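/- Let $d\ge 1$ and let $\psi\in C_c^\infty((-1,1))$ be a (complex-valued) smooth function with compact support in $(-1,1)$. Write $\langle\xi\rangle=(1+|\xi|^2)^{1/2}$ and, for $\kappa\in\mathbb R$, $\varepsilon>0$ and $(x,t)\in\mathbb R^d\times\mathbb R$, put $$\mathcal J_{\kappa,\varepsilon}(x,t)=\int_{\mathbb R^d} e^{i(x\cdot\xi+t\langle\xi\rangle)}\,\psi(\varepsilon|\xi|)\,(1+|\xi|^2)^{-\frac{d+1}{4}-i\kappa}\,\mathrm d\xi .$$ Then there exist constants $C<\infty$ and $N>0$, depending only on $d$ and $\psi$, such that $$|\kappa\,\mathcal J_{\kappa,\varepsilon}(x,t)|\le C(1+|\kappa|)^N|t|^{-\frac{d-1}{2}}$$ for all $\kappa\in\mathbb R$, $\varepsilon>0$ and $(x,t)\in\mathbb R^d\times\mathbb R$, where for $d\ge 2$ and $t=0$ the right-hand side is understood as $+\infty$ (so there is no claim in that case), and for $d=1$ the factor $|t|^{-\frac{d-1}{2}}$ equals $1$ for every $t$, including $t=0$. -/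

import Mathlib

open scoped ContDiff

noncomputable section

/-- The Japanese bracket `⟨ξ⟩ = (1 + |ξ|²)^{1/2}`. -/
def japaneseBracket {d : ℕ} (ξ : EuclideanSpace ℝ (Fin d)) : ℝ :=
  Real.sqrt (1 + ‖ξ‖ ^ 2)

/-- The integrand `e^{i(x·ξ + t⟨ξ⟩)} ψ(ε|ξ|) (1 + |ξ|²)^{-(d+1)/4 - iκ}`. -/
def kleinGordonIntegrand {d : ℕ} (ψ : ℝ → ℂ) (κ ε : ℝ) (x : EuclideanSpace ℝ (Fin d)) (t : ℝ)
    (ξ : EuclideanSpace ℝ (Fin d)) : ℂ :=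
  Complex.exp (Complex.I * ((inner ℝ x ξ + t * japaneseBracket ξ : ℝ) : ℂ)) * ψ (ε * ‖ξ‖) *
    ((1 + ‖ξ‖ ^ 2 : ℝ) : ℂ) ^ (-((d : ℂ) + 1) / 4 - Complex.I * (κ : ℂ))

/-- The oscillatory integral `𝒥_{κ,ε}(x,t)`, integrated over `ℝ^d` with Lebesgue measure. -/
def kleinGordonJ {d : ℕ} (ψ : ℝ → ℂ) (κ ε : ℝ) (x : EuclideanSpace ℝ (Fin d)) (t : ℝ) : ℂ :=
  ∫ ξ : EuclideanSpace ℝ (Fin d), kleinGordonIntegrand ψ κ ε x t ξ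

end

/-!
# A uniform bound for the Klein-Gordon kernel of critical order

Write `n = d - 1`, `s = n/2` and `b = s + 2iκ`. The argument has four ingredients.

*The cut-off is harmless.* Multiplying a symbol by `ψ(ε|ξ|)` enlarges the supremum of its Fourier
integral by at most a constant, uniformly in `ε` (`exists_isSupMultiplier_radial`): Gaussians are
such multipliers, Bochner-Riesz means of large order are superpositions of complex Gaussians, and a
smooth radial function is a superposition of Bochner-Riesz means by Taylor's formula. It remains to
bound the kernel without cut-off but with complex time `t + iδ`, uniformly as `δ → 0`.

*Rapidity.* Splitting `ξ = (ξ₁, η)` along `x` and putting `ξ₁ = ⟨η⟩ sinh θ` turns the kernel into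
`∫ cosh(θ)^{-b} G_b(λ(θ)) dθ` (`oscIntegral_dampedSymbol`), up to a constant. Here
`λ = ((p + iδ) e^θ + (q + iδ) e^{-θ})/2` with `p = t + |x|` and `q = t - |x|`, and
`G_b(λ) = ∫ ρ^{n-1} ⟨ρ⟩^{-b} e^{iλ⟨ρ⟩} dρ`.

*The factor `κ`.* `G_b` is homogeneous of degree `b - n` up to better terms (`radialG_dilation`).
Hence, where `e^θ` dominates in `λ`, the integrand `u` solves `u' = 4iκu + error` with an
absolutely integrable error (`hasDerivAt_coneIntegrand`), and integration by parts bounds `κ ∫ u`.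
Absolute values would lose a logarithm near the light cone, as `|u|` is almost constant between the
point where the two exponentials in `λ` balance and `θ = 0`. Where `e^{-θ}` dominates, `u` decays
exponentially.

*Contours.* For this the phase must have an imaginary part comparable to its size, uniformly in
`δ`. This is achieved by moving the contour to height `1/(2(1+|κ|))`, so that the powers with
exponent `2iκ` remain bounded: along the whole line outside the light cone, and only beyond the
point where the two exponentials balance inside of it. On the part that is not moved, a contour
rotation in the variable `ρ` gives `|G_b(λ)| ≲ |λ|^{-s}` in the whole first quadrant
(`exists_norm_radialG_le_of_quadrant`).

In space dimension one there is no transversal integral, and the oscillation is that of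
`cosh^{-2iκ}` at both ends (`hasDerivAt_neg_tanh_mul_lineIntegrand`).
-/

open MeasureTheory Complex Filter Topology Set
open scoped Real FourierTransform ContDiff

/-! ### Multipliers for the supremum of a Fourier integral -/

section Multipliers

variable {V : Type*} [NormedAddCommGroup V] [InnerProductSpace ℝ V] [FiniteDimensional ℝ V]
  [MeasurableSpace V] [BorelSpace V]

/-- The Fourier integral `∫ e^{i x·ξ} F(ξ) dξ`, without normalising constants. -/
noncomputable def oscIntegral (F : V → ℂ) (x : V) : ℂ :=
  ∫ ξ : V, cexp (I * (inner ℝ x ξ : ℝ)) * F ξ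

/-- Multiplying by `g` on the Fourier side enlarges the supremum of the Fourier integral of an
integrable function by a factor at most `A`. -/
def IsSupMultiplier (g : V → ℂ) (A : ℝ) : Prop :=
  ∀ F : V → ℂ, Integrable F → ∀ B : ℝ, (∀ x, ‖oscIntegral F x‖ ≤ B) →
    ∀ x, ‖oscIntegral (fun ξ => F ξ * g ξ) x‖ ≤ A * B

lemma norm_cexp_I_mul_ofReal (a : ℝ) : ‖cexp (I * (a : ℂ))‖ = 1 := by
  rw [mul_comm, Complex.norm_exp_ofReal_mul_I]

/-- A complex Gaussian is the Fourier transform of a complex Gaussian, so its multiplier bound is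
the `L¹` norm of the latter. -/
lemma isSupMultiplier_gaussian {z : ℂ} (hz : 0 < z.re) :
    IsSupMultiplier (fun ξ : V => cexp (-z * ‖ξ‖ ^ 2))
      ((‖z‖ / z.re) ^ ((Module.finrank ℝ V : ℝ) / 2)) := by
  intro F hF B hB x
  have hz0 : z ≠ 0 := fun h => by simp [h] at hz
  set d : ℝ := (Module.finrank ℝ V : ℝ) with hd
  set w : ℂ := 1 / (4 * z) with hw
  have hwre : w.re = z.re / (4 * ‖z‖ ^ 2) := by
    rw [hw, one_div, Complex.inv_re, Complex.normSq_eq_norm_sq]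
    simp
    field_simp
  have hzn : 0 < ‖z‖ := norm_pos_iff.2 hz0
  have hwpos : 0 < w.re := by rw [hwre]; positivity
  -- `e^{-z|ξ|²}` is the Fourier transform of `c⁻¹ e^{-w|y|²}`
  set c : ℂ := (π / w) ^ ((Module.finrank ℝ V : ℂ) / 2) with hc
  have hpw : (π : ℂ) / w ≠ 0 := by
    have : w ≠ 0 := fun h => by simp [h] at hwpos
    exact div_ne_zero (by exact_mod_cast Real.pi_ne_zero) this
  have hc0 : c ≠ 0 := by
    rw [hc, Ne, Complex.cpow_eq_zero_iff]; exact fun h => hpw h.1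
  have hg : ∀ ξ : V, cexp (-z * ‖ξ‖ ^ 2)
      = c⁻¹ * ∫ y : V, cexp (-w * ‖y‖ ^ 2 + (-I) * (inner ℝ ξ y : ℝ)) := by
    intro ξ
    have h := GaussianFourier.integral_cexp_neg_mul_sq_norm_add hwpos (-I) ξ
    rw [h, ← hc, ← mul_assoc, inv_mul_cancel₀ hc0, one_mul]
    congr 1
    rw [hw]
    simp
    field_simp
  have hnorm : ∀ y : V, ‖cexp (-w * ‖y‖ ^ 2)‖ = Real.exp (-w.re * ‖y‖ ^ 2) := by
    intro y
    rw [Complex.norm_exp]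
    congr 1
    have : (-w * (‖y‖ : ℂ) ^ 2) = (-w) * ((‖y‖ ^ 2 : ℝ) : ℂ) := by push_cast; ring
    rw [this, Complex.re_mul_ofReal]; simp
  have hgint : Integrable (fun y : V => cexp (-w * ‖y‖ ^ 2)) := by
    have := GaussianFourier.integrable_cexp_neg_mul_sq_norm_add hwpos (V := V) 0 0
    simpa using this
  have key : oscIntegral (fun ξ => F ξ * cexp (-z * ‖ξ‖ ^ 2)) x
      = c⁻¹ * ∫ y : V, cexp (-w * ‖y‖ ^ 2) * oscIntegral F (x - y) := by
    unfold oscIntegral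
    have h1 : ∀ ξ : V, cexp (I * (inner ℝ x ξ : ℝ)) * (F ξ * cexp (-z * ‖ξ‖ ^ 2))
        = c⁻¹ * ∫ y : V, cexp (-w * ‖y‖ ^ 2) * (cexp (I * (inner ℝ (x - y) ξ : ℝ)) * F ξ) := by
      intro ξ
      rw [hg ξ]
      have : ∀ y : V, cexp (-w * ‖y‖ ^ 2) * (cexp (I * (inner ℝ (x - y) ξ : ℝ)) * F ξ)
          = (cexp (I * (inner ℝ x ξ : ℝ)) * F ξ) *
            cexp (-w * ‖y‖ ^ 2 + (-I) * (inner ℝ ξ y : ℝ)) := by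
        intro y
        rw [inner_sub_left, Complex.exp_add, Complex.ofReal_sub, mul_sub, sub_eq_add_neg,
          Complex.exp_add, real_inner_comm y ξ, neg_mul]
        ring_nf
      simp_rw [this]
      rw [integral_const_mul]
      ring
    simp_rw [h1]
    rw [integral_const_mul]
    congr 1
    rw [integral_integral_swap]
    · simp_rw [integral_const_mul]
    · have h2 : Integrable (fun q : V × V => F q.1 * cexp (-w * ‖q.2‖ ^ 2)) :=
        hF.mul_prod hgint
      have h3 : Integrable (fun q : V × V =>
          cexp (I * (inner ℝ (x - q.2) q.1 : ℝ)) * (F q.1 * cexp (-w * ‖q.2‖ ^ 2))) := by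
        refine h2.bdd_mul (c := 1) ?_ (Eventually.of_forall fun q => ?_)
        · exact Continuous.aestronglyMeasurable (by fun_prop)
        · rw [norm_cexp_I_mul_ofReal]
      refine h3.congr (Eventually.of_forall fun q => ?_)
      simp only [Function.uncurry]; ring
  rw [key, norm_mul, norm_inv]
  have hcn : ‖c‖ = (π * 4 * ‖z‖) ^ (d / 2) := by
    have : (Module.finrank ℝ V : ℂ) / 2 = ((d / 2 : ℝ) : ℂ) := by rw [hd]; push_cast; ring
    rw [hc, this, Complex.norm_cpow_real, hw]
    congr 1
    simp only [one_div, norm_mul, Complex.norm_real, Real.norm_eq_abs,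
      abs_of_pos Real.pi_pos, Complex.norm_ofNat, div_inv_eq_mul]
    ring
  have hbound : ‖∫ y : V, cexp (-w * ‖y‖ ^ 2) * oscIntegral F (x - y)‖
      ≤ (π / w.re) ^ (d / 2) * B := by
    have hint := GaussianFourier.integral_rexp_neg_mul_sq_norm (V := V) hwpos
    rw [← hd] at hint
    rw [← hint, ← integral_mul_const]
    refine norm_integral_le_of_norm_le ?_ (Eventually.of_forall fun y => ?_)
    · refine Integrable.mul_const ?_ _
      refine hgint.norm.congr (Eventually.of_forall fun y => ?_)
      exact hnorm y
    · rw [norm_mul, hnorm]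
      exact mul_le_mul_of_nonneg_left (hB _) (Real.exp_pos _).le
  refine (mul_le_mul_of_nonneg_left hbound (by positivity)).trans (le_of_eq ?_)
  rw [hcn, ← mul_assoc, ← Real.inv_rpow (by positivity), ← Real.mul_rpow (by positivity) (by positivity), hwre]
  congr 2
  field_simp

/-- Superpositions of multipliers. -/
lemma IsSupMultiplier.integral {Ω : Type*} [MeasurableSpace Ω] {ν : Measure Ω} [SFinite ν]
    {g : Ω → V → ℂ} {a : Ω → ℝ} (ha : Integrable a ν)
    (hg : AEStronglyMeasurable (fun q : V × Ω => g q.2 q.1) ((volume : Measure V).prod ν))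
    (hb : ∀ᵐ w ∂ν, ∀ ξ, ‖g w ξ‖ ≤ a w) (hm : ∀ᵐ w ∂ν, IsSupMultiplier (g w) (a w)) :
    IsSupMultiplier (fun ξ => ∫ w, g w ξ ∂ν) (∫ w, a w ∂ν) := by
  intro F hF B hB x
  have key : oscIntegral (fun ξ => F ξ * ∫ w, g w ξ ∂ν) x
      = ∫ w, oscIntegral (fun ξ => F ξ * g w ξ) x ∂ν := by
    unfold oscIntegral
    rw [← integral_integral_swap]
    · refine integral_congr_ae (Eventually.of_forall fun ξ => ?_)
      simp only
      rw [integral_const_mul, integral_const_mul]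
    · have h2 : Integrable (fun q : V × Ω => ‖F q.1‖ * a q.2) (volume.prod ν) :=
        hF.norm.mul_prod ha
      have hb' : ∀ᵐ q : V × Ω ∂(volume.prod ν), ∀ ξ, ‖g q.2 ξ‖ ≤ a q.2 :=
        Measure.quasiMeasurePreserving_snd.ae hb
      refine h2.mono' ?_ (hb'.mono fun q hq => ?_)
      · have hx : Continuous fun ξ : V => cexp (I * (inner ℝ x ξ : ℝ)) := by fun_prop
        refine AEStronglyMeasurable.mul (hx.aestronglyMeasurable.comp_fst) ?_
        exact hF.aestronglyMeasurable.comp_fst.mul hg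
      · simp only [Function.uncurry]
        rw [norm_mul, norm_mul, norm_cexp_I_mul_ofReal, one_mul]
        exact mul_le_mul_of_nonneg_left (hq _) (norm_nonneg _)
  rw [key, ← integral_mul_const]
  exact norm_integral_le_of_norm_le (ha.mul_const _)
    (hm.mono fun w hw => hw F hF B hB x)

lemma IsSupMultiplier.mono {g : V → ℂ} {A A' : ℝ} (h : IsSupMultiplier g A) (hA : A ≤ A') :
    IsSupMultiplier g A' := by
  intro F hF B hB x
  exact (h F hF B hB x).trans (mul_le_mul_of_nonneg_right hA ((norm_nonneg _).trans (hB 0)))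

lemma IsSupMultiplier.const_mul {g : V → ℂ} {A : ℝ} (h : IsSupMultiplier g A) (c : ℂ) :
    IsSupMultiplier (fun ξ => c * g ξ) (‖c‖ * A) := by
  intro F hF B hB x
  have : oscIntegral (fun ξ => F ξ * (c * g ξ)) x = c * oscIntegral (fun ξ => F ξ * g ξ) x := by
    unfold oscIntegral
    rw [← integral_const_mul]
    congr 1; ext ξ; ring
  rw [this, norm_mul, mul_assoc]
  exact mul_le_mul_of_nonneg_left (h F hF B hB x) (norm_nonneg _)

lemma IsSupMultiplier.congr_ae {g g' : V → ℂ} {A : ℝ} (h : IsSupMultiplier g A)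
    (hg : g =ᵐ[volume] g') : IsSupMultiplier g' A := by
  intro F hF B hB x
  have : oscIntegral (fun ξ => F ξ * g' ξ) x = oscIntegral (fun ξ => F ξ * g ξ) x := by
    unfold oscIntegral
    refine integral_congr_ae ?_
    filter_upwards [hg] with ξ hξ
    rw [hξ]
  rw [this]
  exact h F hF B hB x

end Multipliers

/-! ### Truncated powers and Taylor expansion from the far end -/

section TruncatedPower

lemma integrableOn_pow_mul_exp_neg_mul {ζ : ℂ} (hζ : 0 < ζ.re) (m : ℕ) :
    IntegrableOn (fun u : ℝ => (u : ℂ) ^ m * cexp (-ζ * u)) (Ioi 0) := by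
  have h := integrableOn_rpow_mul_exp_neg_mul_rpow (s := m) (p := 1) (b := ζ.re)
    (by have := Nat.cast_nonneg (α := ℝ) m; linarith) one_pos hζ
  refine Integrable.mono' h (Continuous.aestronglyMeasurable (by fun_prop)) ?_
  refine (ae_restrict_iff' measurableSet_Ioi).2 (Eventually.of_forall fun u hu => ?_)
  rw [norm_mul, norm_pow, Complex.norm_real, Real.norm_of_nonneg (le_of_lt hu), Complex.norm_exp,
    Complex.re_mul_ofReal]
  simp

/-- Euler's integral for the Gamma function at an integer, with a complex rate. -/
lemma integral_pow_mul_exp_neg_mul {ζ : ℂ} (hζ : 0 < ζ.re) (m : ℕ) :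
    ∫ u : ℝ in Ioi 0, (u : ℂ) ^ m * cexp (-ζ * u) = (m.factorial : ℂ) / ζ ^ (m + 1) := by
  have hζ0 : ζ ≠ 0 := fun h => by simp [h] at hζ
  induction m with
  | zero =>
    have := integral_exp_mul_complex_Ioi (a := -ζ) (by simpa using hζ) 0
    simp only [pow_zero, one_mul]
    rw [this]
    simp
  | succ m ih =>
    have hd : ∀ u ∈ Ici (0 : ℝ), HasDerivAt (fun u : ℝ => (u : ℂ) ^ (m + 1) * cexp (-ζ * u))
        (((m : ℂ) + 1) * ((u : ℂ) ^ m * cexp (-ζ * u))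
          - ζ * ((u : ℂ) ^ (m + 1) * cexp (-ζ * u))) u := by
      intro u _
      have h1 : HasDerivAt (fun u : ℂ => u ^ (m + 1) * cexp (-ζ * u))
          (((m : ℂ) + 1) * ((u : ℂ) ^ m * cexp (-ζ * u))
          - ζ * ((u : ℂ) ^ (m + 1) * cexp (-ζ * u))) (u : ℂ) := by
        have h2 := (hasDerivAt_pow (m + 1) (u : ℂ)).mul
          (((hasDerivAt_id (u : ℂ)).const_mul (-ζ)).cexp)
        refine h2.congr_deriv ?_
        push_cast
        simp only [id]
        ring
      exact h1.comp_ofReal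
    have hi := integrableOn_pow_mul_exp_neg_mul hζ
    have hlim : Tendsto (fun u : ℝ => (u : ℂ) ^ (m + 1) * cexp (-ζ * u)) atTop (𝓝 0) := by
      rw [tendsto_zero_iff_norm_tendsto_zero]
      have h := tendsto_rpow_mul_exp_neg_mul_atTop_nhds_zero ((m + 1 : ℕ) : ℝ) ζ.re hζ
      refine h.congr' ?_
      filter_upwards [eventually_ge_atTop 0] with u hu
      rw [norm_mul, norm_pow, Complex.norm_real, Real.norm_of_nonneg hu, Complex.norm_exp,
        Complex.re_mul_ofReal, Real.rpow_natCast]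
      simp
    have h := integral_Ioi_of_hasDerivAt_of_tendsto' hd
      (((hi m).const_mul _).sub ((hi (m + 1)).const_mul _)) hlim
    rw [integral_sub ((hi m).const_mul _) ((hi (m + 1)).const_mul _), integral_const_mul,
      integral_const_mul, ih] at h
    simp at h
    rw [sub_eq_zero] at h
    rw [eq_div_iff (pow_ne_zero _ hζ0), Nat.factorial_succ]
    have : (∫ u : ℝ in Ioi 0, (u : ℂ) ^ (m + 1) * cexp (-ζ * u)) * ζ ^ (m + 1 + 1)
        = ζ ^ (m + 1) * (ζ * ∫ u : ℝ in Ioi 0, (u : ℂ) ^ (m + 1) * cexp (-ζ * u)) := by ring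
    rw [this]
    simp only [neg_mul]
    rw [← h]
    push_cast
    field_simp

/-- Laplace inversion for the truncated power `u ↦ max(u,0)^(k+1)`. -/
lemma truncatedPower_eq_integral (k : ℕ) (u : ℝ) :
    ((max u 0 : ℝ) : ℂ) ^ (k + 1) = ∫ w : ℝ, cexp ((1 + 2 * π * w * I) * u) *
      (((k + 1).factorial : ℂ) / (1 + 2 * π * w * I) ^ (k + 2)) := by
  set f : ℝ → ℂ := fun u => ((max u 0 : ℝ) : ℂ) ^ (k + 1) * cexp (-(1 : ℂ) * u) with hf
  have hfc : Continuous f := by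
    have : Continuous fun u : ℝ => ((max u 0 : ℝ) : ℂ) :=
      Complex.continuous_ofReal.comp (continuous_id.max continuous_const)
    fun_prop
  have hfe : f = (Ioi 0).indicator (fun u : ℝ => (u : ℂ) ^ (k + 1) * cexp (-(1 : ℂ) * u)) := by
    ext u
    by_cases hu : 0 < u
    · rw [indicator_of_mem (mem_Ioi.2 hu)]; simp [hf, max_eq_left hu.le]
    · rw [indicator_of_notMem (notMem_Ioi.2 (not_lt.1 hu))]; simp [hf, max_eq_right (not_lt.1 hu)]
  have hfi : Integrable f := by
    rw [hfe, integrable_indicator_iff measurableSet_Ioi]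
    exact integrableOn_pow_mul_exp_neg_mul (by simp) _
  have hζre : ∀ w : ℝ, (1 + 2 * π * w * I : ℂ).re = 1 := by intro w; simp
  have hF : 𝓕 f = fun w : ℝ => ((k + 1).factorial : ℂ) / (1 + 2 * π * w * I) ^ (k + 2) := by
    ext w
    rw [Real.fourier_real_eq_integral_exp_smul]
    have h := integral_pow_mul_exp_neg_mul (ζ := 1 + 2 * π * w * I) (by rw [hζre]; norm_num) (k + 1)
    rw [← h, hfe, ← integral_indicator measurableSet_Ioi]
    congr 1; ext u
    by_cases hu : u ∈ Ioi (0 : ℝ)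
    · rw [indicator_of_mem hu, indicator_of_mem hu, smul_eq_mul, mul_left_comm, ← Complex.exp_add]
      congr 2
      push_cast
      ring
    · rw [indicator_of_notMem hu, indicator_of_notMem hu, smul_zero]
  have hnz : ∀ w : ℝ, (1 + 2 * π * w * I : ℂ) ≠ 0 := fun w h => by
    have := hζre w; rw [h] at this; simp at this
  have hFi : Integrable (𝓕 f) := by
    have h1 : Integrable fun w : ℝ => ((k + 1).factorial : ℝ) * (1 + (2 * π * w) ^ 2)⁻¹ :=
      ((integrable_inv_one_add_sq).comp_mul_left' (R := 2 * π) (by positivity)).const_mul _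
    refine h1.mono' ?_ (Eventually.of_forall fun w => ?_)
    · rw [hF]
      refine Continuous.aestronglyMeasurable ?_
      exact continuous_const.div (by fun_prop) fun w => pow_ne_zero _ (hnz w)
    · rw [hF]
      simp only [norm_div, norm_pow, Complex.norm_natCast]
      rw [div_eq_mul_inv]
      refine mul_le_mul_of_nonneg_left ?_ (by positivity)
      have hsq : ‖(1 + 2 * π * w * I : ℂ)‖ ^ 2 = 1 + (2 * π * w) ^ 2 := by
        rw [← Complex.normSq_eq_norm_sq, Complex.normSq_apply]; simp; ring
      have h1 : (1 : ℝ) ≤ ‖(1 + 2 * π * w * I : ℂ)‖ := by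
        have := Complex.abs_re_le_norm (1 + 2 * π * w * I : ℂ)
        rw [hζre] at this; simpa using this
      rw [← hsq]
      exact inv_anti₀ (by positivity) (pow_le_pow_right₀ h1 (by omega : 2 ≤ k + 2))
  have hinv := congrFun (hfc.fourierInv_fourier_eq hfi hFi) u
  rw [Real.fourierInv_eq', hF] at hinv
  have hfu : ((max u 0 : ℝ) : ℂ) ^ (k + 1) = cexp u * f u := by
    simp only [hf]
    rw [mul_left_comm, ← Complex.exp_add]
    simp
  rw [hfu, ← hinv, ← integral_const_mul]
  congr 1; ext w
  rw [smul_eq_mul, ← mul_assoc, ← Complex.exp_add]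
  congr 2
  simp
  ring

/-- A function continuous on `[a, ∞)` and vanishing beyond some point is integrable there. -/
lemma integrableOn_Ioi_of_continuousOn_of_eq_zero {f : ℝ → ℂ} {a c : ℝ}
    (hf : ContinuousOn f (Ici a)) (h0 : ∀ x, c ≤ x → f x = 0) : IntegrableOn f (Ioi a) := by
  have h1 : IntegrableOn f (Icc a c) := (hf.mono Icc_subset_Ici_self).integrableOn_Icc
  have h2 : IntegrableOn f (Ioi c) :=
    (integrableOn_zero (μ := volume)).congr_fun (fun x hx => (h0 x (le_of_lt hx)).symm)
      measurableSet_Ioi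
  refine (h1.union h2).mono_set fun x hx => ?_
  rcases le_or_gt x c with h | h
  · exact Or.inl ⟨le_of_lt hx, h⟩
  · exact Or.inr h

variable (ψ : ℝ → ℂ)

/-- The profiles of the derivatives of `β ↦ ψ(√β)`: its derivative of order `k + 1` is
`β^(-1/2-k) φ_k(√β)`, where `φ_0 = ψ'/2` and `φ_{k+1}(σ) = (-1/2-k) φ_k(σ) + (σ/2) φ_k'(σ)`. -/
noncomputable def sqrtDerivProfile : ℕ → ℝ → ℂ
  | 0 => fun σ => deriv ψ σ / 2
  | k + 1 => fun σ => (-1 / 2 - k : ℂ) * sqrtDerivProfile k σ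
      + (σ : ℂ) / 2 * deriv (sqrtDerivProfile k) σ

/-- The derivative of order `k + 1` of `β ↦ ψ(√β)` on `β > 0`. -/
noncomputable def sqrtDeriv (k : ℕ) (β : ℝ) : ℂ :=
  ((β ^ (-1 / 2 - k : ℝ) : ℝ) : ℂ) * sqrtDerivProfile ψ k (√β)

variable {ψ}

lemma contDiff_sqrtDerivProfile (hψ : ContDiff ℝ ∞ ψ) (k : ℕ) :
    ContDiff ℝ ∞ (sqrtDerivProfile ψ k) := by
  induction k with
  | zero =>
    exact (((contDiff_infty_iff_deriv).1 hψ).2).div_const _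
  | succ k ih =>
    have h1 : ContDiff ℝ ∞ (deriv (sqrtDerivProfile ψ k)) := ((contDiff_infty_iff_deriv).1 ih).2
    have h2 : ContDiff ℝ ∞ (fun σ : ℝ => (σ : ℂ)) := Complex.ofRealCLM.contDiff
    exact (contDiff_const.mul ih).add ((h2.div_const _).mul h1)

lemma sqrtDerivProfile_eventuallyEq_zero {σ : ℝ} (h : ψ =ᶠ[𝓝 σ] 0) (k : ℕ) :
    sqrtDerivProfile ψ k =ᶠ[𝓝 σ] 0 := by
  induction k with
  | zero =>
    have := h.deriv
    filter_upwards [this] with x hx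
    simp [sqrtDerivProfile, hx]
  | succ k ih =>
    have := ih.deriv
    filter_upwards [this, ih] with x hx hx2
    simp [sqrtDerivProfile, hx, hx2]

lemma sqrtDeriv_eq_zero (hsupp : tsupport ψ ⊆ Ioo (-1 : ℝ) 1) (k : ℕ) {β : ℝ} (hβ : 1 ≤ β) :
    sqrtDeriv ψ k β = 0 := by
  have h : ψ =ᶠ[𝓝 (√β)] 0 := by
    refine notMem_tsupport_iff_eventuallyEq.1 fun hh => ?_
    have := (hsupp hh).2
    rw [Real.sqrt_lt' one_pos] at this
    linarith
  simp [sqrtDeriv, (sqrtDerivProfile_eventuallyEq_zero h k).eq_of_nhds]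

lemma hasDerivAt_comp_sqrt (hψ : ContDiff ℝ ∞ ψ) {β : ℝ} (hβ : 0 < β) :
    HasDerivAt (fun β => ψ (√β)) (sqrtDeriv ψ 0 β) β := by
  have h1 : HasDerivAt ψ (deriv ψ (√β)) (√β) :=
    (hψ.differentiable (by simp)).differentiableAt.hasDerivAt
  have h2 := h1.scomp β (Real.hasDerivAt_sqrt hβ.ne')
  refine h2.congr_deriv ?_
  simp only [sqrtDeriv, sqrtDerivProfile, Nat.cast_zero, sub_zero]
  rw [neg_div, Real.rpow_neg hβ.le, ← Real.sqrt_eq_rpow, Complex.real_smul]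
  push_cast
  ring

lemma hasDerivAt_sqrtDeriv (hψ : ContDiff ℝ ∞ ψ) (k : ℕ) {β : ℝ} (hβ : 0 < β) :
    HasDerivAt (sqrtDeriv ψ k) (sqrtDeriv ψ (k + 1) β) β := by
  have h1 : HasDerivAt (sqrtDerivProfile ψ k) (deriv (sqrtDerivProfile ψ k) (√β)) (√β) :=
    ((contDiff_sqrtDerivProfile hψ k).differentiable (by simp)).differentiableAt.hasDerivAt
  have h2 := h1.scomp β (Real.hasDerivAt_sqrt hβ.ne')
  have h3 := (Real.hasDerivAt_rpow_const (x := β) (p := -1 / 2 - k) (Or.inl hβ.ne')).ofReal_comp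
  refine (h3.mul h2).congr_deriv ?_
  simp only [sqrtDeriv, sqrtDerivProfile]
  have e1 : β ^ (-1 / 2 - ((k + 1 : ℕ) : ℝ)) = β ^ (-1 / 2 - k - 1 : ℝ) := by
    congr 1; push_cast; ring
  have e2 : β ^ (-1 / 2 - k : ℝ) = β ^ (-1 / 2 - k - 1 : ℝ) * β := by
    rw [← Real.rpow_add_one hβ.ne']; congr 1; ring
  have e3 : (√β) ≠ 0 := (Real.sqrt_pos.2 hβ).ne'
  have e4 : (β : ℂ) = (√β : ℂ) * (√β : ℂ) := by
    rw [← Complex.ofReal_mul, Real.mul_self_sqrt hβ.le]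
  have e5 : (√β : ℂ) ≠ 0 := by exact_mod_cast e3
  rw [e1, e2, Complex.real_smul]
  push_cast
  simp only [Function.comp_apply]
  rw [e4]
  field_simp

/-- Taylor's formula for `β ↦ ψ(√β)` with the remainder taken from the far end, where `ψ` vanishes:
it writes the radial function as a superposition of truncated powers. -/
lemma comp_sqrt_eq_integral (hψ : ContDiff ℝ ∞ ψ) (hsupp : tsupport ψ ⊆ Ioo (-1 : ℝ) 1)
    (m : ℕ) {a : ℝ} (ha : 0 < a) :
    ψ (√a) = (-1) ^ (m + 1) / (m.factorial : ℂ) *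
      ∫ β in Ioi a, ((β - a : ℝ) : ℂ) ^ m * sqrtDeriv ψ m β := by
  have hcont : ∀ k, ContinuousOn (sqrtDeriv ψ k) (Ici a) := fun k β hβ =>
    (hasDerivAt_sqrtDeriv hψ k (ha.trans_le hβ)).continuousAt.continuousWithinAt
  have hpc : ∀ k : ℕ, Continuous fun β : ℝ => ((β - a : ℝ) : ℂ) ^ k := fun k => by fun_prop
  have hint : ∀ k l : ℕ, IntegrableOn (fun β : ℝ => ((β - a : ℝ) : ℂ) ^ k * sqrtDeriv ψ l β)
      (Ioi a) := fun k l =>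
    integrableOn_Ioi_of_continuousOn_of_eq_zero (c := 1) ((hpc k).continuousOn.mul (hcont l))
      fun x hx => by rw [sqrtDeriv_eq_zero hsupp l hx, mul_zero]
  induction m with
  | zero =>
    have hlim : Tendsto (fun β => ψ (√β)) atTop (𝓝 0) := by
      refine tendsto_const_nhds.congr' ?_
      filter_upwards [eventually_ge_atTop 1] with β hβ
      refine (image_eq_zero_of_notMem_tsupport fun hh => ?_).symm
      have := (hsupp hh).2
      rw [Real.sqrt_lt' one_pos] at this
      linarith
    have h := integral_Ioi_of_hasDerivAt_of_tendsto'
      (fun β hβ => hasDerivAt_comp_sqrt hψ (ha.trans_le hβ)) (by simpa using hint 0 0) hlim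
    simp [h]
  | succ m ih =>
    have hlim : Tendsto (fun β : ℝ => ((β - a : ℝ) : ℂ) ^ (m + 1) * sqrtDeriv ψ m β)
        atTop (𝓝 0) := by
      refine tendsto_const_nhds.congr' ?_
      filter_upwards [eventually_ge_atTop 1] with β hβ
      rw [sqrtDeriv_eq_zero hsupp m hβ, mul_zero]
    have hd : ∀ β ∈ Ici a, HasDerivAt (fun β : ℝ => ((β - a : ℝ) : ℂ) ^ (m + 1) * sqrtDeriv ψ m β)
        (((m : ℂ) + 1) * (((β - a : ℝ) : ℂ) ^ m * sqrtDeriv ψ m β)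
          + ((β - a : ℝ) : ℂ) ^ (m + 1) * sqrtDeriv ψ (m + 1) β) β := by
      intro β hβ
      have h1 : HasDerivAt (fun β : ℝ => ((β - a : ℝ) : ℂ)) 1 β := by
        simpa using ((hasDerivAt_id β).sub_const a).ofReal_comp
      have h2 : HasDerivAt (fun β : ℝ => ((β - a : ℝ) : ℂ) ^ (m + 1))
          (((m : ℂ) + 1) * ((β - a : ℝ) : ℂ) ^ m) β := by
        exact (h1.fun_pow (m + 1)).congr_deriv (by push_cast; simp)
      refine (h2.mul (hasDerivAt_sqrtDeriv hψ m (ha.trans_le hβ))).congr_deriv ?_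
      ring
    have h := integral_Ioi_of_hasDerivAt_of_tendsto' hd
      (((hint m m).const_mul _).add (hint (m + 1) (m + 1))) hlim
    rw [integral_add ((hint m m).const_mul _) (hint (m + 1) (m + 1)), integral_const_mul] at h
    simp at h
    simp only [ofReal_sub] at ih ⊢
    rw [ih, Nat.factorial_succ]
    rw [← eq_neg_iff_add_eq_zero] at h
    have hm : (m : ℂ) + 1 ≠ 0 := by exact_mod_cast Nat.succ_ne_zero m
    have hf : (m.factorial : ℂ) ≠ 0 := by exact_mod_cast Nat.factorial_ne_zero m
    push_cast
    rw [← neg_eq_iff_eq_neg] at h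
    rw [← h]
    field_simp
    ring

end TruncatedPower

/-! ### Smooth radial cut-offs are multipliers -/

section RadialMultiplier

variable {V : Type*} [NormedAddCommGroup V] [InnerProductSpace ℝ V] [FiniteDimensional ℝ V]
  [MeasurableSpace V] [BorelSpace V]

/-- Bochner–Riesz means of large order are multipliers, uniformly in the scale. -/
lemma isSupMultiplier_truncatedPower :
    ∃ A : ℝ, 1 ≤ A ∧ ∀ c : ℝ, 0 < c → IsSupMultiplier
      (fun ξ : V => ((max (1 - c * ‖ξ‖ ^ 2) 0 : ℝ) : ℂ) ^ (Module.finrank ℝ V + 1)) A := by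
  set k := Module.finrank ℝ V with hk
  set ζ : ℝ → ℂ := fun w => 1 + 2 * π * w * I with hζ
  have hζre : ∀ w : ℝ, (ζ w).re = 1 := by intro w; simp [hζ]
  have hζ1 : ∀ w : ℝ, (1 : ℝ) ≤ ‖ζ w‖ := fun w => by
    have := Complex.abs_re_le_norm (ζ w)
    rw [hζre] at this; simpa using this
  have hnz : ∀ w : ℝ, ζ w ≠ 0 := fun w h => by
    have := hζre w; rw [h] at this; simp at this
  have hζc : Continuous ζ := by rw [hζ]; fun_prop
  have hsq : ∀ w : ℝ, ‖ζ w‖ ^ 2 = 1 + (2 * π * w) ^ 2 := fun w => by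
    rw [← Complex.normSq_eq_norm_sq, Complex.normSq_apply]; simp [hζ]; ring
  set a : ℝ → ℝ := fun w => Real.exp 1 * ((k + 1).factorial : ℝ) * (‖ζ w‖ ^ 2)⁻¹ with ha
  have hai : Integrable a := by
    have h1 : Integrable fun w : ℝ => (Real.exp 1 * ((k + 1).factorial : ℝ)) *
        (1 + (2 * π * w) ^ 2)⁻¹ :=
      ((integrable_inv_one_add_sq).comp_mul_left' (R := 2 * π) (by positivity)).const_mul _
    refine h1.congr (Eventually.of_forall fun w => ?_)
    simp only [ha, hsq]
  refine ⟨max 1 (∫ w, a w), le_max_left _ _, fun c hc => ?_⟩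
  refine IsSupMultiplier.mono ?_ (le_max_right _ _)
  have hrep : (fun ξ : V => ((max (1 - c * ‖ξ‖ ^ 2) 0 : ℝ) : ℂ) ^ (k + 1))
      = fun ξ : V => ∫ w : ℝ, cexp (ζ w * ((1 - c * ‖ξ‖ ^ 2 : ℝ) : ℂ)) *
        (((k + 1).factorial : ℂ) / ζ w ^ (k + 2)) := by
    ext ξ
    exact truncatedPower_eq_integral k _
  rw [hrep]
  refine IsSupMultiplier.integral
    (g := fun w ξ => cexp (ζ w * ((1 - c * ‖ξ‖ ^ 2 : ℝ) : ℂ)) *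
        (((k + 1).factorial : ℂ) / ζ w ^ (k + 2))) hai ?_ (Eventually.of_forall fun w ξ => ?_)
    (Eventually.of_forall fun w => ?_)
  · refine Continuous.aestronglyMeasurable ?_
    refine Continuous.mul (by fun_prop) ?_
    exact continuous_const.div (by fun_prop) fun q => pow_ne_zero _ (hnz _)
  · rw [norm_mul, Complex.norm_exp, Complex.re_mul_ofReal, hζre, norm_div, norm_pow,
      Complex.norm_natCast]
    have h1 : Real.exp (1 * (1 - c * ‖ξ‖ ^ 2)) ≤ Real.exp 1 :=
      Real.exp_le_exp.2 (by nlinarith [mul_nonneg hc.le (sq_nonneg ‖ξ‖)])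
    have h2 : ((k + 1).factorial : ℝ) / ‖ζ w‖ ^ (k + 2)
        ≤ ((k + 1).factorial : ℝ) * (‖ζ w‖ ^ 2)⁻¹ := by
      rw [div_eq_mul_inv]
      refine mul_le_mul_of_nonneg_left (inv_anti₀ ?_ ?_) (by positivity)
      · have := hζ1 w; positivity
      · exact pow_le_pow_right₀ (hζ1 w) (by omega)
    simp only [ha]
    rw [mul_assoc]
    exact mul_le_mul h1 h2 (by positivity) (by positivity)
  · have hz : 0 < (ζ w * c).re := by rw [Complex.re_mul_ofReal, hζre]; simpa using hc
    have h := (isSupMultiplier_gaussian (V := V) hz).const_mul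
      (cexp (ζ w) * (((k + 1).factorial : ℂ) / ζ w ^ (k + 2)))
    have hfun : (fun ξ : V => cexp (ζ w * ((1 - c * ‖ξ‖ ^ 2 : ℝ) : ℂ)) *
        (((k + 1).factorial : ℂ) / ζ w ^ (k + 2)))
        = fun ξ : V => cexp (ζ w) * (((k + 1).factorial : ℂ) / ζ w ^ (k + 2)) *
          cexp (-(ζ w * c) * ‖ξ‖ ^ 2) := by
      ext ξ
      rw [mul_right_comm, ← Complex.exp_add]
      congr 2
      push_cast
      ring
    rw [hfun]
    refine h.mono ?_
    rw [Complex.re_mul_ofReal, hζre, one_mul, norm_mul, norm_mul, Complex.norm_exp, hζre, norm_div,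
      norm_pow, Complex.norm_natCast, Complex.norm_real, Real.norm_of_nonneg hc.le,
      mul_div_cancel_right₀ _ hc.ne']
    simp only [ha]
    have h1 := hζ1 w
    have h2 : ‖ζ w‖ ^ ((k : ℝ) / 2) ≤ ‖ζ w‖ ^ k := by
      rw [← Real.rpow_natCast]
      refine Real.rpow_le_rpow_of_exponent_le h1 ?_
      have := Nat.cast_nonneg (α := ℝ) k
      linarith
    calc Real.exp 1 * (((k + 1).factorial : ℝ) / ‖ζ w‖ ^ (k + 2)) * ‖ζ w‖ ^ ((k : ℝ) / 2)
        ≤ Real.exp 1 * (((k + 1).factorial : ℝ) / ‖ζ w‖ ^ (k + 2)) * ‖ζ w‖ ^ k := by gcongr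
      _ = Real.exp 1 * ((k + 1).factorial : ℝ) * (‖ζ w‖ ^ 2)⁻¹ := by
        rw [pow_add]; field_simp

lemma integrableOn_pow_mul_sqrtDeriv {ψ : ℝ → ℂ} (hψ : ContDiff ℝ ∞ ψ)
    (hsupp : tsupport ψ ⊆ Ioo (-1 : ℝ) 1) (m : ℕ) :
    IntegrableOn (fun β : ℝ => ((β : ℝ) : ℂ) ^ m * sqrtDeriv ψ m β) (Ioi 0) := by
  obtain ⟨M, hM⟩ := (isCompact_Icc (a := (0 : ℝ)) (b := 1)).exists_bound_of_continuousOn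
    (contDiff_sqrtDerivProfile hψ m).continuous.continuousOn
  have hc : ContinuousOn (fun β : ℝ => ((β : ℝ) : ℂ) ^ m * sqrtDeriv ψ m β) (Ioi 0) := by
    refine ContinuousOn.mul (Continuous.continuousOn (by fun_prop)) fun β hβ => ?_
    exact (hasDerivAt_sqrtDeriv hψ m hβ).continuousAt.continuousWithinAt
  have h1 : IntegrableOn (fun β : ℝ => ((β : ℝ) : ℂ) ^ m * sqrtDeriv ψ m β) (Ioc 0 1) := by
    have h2 : IntegrableOn (fun β : ℝ => M * β ^ (-1 / 2 : ℝ)) (Ioc 0 1) :=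
      ((intervalIntegrable_iff_integrableOn_Ioc_of_le zero_le_one).1
        (intervalIntegral.intervalIntegrable_rpow' (by norm_num))).const_mul M
    refine Integrable.mono' h2
      ((hc.mono Ioc_subset_Ioi_self).aestronglyMeasurable measurableSet_Ioc) ?_
    refine (ae_restrict_iff' measurableSet_Ioc).2 (Eventually.of_forall fun β hβ => ?_)
    have hβ0 : 0 < β := hβ.1
    rw [sqrtDeriv, norm_mul, norm_mul, norm_pow, Complex.norm_real, Complex.norm_real,
      Real.norm_of_nonneg hβ0.le, Real.norm_of_nonneg (by positivity), ← mul_assoc,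
      ← Real.rpow_natCast, ← Real.rpow_add hβ0]
    have e : (m : ℝ) + (-1 / 2 - m) = -1 / 2 := by ring
    rw [e, mul_comm]
    exact mul_le_mul_of_nonneg_right (hM _ ⟨Real.sqrt_nonneg _, Real.sqrt_le_one.2 hβ.2⟩)
      (by positivity)
  have h3 : IntegrableOn (fun β : ℝ => ((β : ℝ) : ℂ) ^ m * sqrtDeriv ψ m β) (Ioi 1) :=
    (integrableOn_zero (μ := volume)).congr_fun
      (fun x hx => by rw [sqrtDeriv_eq_zero hsupp m (le_of_lt hx), mul_zero]) measurableSet_Ioi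
  refine (h1.union h3).mono_set fun x hx => ?_
  rcases le_or_gt x 1 with h | h
  · exact Or.inl ⟨hx, h⟩
  · exact Or.inr h

/-- A radial cut-off `ψ(ε|ξ|)` is a multiplier, uniformly in `ε`, even though it may fail to be
smooth at the origin. -/
theorem exists_isSupMultiplier_radial [Nontrivial V] {ψ : ℝ → ℂ} (hψ : ContDiff ℝ ∞ ψ)
    (hsupp : tsupport ψ ⊆ Ioo (-1 : ℝ) 1) :
    ∃ A : ℝ, 0 ≤ A ∧ ∀ ε : ℝ, 0 < ε → IsSupMultiplier (fun ξ : V => ψ (ε * ‖ξ‖)) A := by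
  obtain ⟨A, hA1, hA⟩ := isSupMultiplier_truncatedPower (V := V)
  set m := Module.finrank ℝ V + 1 with hm
  set h : ℝ → ℂ := fun β => (β : ℂ) ^ m * sqrtDeriv ψ m β with hh
  have hint : IntegrableOn h (Ioi 0) := integrableOn_pow_mul_sqrtDeriv hψ hsupp m
  set K : ℂ := (-1) ^ (m + 1) / (m.factorial : ℂ) with hK
  refine ⟨‖K‖ * ∫ β in Ioi 0, ‖h β‖ * A, by positivity, fun ε hε => ?_⟩
  have hmult := IsSupMultiplier.integral (V := V) (ν := volume.restrict (Ioi (0 : ℝ)))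
    (g := fun β ξ => h β * ((max (1 - ε ^ 2 / β * ‖ξ‖ ^ 2) 0 : ℝ) : ℂ) ^ m)
    (a := fun β => ‖h β‖ * A) (hint.norm.mul_const A) ?_ ?_ ?_
  · refine (hmult.const_mul K).congr_ae ?_
    have hae : ∀ᵐ ξ : V, ξ ≠ 0 := by simp [ae_iff]
    filter_upwards [hae] with ξ hξ
    have hρ : 0 < ‖ξ‖ := norm_pos_iff.2 hξ
    have ha : 0 < (ε * ‖ξ‖) ^ 2 := by positivity
    have h1 := comp_sqrt_eq_integral hψ hsupp m ha
    rw [Real.sqrt_sq (by positivity)] at h1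
    rw [h1, ← hK]
    congr 1
    rw [← integral_indicator measurableSet_Ioi, ← integral_indicator measurableSet_Ioi]
    congr 1
    ext β
    by_cases hβ : β ∈ Ioi ((ε * ‖ξ‖) ^ 2)
    · have hβ0 : 0 < β := ha.trans hβ
      rw [indicator_of_mem hβ, indicator_of_mem (mem_Ioi.2 hβ0), max_eq_left, hh]
      · have : ((β - (ε * ‖ξ‖) ^ 2 : ℝ) : ℂ) = (β : ℂ) * ((1 - ε ^ 2 / β * ‖ξ‖ ^ 2 : ℝ) : ℂ) := by
          rw [← Complex.ofReal_mul]; congr 1; field_simp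
        rw [this]; ring
      · rw [sub_nonneg, div_mul_eq_mul_div, div_le_one hβ0, ← mul_pow]; exact le_of_lt hβ
    · rw [indicator_of_notMem hβ]
      by_cases hβ0 : β ∈ Ioi (0 : ℝ)
      · rw [indicator_of_mem hβ0, max_eq_right]
        · simp [hm]
        · rw [sub_nonpos, div_mul_eq_mul_div, one_le_div hβ0, ← mul_pow]
          exact not_lt.1 hβ
      · rw [indicator_of_notMem hβ0]
  · refine AEStronglyMeasurable.mul hint.aestronglyMeasurable.comp_snd ?_
    refine Measurable.aestronglyMeasurable ?_
    fun_prop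
  · refine (ae_restrict_iff' measurableSet_Ioi).2 (Eventually.of_forall fun β hβ ξ => ?_)
    have hβ0 : 0 < β := hβ
    rw [norm_mul, norm_pow, Complex.norm_real, Real.norm_of_nonneg (le_max_right _ _)]
    refine mul_le_mul_of_nonneg_left (le_trans (pow_le_one₀ (le_max_right _ _) ?_) hA1)
      (norm_nonneg _)
    refine max_le ?_ zero_le_one
    have : 0 ≤ ε ^ 2 / β * ‖ξ‖ ^ 2 := by positivity
    linarith
  · refine (ae_restrict_iff' measurableSet_Ioi).2 (Eventually.of_forall fun β hβ => ?_)
    exact (hA _ (div_pos (pow_pos hε 2) hβ)).const_mul _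

end RadialMultiplier

/-! ### Shifting contours -/

section ContourShift

/-- The four sides of a rectangle of base `[a, b]` and height `α`. -/
lemma integral_rect_eq {f : ℂ → ℂ} {a b α : ℝ} (hab : a ≤ b) (hα : 0 ≤ α)
    (hd : ∀ z : ℂ, a ≤ z.re → z.re ≤ b → 0 ≤ z.im → z.im ≤ α → DifferentiableAt ℂ f z) :
    (∫ x : ℝ in a..b, f x) = (∫ x : ℝ in a..b, f (x + α * I))
      - I * (∫ y : ℝ in (0 : ℝ)..α, f (b + y * I)) + I * ∫ y : ℝ in (0 : ℝ)..α, f (a + y * I) := by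
  have h := Complex.integral_boundary_rect_eq_zero_of_differentiableOn f (a : ℂ) (b + α * I) ?_
  · simp only [ofReal_re, ofReal_im, add_re, add_im, mul_re, mul_im, I_re, I_im, mul_zero, mul_one,
      sub_self, add_zero, zero_add, ofReal_zero, zero_mul, smul_eq_mul] at h
    linear_combination h
  · intro z hz
    simp only [mem_reProdIm, ofReal_re, ofReal_im, add_re, add_im, mul_re, mul_im, I_re, I_im,
      mul_zero, mul_one, sub_self, add_zero, zero_add, uIcc_of_le hab, uIcc_of_le hα, mem_Icc] at hz
    exact (hd z hz.1.1 hz.1.2 hz.2.1 hz.2.2).differentiableWithinAt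

lemma integrableOn_line_of_bound {f : ℂ → ℂ} {s : Set ℝ} {g : ℝ → ℝ} {y : ℝ}
    (hs : MeasurableSet s) (hd : ∀ x ∈ s, DifferentiableAt ℂ f (x + y * I))
    (hb : ∀ x ∈ s, ‖f (x + y * I)‖ ≤ g x) (hg : IntegrableOn g s) :
    IntegrableOn (fun x : ℝ => f (x + y * I)) s := by
  refine Integrable.mono' hg (ContinuousOn.aestronglyMeasurable (fun x hx => ?_) hs)
    ((ae_restrict_iff' hs).2 (Eventually.of_forall hb))
  refine ContinuousAt.continuousWithinAt ?_
  exact ContinuousAt.comp (f := fun x : ℝ => (x + y * I : ℂ)) (hd x hx).continuousAt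
    (Continuous.continuousAt (by fun_prop))

lemma norm_intervalIntegral_vertical_le {f : ℂ → ℂ} {a α M : ℝ} (hα : 0 ≤ α)
    (hb : ∀ y : ℝ, 0 ≤ y → y ≤ α → ‖f (a + y * I)‖ ≤ M) :
    ‖∫ y : ℝ in (0 : ℝ)..α, f (a + y * I)‖ ≤ M * α := by
  have := intervalIntegral.norm_integral_le_of_norm_le_const (a := (0 : ℝ)) (b := α) (C := M)
    (f := fun y : ℝ => f (a + y * I)) fun y hy => by
      rw [uIoc_of_le hα] at hy
      exact hb y hy.1.le hy.2
  rwa [sub_zero, abs_of_nonneg hα] at this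

/-- Shifting the contour of an integral over a half-line upwards. -/
lemma integral_Ioi_shift {f : ℂ → ℂ} {a α : ℝ} {g : ℝ → ℝ} (hα : 0 ≤ α)
    (hd : ∀ z : ℂ, a ≤ z.re → 0 ≤ z.im → z.im ≤ α → DifferentiableAt ℂ f z)
    (hb : ∀ x y : ℝ, a ≤ x → 0 ≤ y → y ≤ α → ‖f (x + y * I)‖ ≤ g x)
    (hg : IntegrableOn g (Ioi a)) (hg0 : Tendsto g atTop (𝓝 0)) :
    ∫ x : ℝ in Ioi a, f x = (∫ x : ℝ in Ioi a, f (x + α * I))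
      + I * ∫ y : ℝ in (0 : ℝ)..α, f (a + y * I) := by
  have hi : ∀ y : ℝ, 0 ≤ y → y ≤ α → IntegrableOn (fun x : ℝ => f (x + y * I)) (Ioi a) :=
    fun y h0 h1 => integrableOn_line_of_bound measurableSet_Ioi
      (fun x hx => hd _ (by simpa using le_of_lt hx) (by simpa using h0) (by simpa using h1))
      (fun x hx => hb x y (le_of_lt hx) h0 h1) hg
  have t1 := intervalIntegral_tendsto_integral_Ioi a (hi 0 le_rfl hα) tendsto_id
  have t2 := intervalIntegral_tendsto_integral_Ioi a (hi α hα le_rfl) tendsto_id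
  have t3 : Tendsto (fun R : ℝ => ∫ y : ℝ in (0 : ℝ)..α, f (R + y * I)) atTop (𝓝 0) := by
    refine squeeze_zero_norm' (a := fun R => g R * α) ?_ (by simpa using hg0.mul_const α)
    filter_upwards [eventually_ge_atTop a] with R hR
    exact norm_intervalIntegral_vertical_le hα fun y h0 h1 => hb R y hR h0 h1
  simp only [ofReal_zero, zero_mul, add_zero, id] at t1 t2
  refine tendsto_nhds_unique t1 ?_
  have t4 := (t2.sub (t3.const_mul I)).add_const (I * ∫ y : ℝ in (0 : ℝ)..α, f (a + y * I))
  rw [mul_zero, sub_zero] at t4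
  refine t4.congr' ?_
  filter_upwards [eventually_ge_atTop a] with R hR
  exact (integral_rect_eq hR hα fun z h1 _ h3 h4 => hd z h1 h3 h4).symm

/-- Shifting the contour of an integral over the line upwards. -/
lemma integral_shift {f : ℂ → ℂ} {α : ℝ} {g : ℝ → ℝ} (hα : 0 ≤ α)
    (hd : ∀ z : ℂ, 0 ≤ z.im → z.im ≤ α → DifferentiableAt ℂ f z)
    (hb : ∀ x y : ℝ, 0 ≤ y → y ≤ α → ‖f (x + y * I)‖ ≤ g x)
    (hg : Integrable g) (hg0 : Tendsto g atTop (𝓝 0)) (hg1 : Tendsto g atBot (𝓝 0)) :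
    ∫ x : ℝ, f x = ∫ x : ℝ, f (x + α * I) := by
  have hi : ∀ y : ℝ, 0 ≤ y → y ≤ α → Integrable (fun x : ℝ => f (x + y * I)) :=
    fun y h0 h1 => integrableOn_univ.1 (integrableOn_line_of_bound MeasurableSet.univ
      (fun x _ => hd _ (by simpa using h0) (by simpa using h1))
      (fun x _ => hb x y h0 h1) hg.integrableOn)
  have t1 := intervalIntegral_tendsto_integral (hi 0 le_rfl hα) tendsto_neg_atTop_atBot tendsto_id
  have t2 := intervalIntegral_tendsto_integral (hi α hα le_rfl) tendsto_neg_atTop_atBot tendsto_id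
  have t3 : Tendsto (fun R : ℝ => ∫ y : ℝ in (0 : ℝ)..α, f (R + y * I)) atTop (𝓝 0) :=
    squeeze_zero_norm (a := fun R => g R * α)
      (fun R => norm_intervalIntegral_vertical_le hα fun y h0 h1 => hb R y h0 h1)
      (by simpa using hg0.mul_const α)
  have t4 : Tendsto (fun R : ℝ => ∫ y : ℝ in (0 : ℝ)..α, f ((-R : ℝ) + y * I)) atTop (𝓝 0) :=
    squeeze_zero_norm (a := fun R => g (-R) * α)
      (fun R => norm_intervalIntegral_vertical_le hα fun y h0 h1 => hb (-R) y h0 h1)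
      (by simpa using (hg1.comp tendsto_neg_atTop_atBot).mul_const α)
  simp only [ofReal_zero, zero_mul, add_zero, id] at t1 t2
  refine tendsto_nhds_unique t1 ?_
  have t5 := (t2.sub (t3.const_mul I)).add (t4.const_mul I)
  rw [mul_zero, sub_zero, add_zero] at t5
  refine t5.congr' ?_
  filter_upwards [eventually_ge_atTop 0] with R hR
  exact (integral_rect_eq (by linarith) hα fun z _ _ h3 h4 => hd z h3 h4).symm

end ContourShift

/-! ### The substitution `x = e^y` -/

section ExpSubstitution

lemma integral_Ioi_eq_integral_exp {E : Type*} [NormedAddCommGroup E] [NormedSpace ℝ E]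
    (f : ℝ → E) : ∫ x in Ioi 0, f x = ∫ y : ℝ, Real.exp y • f (Real.exp y) := by
  have h := integral_image_eq_integral_abs_deriv_smul (s := univ) (f := Real.exp) (f' := Real.exp)
    MeasurableSet.univ (fun x _ => (Real.hasDerivAt_exp x).hasDerivWithinAt)
    Real.exp_injective.injOn f
  rw [image_univ, Real.range_exp, setIntegral_univ] at h
  simpa [abs_of_pos (Real.exp_pos _)] using h

lemma integrableOn_Ioi_iff_integrable_exp {E : Type*} [NormedAddCommGroup E] [NormedSpace ℝ E]
    (f : ℝ → E) : IntegrableOn f (Ioi 0) ↔ Integrable fun y : ℝ => Real.exp y • f (Real.exp y) := by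
  have h := integrableOn_image_iff_integrableOn_abs_deriv_smul (s := univ) (f := Real.exp)
    (f' := Real.exp) MeasurableSet.univ (fun x _ => (Real.hasDerivAt_exp x).hasDerivWithinAt)
    Real.exp_injective.injOn f
  rw [image_univ, Real.range_exp, integrableOn_univ] at h
  simpa [abs_of_pos (Real.exp_pos _)] using h

lemma exp_mul_gamma_integrand (s k y : ℝ) :
    Real.exp y • (Real.exp y ^ (s - 1) * Real.exp (-(k * Real.exp y)))
      = Real.exp (s * y) * Real.exp (-(k * Real.exp y)) := by
  rw [smul_eq_mul, ← mul_assoc, ← Real.exp_mul, ← Real.exp_add]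
  congr 2
  ring

lemma integrableOn_rpow_mul_exp_neg {s k : ℝ} (hs : 0 < s) (hk : 0 < k) :
    IntegrableOn (fun x : ℝ => x ^ (s - 1) * Real.exp (-(k * x))) (Ioi 0) := by
  have := integrableOn_rpow_mul_exp_neg_mul_rpow (s := s - 1) (p := 1) (b := k) (by linarith)
    one_pos hk
  simpa using this

lemma integrable_exp_mul_exp_neg_exp {s k : ℝ} (hs : 0 < s) (hk : 0 < k) :
    Integrable fun y : ℝ => Real.exp (s * y) * Real.exp (-(k * Real.exp y)) := by
  have h := (integrableOn_Ioi_iff_integrable_exp _).1 (integrableOn_rpow_mul_exp_neg hs hk)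
  simpa only [exp_mul_gamma_integrand] using h

/-- Euler's integral for the Gamma function, in the variable `log x`. -/
lemma integral_exp_mul_exp_neg_exp {s k : ℝ} (hs : 0 < s) (hk : 0 < k) :
    ∫ y : ℝ, Real.exp (s * y) * Real.exp (-(k * Real.exp y)) = k ^ (-s) * Real.Gamma s := by
  have h := Real.integral_rpow_mul_exp_neg_mul_Ioi hs hk
  rw [integral_Ioi_eq_integral_exp] at h
  simp only [exp_mul_gamma_integrand] at h
  rw [h, one_div, Real.inv_rpow hk.le, Real.rpow_neg hk.le]

end ExpSubstitution

/-! ### The hyperbolic cosine on a strip -/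

section ComplexCosh

lemma cosh_add_mul_I_re (θ τ : ℝ) : (Complex.cosh (θ + τ * I)).re = Real.cosh θ * Real.cos τ := by
  rw [Complex.cosh_add, Complex.cosh_mul_I, Complex.sinh_mul_I, ← Complex.ofReal_cosh,
    ← Complex.ofReal_sinh, ← Complex.ofReal_cos, ← Complex.ofReal_sin]
  simp [-Complex.ofReal_cosh, -Complex.ofReal_sinh, -Complex.ofReal_cos, -Complex.ofReal_sin]

lemma cosh_add_mul_I_im (θ τ : ℝ) : (Complex.cosh (θ + τ * I)).im = Real.sinh θ * Real.sin τ := by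
  rw [Complex.cosh_add, Complex.cosh_mul_I, Complex.sinh_mul_I, ← Complex.ofReal_cosh,
    ← Complex.ofReal_sinh, ← Complex.ofReal_cos, ← Complex.ofReal_sin]
  simp [-Complex.ofReal_cosh, -Complex.ofReal_sinh, -Complex.ofReal_cos, -Complex.ofReal_sin]

lemma half_le_cos {τ : ℝ} (h : |τ| ≤ 1 / 2) : 7 / 8 ≤ Real.cos τ := by
  have := Real.one_sub_sq_div_two_le_cos (x := τ)
  nlinarith [sq_abs τ, abs_nonneg τ]

lemma half_le_sin {τ : ℝ} (h0 : 0 ≤ τ) (h : τ ≤ 1 / 2) : τ / 2 ≤ Real.sin τ := by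
  rcases h0.eq_or_lt with rfl | h1
  · simp
  · have := Real.sin_gt_sub_cube h1
    nlinarith [mul_nonneg h0 h0, mul_le_mul h h h0 (by norm_num : (0 : ℝ) ≤ 1 / 2)]

lemma cosh_mem_slitPlane {θ τ : ℝ} (h : |τ| ≤ 1 / 2) :
    Complex.cosh (θ + τ * I) ∈ Complex.slitPlane := by
  refine Or.inl ?_
  rw [cosh_add_mul_I_re]
  exact mul_pos (Real.cosh_pos _) (by linarith [half_le_cos h])

lemma half_cosh_le_norm_cosh {θ τ : ℝ} (h : |τ| ≤ 1 / 2) :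
    Real.cosh θ / 2 ≤ ‖Complex.cosh (θ + τ * I)‖ := by
  refine le_trans ?_ ((le_abs_self _).trans (Complex.abs_re_le_norm _))
  rw [cosh_add_mul_I_re]
  nlinarith [Real.cosh_pos θ, half_le_cos h]

lemma abs_arg_le_of_re_pos {z : ℂ} (hz : 0 < z.re) : |arg z| ≤ |z.im| / z.re := by
  have h1 : |arg z| < π / 2 := Complex.abs_arg_lt_pi_div_two_iff.2 (Or.inl hz)
  have h2 : Real.tan |arg z| = |z.im| / z.re := by
    rcases le_total 0 (arg z) with h | h
    · rw [abs_of_nonneg h, Complex.tan_arg, abs_of_nonneg (Complex.arg_nonneg_iff.1 h)]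
    · rw [abs_of_nonpos h, Real.tan_neg, Complex.tan_arg]
      have : z.im ≤ 0 := by
        by_contra! h3
        have h4 := Complex.arg_nonneg_iff.2 h3.le
        have h5 : arg z = 0 := le_antisymm h h4
        have := (Complex.arg_eq_zero_iff.1 h5).2
        linarith
      rw [abs_of_nonpos this]; ring
  rw [← h2]
  exact Real.le_tan (abs_nonneg _) h1

lemma abs_arg_cosh_le {θ τ : ℝ} (h : |τ| ≤ 1 / 2) :
    |arg (Complex.cosh (θ + τ * I))| ≤ 2 * |τ| := by
  have hc := half_le_cos h
  have hp : 0 < (Complex.cosh (θ + τ * I)).re := by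
    rw [cosh_add_mul_I_re]; exact mul_pos (Real.cosh_pos _) (by linarith)
  refine (abs_arg_le_of_re_pos hp).trans ?_
  rw [div_le_iff₀ hp, cosh_add_mul_I_re, cosh_add_mul_I_im, abs_mul]
  have h1 : |Real.sinh θ| ≤ Real.cosh θ := by
    rw [abs_le]
    constructor
    · have := Real.exp_pos θ; rw [← Real.cosh_add_sinh] at this; linarith
    · exact (Real.sinh_lt_cosh θ).le
  have h2 : |Real.sin τ| ≤ |τ| := Real.abs_sin_le_abs
  have h3 := Real.cosh_pos θ
  calc |Real.sinh θ| * |Real.sin τ| ≤ Real.cosh θ * |τ| := by gcongr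
    _ ≤ 2 * |τ| * (Real.cosh θ * Real.cos τ) := by
      nlinarith [mul_nonneg h3.le (abs_nonneg τ)]

lemma norm_cpow_neg_le {z : ℂ} (hz : z ≠ 0) (s κ M : ℝ) (hM : 2 * |κ| * |arg z| ≤ M) :
    ‖z ^ (-((s : ℂ) + 2 * κ * I))‖ ≤ ‖z‖ ^ (-s) * Real.exp M := by
  rw [Complex.norm_cpow_of_ne_zero hz]
  have h1 : (-((s : ℂ) + 2 * κ * I)).re = -s := by simp
  have h2 : (-((s : ℂ) + 2 * κ * I)).im = -(2 * κ) := by simp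
  rw [h1, h2, div_eq_mul_inv, ← Real.exp_neg]
  refine mul_le_mul_of_nonneg_left (Real.exp_le_exp.2 ?_) (by positivity)
  refine le_trans (le_abs_self _) (le_trans (le_of_eq ?_) hM)
  rw [abs_neg, abs_mul, abs_neg, abs_mul, abs_two]; ring

/-- The factor `cosh^{-s-2iκ}` stays comparable to `cosh^{-s}` on a strip of width `O(1/(1+|κ|))`. -/
lemma norm_cosh_cpow_le {s κ θ τ : ℝ} (hs : 0 ≤ s) (h : |τ| ≤ 1 / 2) (hκ : |κ| * |τ| ≤ 1 / 2) :
    ‖Complex.cosh (θ + τ * I) ^ (-((s : ℂ) + 2 * κ * I))‖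
      ≤ (2 ^ s * Real.exp 2) * Real.cosh θ ^ (-s) := by
  have hne : Complex.cosh (θ + τ * I) ≠ 0 := Complex.slitPlane_ne_zero (cosh_mem_slitPlane h)
  refine (norm_cpow_neg_le hne s κ 2 ?_).trans ?_
  · have := abs_arg_cosh_le (θ := θ) h
    nlinarith [abs_nonneg κ]
  · have h1 : ‖Complex.cosh (θ + τ * I)‖ ^ (-s) ≤ (Real.cosh θ / 2) ^ (-s) :=
      Real.rpow_le_rpow_of_nonpos (by have := Real.cosh_pos θ; positivity)
        (half_cosh_le_norm_cosh h) (by linarith)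
    have h2 : (Real.cosh θ / 2) ^ (-s) = 2 ^ s * Real.cosh θ ^ (-s) := by
      rw [Real.div_rpow (Real.cosh_pos θ).le (by norm_num), Real.rpow_neg (by norm_num : (0:ℝ) ≤ 2)]
      field_simp
    rw [h2] at h1
    calc _ ≤ 2 ^ s * Real.cosh θ ^ (-s) * Real.exp 2 := by gcongr
      _ = _ := by ring

lemma hasDerivAt_cosh_cpow {z : ℂ} (hz : Complex.cosh z ∈ Complex.slitPlane) (b : ℂ) :
    HasDerivAt (fun z => Complex.cosh z ^ (-b))
      (-b * Complex.tanh z * Complex.cosh z ^ (-b)) z := by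
  refine ((Complex.hasDerivAt_cosh z).cpow_const hz).congr_deriv ?_
  rw [Complex.cpow_sub _ _ (Complex.slitPlane_ne_zero hz), Complex.cpow_one,
    Complex.tanh_eq_sinh_div_cosh]
  ring

end ComplexCosh

/-! ### The radial integral `G_b` -/

section RadialIntegral

/-- The integrand `ρ^{n-1} ⟨ρ⟩^{-b} e^{iλ⟨ρ⟩}` of `radialG`. -/
noncomputable def radialIntegrand (n : ℕ) (b z : ℂ) (ρ : ℝ) : ℂ :=
  (ρ : ℂ) ^ (n - 1) * (((√(1 + ρ ^ 2) : ℝ) : ℂ) ^ (-b)) * cexp (I * z * (√(1 + ρ ^ 2) : ℝ))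

/-- The function `G_b(λ) = ∫_0^∞ ρ^{n-1} ⟨ρ⟩^{-b} e^{iλ⟨ρ⟩} dρ` of `λ` in the upper half-plane. -/
noncomputable def radialG (n : ℕ) (b z : ℂ) : ℂ := ∫ ρ in Ioi (0 : ℝ), radialIntegrand n b z ρ

lemma one_le_sqrt_one_add_sq (ρ : ℝ) : 1 ≤ √(1 + ρ ^ 2) := by
  rw [Real.one_le_sqrt]; nlinarith [sq_nonneg ρ]

lemma le_sqrt_one_add_sq (ρ : ℝ) : ρ ≤ √(1 + ρ ^ 2) := Real.le_sqrt_of_sq_le (by linarith)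

lemma norm_radialIntegrand {n : ℕ} {b z : ℂ} {ρ : ℝ} (hρ : 0 ≤ ρ) :
    ‖radialIntegrand n b z ρ‖
      = ρ ^ (n - 1) * √(1 + ρ ^ 2) ^ (-b.re) * Real.exp (-(z.im * √(1 + ρ ^ 2))) := by
  have hW : 0 < √(1 + ρ ^ 2) := by positivity
  rw [radialIntegrand, norm_mul, norm_mul, norm_pow, Complex.norm_real, Real.norm_of_nonneg hρ,
    Complex.norm_cpow_eq_rpow_re_of_pos hW, Complex.norm_exp, Complex.re_mul_ofReal]
  simp

lemma continuous_radialIntegrand (n : ℕ) (b z : ℂ) : Continuous (radialIntegrand n b z) := by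
  unfold radialIntegrand
  refine Continuous.mul (Continuous.mul (by fun_prop) ?_) (by fun_prop)
  refine Continuous.cpow (by fun_prop) (by fun_prop) fun ρ => ?_
  exact Or.inl (by rw [Complex.ofReal_re]; positivity)

lemma exists_rpow_le_mul_exp (γ : ℝ) : ∃ C : ℝ, 0 < C ∧ ∀ x : ℝ, 1 ≤ x → x ^ γ ≤ C * Real.exp x := by
  refine ⟨(⌈γ⌉₊.factorial : ℝ), by positivity, fun x hx => ?_⟩
  have h1 : x ^ γ ≤ x ^ (⌈γ⌉₊ : ℝ) := Real.rpow_le_rpow_of_exponent_le hx (Nat.le_ceil γ)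
  have h2 := Real.pow_div_factorial_le_exp x (by linarith) ⌈γ⌉₊
  rw [div_le_iff₀ (by positivity)] at h2
  rw [Real.rpow_natCast] at h1
  linarith

lemma exists_rpow_le_mul_exp_of_pos {γ : ℝ} (hγ : 0 ≤ γ) :
    ∃ C : ℝ, 0 < C ∧ ∀ x : ℝ, 0 < x → x ^ γ ≤ C * Real.exp x := by
  obtain ⟨C, hC, h⟩ := exists_rpow_le_mul_exp γ
  refine ⟨max C 1, by positivity, fun x hx => ?_⟩
  rcases le_total 1 x with h1 | h1
  · exact (h x h1).trans (by gcongr; exact le_max_left _ _)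
  · have h2 : x ^ γ ≤ 1 := Real.rpow_le_one hx.le h1 hγ
    have h3 : 1 ≤ Real.exp x := Real.one_le_exp hx.le
    have h4 : (1 : ℝ) ≤ max C 1 := le_max_right _ _
    nlinarith

lemma pow_eq_rpow_sub_one {n : ℕ} (hn : 1 ≤ n) {ρ : ℝ} : ρ ^ (n - 1) = ρ ^ ((n : ℝ) - 1) := by
  rw [← Real.rpow_natCast]; congr 1; push_cast [hn]; ring

/-- A dominating function for `radialIntegrand`, uniform in `Im λ ≥ μ`. -/
lemma exists_radialIntegrand_bound {n : ℕ} (hn : 1 ≤ n) (β : ℝ) {μ : ℝ} (hμ : 0 < μ) :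
    ∃ g : ℝ → ℝ, IntegrableOn g (Ioi 0) ∧ ∀ (b z : ℂ), b.re = β → μ ≤ z.im →
      ∀ ρ ∈ Ioi (0 : ℝ), ‖radialIntegrand n b z ρ‖ ≤ g ρ := by
  obtain ⟨N, hN⟩ := exists_nat_gt (-β)
  refine ⟨fun ρ => (N.factorial : ℝ) * (2 / μ) ^ N *
    (ρ ^ ((n : ℝ) - 1) * Real.exp (-(μ / 2 * ρ))), ?_, fun b z hb hz ρ hρ => ?_⟩
  · exact (integrableOn_rpow_mul_exp_neg (by exact_mod_cast hn) (by positivity)).const_mul _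
  · have hρ0 : 0 < ρ := hρ
    rw [norm_radialIntegrand hρ0.le, hb, pow_eq_rpow_sub_one hn]
    set W := √(1 + ρ ^ 2)
    have hW1 : 1 ≤ W := one_le_sqrt_one_add_sq ρ
    have hWρ : ρ ≤ W := le_sqrt_one_add_sq ρ
    have h1 : W ^ (-β) ≤ W ^ N := by
      rw [← Real.rpow_natCast]; exact Real.rpow_le_rpow_of_exponent_le hW1 hN.le
    have h2 : W ^ N ≤ (N.factorial : ℝ) * (2 / μ) ^ N * Real.exp (μ / 2 * W) := by
      have := Real.pow_div_factorial_le_exp (μ / 2 * W) (by positivity) N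
      rw [div_le_iff₀ (by positivity), mul_pow] at this
      calc W ^ N = (2 / μ) ^ N * ((μ / 2) ^ N * W ^ N) := by
            rw [← mul_assoc, ← mul_pow]; field_simp; simp
        _ ≤ (2 / μ) ^ N * (Real.exp (μ / 2 * W) * N.factorial) := by gcongr
        _ = _ := by ring
    have h3 : Real.exp (-(z.im * W)) ≤ Real.exp (-(μ / 2 * W)) * Real.exp (-(μ / 2 * ρ)) := by
      rw [← Real.exp_add]
      refine Real.exp_le_exp.2 ?_
      nlinarith
    calc ρ ^ ((n : ℝ) - 1) * W ^ (-β) * Real.exp (-(z.im * W))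
        ≤ ρ ^ ((n : ℝ) - 1) * ((N.factorial : ℝ) * (2 / μ) ^ N * Real.exp (μ / 2 * W)) *
          (Real.exp (-(μ / 2 * W)) * Real.exp (-(μ / 2 * ρ))) := by
          gcongr
          exact h1.trans h2
      _ = (N.factorial : ℝ) * (2 / μ) ^ N * (ρ ^ ((n : ℝ) - 1) * Real.exp (-(μ / 2 * ρ))) *
          (Real.exp (μ / 2 * W) * Real.exp (-(μ / 2 * W))) := by ring
      _ = _ := by rw [← Real.exp_add, add_neg_cancel, Real.exp_zero, mul_one]

lemma integrableOn_radialIntegrand {n : ℕ} (hn : 1 ≤ n) (b : ℂ) {z : ℂ} (hz : 0 < z.im) :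
    IntegrableOn (radialIntegrand n b z) (Ioi 0) := by
  obtain ⟨g, hg, hb⟩ := exists_radialIntegrand_bound hn b.re hz
  exact Integrable.mono' hg (continuous_radialIntegrand n b z).aestronglyMeasurable
    ((ae_restrict_iff' measurableSet_Ioi).2 (Eventually.of_forall (hb b z rfl le_rfl)))

lemma hasDerivAt_radialG {n : ℕ} (hn : 1 ≤ n) (b : ℂ) {z : ℂ} (hz : 0 < z.im) :
    HasDerivAt (radialG n b) (I * radialG n (b - 1) z) z := by
  obtain ⟨g, hg, hb⟩ := exists_radialIntegrand_bound hn (b - 1).re (half_pos hz)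
  have h := hasDerivAt_integral_of_dominated_loc_of_deriv_le (μ := volume.restrict (Ioi (0 : ℝ)))
    (F := fun z ρ => radialIntegrand n b z ρ)
    (F' := fun z ρ => I * radialIntegrand n (b - 1) z ρ) (x₀ := z) (bound := g)
    (s := Metric.ball z (z.im / 2)) (Metric.ball_mem_nhds z (half_pos hz))
    (Eventually.of_forall fun w => (continuous_radialIntegrand n b w).aestronglyMeasurable)
    (integrableOn_radialIntegrand hn b hz)
    (continuous_const.mul (continuous_radialIntegrand n (b - 1) z)).aestronglyMeasurable
    ?_ hg ?_
  · have h2 := h.2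
    rw [integral_const_mul] at h2
    exact h2
  · refine (ae_restrict_iff' measurableSet_Ioi).2 (Eventually.of_forall fun ρ hρ w hw => ?_)
    rw [norm_mul, Complex.norm_I, one_mul]
    refine hb _ w rfl ?_ ρ hρ
    have h1 : |(w - z).im| ≤ ‖w - z‖ := Complex.abs_im_le_norm _
    rw [mem_ball_iff_norm] at hw
    rw [Complex.sub_im] at h1
    linarith [(abs_le.1 (h1.trans hw.le)).1]
  · refine Eventually.of_forall fun ρ w _ => ?_
    have hW : ((√(1 + ρ ^ 2) : ℝ) : ℂ) ≠ 0 := by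
      have : 0 < √(1 + ρ ^ 2) := by positivity
      exact_mod_cast this.ne'
    unfold radialIntegrand
    have h1 : HasDerivAt (fun w => I * w * (√(1 + ρ ^ 2) : ℝ)) (I * (√(1 + ρ ^ 2) : ℝ)) w := by
      simpa using ((hasDerivAt_id w).const_mul I).mul_const ((√(1 + ρ ^ 2) : ℝ) : ℂ)
    refine (h1.cexp.const_mul _).congr_deriv ?_
    have h2 : -(b - 1) = -b + 1 := by ring
    rw [h2, Complex.cpow_add _ _ hW, Complex.cpow_one]
    ring

/-- Integration by parts along the dilation field `ρ ∂_ρ`: up to terms with better decay,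
`G_b` is homogeneous of degree `b - n`. -/
lemma radialG_dilation {n : ℕ} (hn : 1 ≤ n) (b : ℂ) {z : ℂ} (hz : 0 < z.im) :
    z * (I * radialG n (b - 1) z)
      = -((n : ℂ) - b) * radialG n b z - (b * radialG n (b + 2) z - I * z * radialG n (b + 1) z) := by
  have hW : ∀ ρ : ℝ, 0 < √(1 + ρ ^ 2) := fun ρ => by positivity
  have hWc : ∀ ρ : ℝ, ((√(1 + ρ ^ 2) : ℝ) : ℂ) ≠ 0 := fun ρ => by exact_mod_cast (hW ρ).ne'
  have hi := fun b => integrableOn_radialIntegrand hn b hz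
  set D : ℝ → ℂ := fun ρ => ((n : ℂ) - b) * radialIntegrand n b z ρ
      + b * radialIntegrand n (b + 2) z ρ
      + I * z * (radialIntegrand n (b - 1) z ρ - radialIntegrand n (b + 1) z ρ) with hD
  have hDi : IntegrableOn D (Ioi 0) :=
    (((hi b).const_mul _).add ((hi (b + 2)).const_mul _)).add
      (((hi (b - 1)).sub (hi (b + 1))).const_mul _)
  have hder : ∀ ρ ∈ Ici (0 : ℝ), HasDerivAt (radialIntegrand (n + 1) b z) (D ρ) ρ := by
    intro ρ _
    have h1 : HasDerivAt (fun ρ : ℝ => √(1 + ρ ^ 2)) (ρ / √(1 + ρ ^ 2)) ρ := by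
      have h0 : HasDerivAt (fun ρ : ℝ => 1 + ρ ^ 2) (2 * ρ) ρ := by
        simpa using (hasDerivAt_pow 2 ρ).const_add 1
      refine (h0.sqrt (by positivity)).congr_deriv ?_
      field_simp
    have h2 := h1.ofReal_comp
    have h3 : HasDerivAt (fun w : ℂ => w ^ (-b)) (-b * ((√(1 + ρ ^ 2) : ℝ) : ℂ) ^ (-b - 1))
        ((√(1 + ρ ^ 2) : ℝ) : ℂ) :=
      ((hasDerivAt_id ((√(1 + ρ ^ 2) : ℝ) : ℂ)).cpow_const (c := -b)
          (Complex.ofReal_mem_slitPlane.2 (hW ρ))).congr_deriv (by simp only [id, mul_one])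
    have h4 : HasDerivAt (fun ρ : ℝ => (ρ : ℂ) ^ n) ((n : ℂ) * (ρ : ℂ) ^ (n - 1)) ρ :=
      (hasDerivAt_pow n (ρ : ℂ)).comp_ofReal
    have h5 := (h4.mul (h3.comp ρ h2)).mul (h2.const_mul (I * z)).cexp
    have h6 : radialIntegrand (n + 1) b z = ((fun ρ : ℝ => (ρ : ℂ) ^ n) *
        fun ρ : ℝ => (((√(1 + ρ ^ 2) : ℝ) : ℂ) ^ (-b))) *
        fun ρ : ℝ => cexp (I * z * ((√(1 + ρ ^ 2) : ℝ) : ℂ)) := by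
      ext ρ; simp [radialIntegrand]
    rw [h6]
    refine h5.congr_deriv ?_
    simp only [hD, radialIntegrand, Pi.mul_apply, Function.comp_apply]
    have e1 : (-(b - 1)) = -b + 1 := by ring
    have e2 : (-(b + 1)) = -b - 1 := by ring
    have e3 : (-(b + 2)) = -b - 1 - 1 := by ring
    simp only [e1, e2, e3, Complex.cpow_sub _ 1 (hWc ρ), Complex.cpow_add _ 1 (hWc ρ),
      Complex.cpow_one]
    have e4 : ((√(1 + ρ ^ 2) : ℝ) : ℂ) ^ 2 = 1 + (ρ : ℂ) ^ 2 := by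
      rw [← Complex.ofReal_pow, Real.sq_sqrt (by positivity)]; push_cast; ring
    have e5 : (ρ : ℂ) ^ n = ρ * (ρ : ℂ) ^ (n - 1) := by
      rw [← pow_succ']; congr 1; omega
    rw [e5]
    push_cast
    set W := ((√(1 + ρ ^ 2) : ℝ) : ℂ) with hWdef
    have hW0 : W ≠ 0 := hWc ρ
    have e6 : (ρ : ℂ) ^ 2 = W ^ 2 - 1 := by rw [e4]; ring
    field_simp
    ring_nf
    rw [e6]
    ring
  have hlim : Tendsto (radialIntegrand (n + 1) b z) atTop (𝓝 0) := by
    exact tendsto_zero_of_hasDerivAt_of_integrableOn_Ioi (fun ρ hρ => hder ρ (Ioi_subset_Ici_self hρ)) hDi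
      (integrableOn_radialIntegrand (by omega) b hz)
  have h := integral_Ioi_of_hasDerivAt_of_tendsto' hder hDi hlim
  have h0 : radialIntegrand (n + 1) b z 0 = 0 := by
    have : n ≠ 0 := by omega
    simp [radialIntegrand, this]
  rw [h0, sub_zero] at h
  simp only [hD] at h
  have i1 : IntegrableOn (fun ρ => ((n : ℂ) - b) * radialIntegrand n b z ρ) (Ioi 0) :=
    (hi b).const_mul _
  have i2 : IntegrableOn (fun ρ => b * radialIntegrand n (b + 2) z ρ) (Ioi 0) :=
    (hi (b + 2)).const_mul _
  have i3 : IntegrableOn (fun ρ => I * z * (radialIntegrand n (b - 1) z ρ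
      - radialIntegrand n (b + 1) z ρ)) (Ioi 0) := ((hi (b - 1)).sub (hi (b + 1))).const_mul _
  have i4 : IntegrableOn (fun ρ => ((n : ℂ) - b) * radialIntegrand n b z ρ
      + b * radialIntegrand n (b + 2) z ρ) (Ioi 0) := i1.add i2
  rw [integral_add i4 i3, integral_add i1 i2, integral_const_mul, integral_const_mul,
    integral_const_mul, integral_sub (hi (b - 1)) (hi (b + 1))] at h
  unfold radialG
  linear_combination h

lemma norm_radialG_le {n : ℕ} {b z : ℂ} {h : ℝ → ℝ} (hh : IntegrableOn h (Ioi 0))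
    (hb : ∀ ρ ∈ Ioi (0 : ℝ), ‖radialIntegrand n b z ρ‖ ≤ h ρ) :
    ‖radialG n b z‖ ≤ ∫ ρ in Ioi 0, h ρ :=
  norm_integral_le_of_norm_le hh ((ae_restrict_iff' measurableSet_Ioi).2 (Eventually.of_forall hb))

/-- The bound of `G_b` by absolute values, for `Re b = n/2`. -/
lemma norm_radialG_le_gamma {n : ℕ} (hn : 1 ≤ n) {b z : ℂ} {s μ : ℝ} (hs : s = n / 2)
    (hb : b.re = s) (hμ : 0 < μ) (hz : μ ≤ z.im) :
    ‖radialG n b z‖ ≤ Real.Gamma s * μ ^ (-s) := by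
  have hs0 : 0 < s := by rw [hs]; have : (1 : ℝ) ≤ n := by exact_mod_cast hn
                         linarith
  have hint := integrableOn_rpow_mul_exp_neg hs0 hμ
  refine (norm_radialG_le hint fun ρ hρ => ?_).trans (le_of_eq ?_)
  · have hρ0 : 0 < ρ := hρ
    rw [norm_radialIntegrand hρ0.le, hb, pow_eq_rpow_sub_one hn]
    have h1 : √(1 + ρ ^ 2) ^ (-s) ≤ ρ ^ (-s) :=
      Real.rpow_le_rpow_of_nonpos hρ0 (le_sqrt_one_add_sq ρ) (by linarith)
    have h2 : Real.exp (-(z.im * √(1 + ρ ^ 2))) ≤ Real.exp (-(μ * ρ)) := by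
      refine Real.exp_le_exp.2 (neg_le_neg ?_)
      exact mul_le_mul hz (le_sqrt_one_add_sq ρ) hρ0.le (hμ.le.trans hz)
    calc _ ≤ ρ ^ ((n : ℝ) - 1) * ρ ^ (-s) * Real.exp (-(μ * ρ)) := by gcongr
      _ = _ := by rw [← Real.rpow_add hρ0, hs]; congr 2; ring
  · rw [Real.integral_rpow_mul_exp_neg_mul_Ioi hs0 hμ, one_div, Real.inv_rpow hμ.le,
      Real.rpow_neg hμ.le, mul_comm]

/-- The bound of the derivative `i G_{b-1}` of `G_b` by absolute values, for `Re b = n/2`. -/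
lemma norm_radialG_sub_one_le {n : ℕ} (hn : 1 ≤ n) {b z : ℂ} {s μ : ℝ} (hs : s = n / 2)
    (hb : b.re = s) (hμ : 0 < μ) (hz : μ ≤ z.im) :
    ‖radialG n (b - 1) z‖ ≤ 2 ^ (s + 1) * Real.Gamma s * μ ^ (-s) * μ⁻¹ := by
  have hs0 : 0 < s := by rw [hs]; have : (1 : ℝ) ≤ n := by exact_mod_cast hn
                         linarith
  have hμ2 : 0 < μ / 2 := half_pos hμ
  have hint := (integrableOn_rpow_mul_exp_neg hs0 hμ2).const_mul (2 / μ)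
  refine (norm_radialG_le hint fun ρ hρ => ?_).trans (le_of_eq ?_)
  · have hρ0 : 0 < ρ := hρ
    rw [norm_radialIntegrand hρ0.le, Complex.sub_re, hb, pow_eq_rpow_sub_one hn, Complex.one_re]
    set W := √(1 + ρ ^ 2)
    have hW1 : 1 ≤ W := one_le_sqrt_one_add_sq ρ
    have hWρ : ρ ≤ W := le_sqrt_one_add_sq ρ
    have h1 : W ^ (-s) ≤ ρ ^ (-s) := Real.rpow_le_rpow_of_nonpos hρ0 hWρ (by linarith)
    have h0 : W ^ (-(s - 1)) = W ^ (-s) * W := by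
      rw [← Real.rpow_add_one (by linarith)]; congr 1; ring
    have h2 : W * Real.exp (-(z.im * W)) ≤ 2 / μ * Real.exp (-(μ / 2 * ρ)) := by
      have h3 : μ / 2 * W ≤ Real.exp (μ / 2 * W) := by
        linarith [Real.add_one_le_exp (μ / 2 * W)]
      have h4 : Real.exp (-(z.im * W)) ≤ Real.exp (-(μ / 2 * W)) * Real.exp (-(μ / 2 * ρ)) := by
        rw [← Real.exp_add]
        exact Real.exp_le_exp.2 (by nlinarith)
      have h5 : W ≤ 2 / μ * Real.exp (μ / 2 * W) := by
        calc W = 2 / μ * (μ / 2 * W) := by field_simp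
          _ ≤ _ := by gcongr
      calc W * Real.exp (-(z.im * W)) ≤ (2 / μ * Real.exp (μ / 2 * W)) *
            (Real.exp (-(μ / 2 * W)) * Real.exp (-(μ / 2 * ρ))) := by gcongr
        _ = 2 / μ * Real.exp (-(μ / 2 * ρ)) *
            (Real.exp (μ / 2 * W) * Real.exp (-(μ / 2 * W))) := by ring
        _ = _ := by rw [← Real.exp_add, add_neg_cancel, Real.exp_zero, mul_one]
    calc _ = ρ ^ ((n : ℝ) - 1) * W ^ (-s) * (W * Real.exp (-(z.im * W))) := by rw [h0]; ring
      _ ≤ ρ ^ ((n : ℝ) - 1) * ρ ^ (-s) * (2 / μ * Real.exp (-(μ / 2 * ρ))) := by gcongr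
      _ = 2 / μ * (ρ ^ ((n : ℝ) - 1 + -s) * Real.exp (-(μ / 2 * ρ))) := by
        rw [Real.rpow_add hρ0]; ring
      _ = _ := by congr 3; rw [hs]; ring
  · rw [integral_const_mul, Real.integral_rpow_mul_exp_neg_mul_Ioi hs0 hμ2, one_div,
      Real.inv_rpow hμ2.le, Real.div_rpow hμ.le (by norm_num), Real.rpow_neg hμ.le,
      Real.rpow_add_one (by norm_num)]
    field_simp

/-- The error in the approximate homogeneity `radialG_dilation` is integrable against `dμ/μ`
after multiplication by `μ^s`. -/
lemma exists_norm_dilation_error_le {n : ℕ} (hn : 1 ≤ n) {s : ℝ} (hs : s = n / 2) :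
    ∃ C : ℝ, 0 < C ∧ ∀ (b z : ℂ) (μ L : ℝ), b.re = s → 0 < μ → μ ≤ z.im → ‖z‖ ≤ L * μ →
      ‖b * radialG n (b + 2) z - I * z * radialG n (b + 1) z‖
        ≤ C * (‖b‖ + L) * μ ^ (-s + min s 1) * Real.exp (-(μ / 4)) := by
  have hs0 : 0 < s := by rw [hs]; have : (1 : ℝ) ≤ n := by exact_mod_cast hn
                         linarith
  set a := min s 1 with ha
  have ha1 : a ≤ 1 := min_le_right _ _
  have has : a ≤ s := min_le_left _ _
  obtain ⟨K, hK, hKb⟩ := exists_rpow_le_mul_exp_of_pos (γ := s - a) (by linarith)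
  set Q : ℝ := ∫ ρ in Ioi (0 : ℝ), (1 + ρ ^ 2)⁻¹ with hQ
  have hQi : IntegrableOn (fun ρ : ℝ => (1 + ρ ^ 2)⁻¹) (Ioi 0) :=
    integrable_inv_one_add_sq.integrableOn
  have hQ0 : 0 ≤ Q := by positivity
  refine ⟨2 * (4 ^ (s - a) * K * Q) + 1, by positivity, fun b z μ L hb hμ hz hL => ?_⟩
  have hL0 : 0 ≤ L := by
    by_contra! h
    have := (norm_nonneg z).trans hL
    nlinarith
  set A : ℝ := 4 ^ (s - a) * K * μ ^ (-s + a) * Real.exp (-(μ / 4)) with hA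
  have hA0 : 0 ≤ A := by positivity
  -- the common majorant of both terms
  have hmaj : ∀ ρ ∈ Ioi (0 : ℝ), ρ ^ (n - 1) * √(1 + ρ ^ 2) ^ (-s - 2) *
      Real.exp (-(μ / 2 * √(1 + ρ ^ 2))) ≤ A * (1 + ρ ^ 2)⁻¹ := by
    intro ρ hρ
    have hρ0 : 0 < ρ := hρ
    have hWsq : √(1 + ρ ^ 2) ^ 2 = 1 + ρ ^ 2 := Real.sq_sqrt (by positivity)
    rw [pow_eq_rpow_sub_one hn, show (1 + ρ ^ 2)⁻¹ = (√(1 + ρ ^ 2) ^ 2)⁻¹ by rw [hWsq]]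
    set W := √(1 + ρ ^ 2)
    have hW1 : 1 ≤ W := one_le_sqrt_one_add_sq ρ
    have hW0 : 0 < W := by linarith
    have hWρ : ρ ≤ W := le_sqrt_one_add_sq ρ
    have h1 : ρ ^ ((n : ℝ) - 1) ≤ W ^ ((n : ℝ) - 1) :=
      Real.rpow_le_rpow hρ0.le hWρ (by have : (1 : ℝ) ≤ n := by exact_mod_cast hn
                                       linarith)
    have h2 : Real.exp (-(μ / 2 * W)) ≤ Real.exp (-(μ / 4 * W)) * Real.exp (-(μ / 4)) := by
      rw [← Real.exp_add]
      exact Real.exp_le_exp.2 (by nlinarith)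
    have h3 : Real.exp (-(μ / 4 * W)) ≤ K * (μ / 4 * W) ^ (-(s - a)) := by
      have := hKb (μ / 4 * W) (by positivity)
      rw [Real.exp_neg, Real.rpow_neg (by positivity), inv_le_iff_one_le_mul₀ (Real.exp_pos _),
        mul_right_comm, ← div_eq_mul_inv, one_le_div (by positivity)]
      exact this
    have h4 : (μ / 4 * W) ^ (-(s - a)) = 4 ^ (s - a) * μ ^ (-s + a) * W ^ (-(s - a)) := by
      rw [Real.mul_rpow (by positivity) hW0.le, Real.div_rpow hμ.le (by norm_num),
        Real.rpow_neg (by norm_num : (0 : ℝ) ≤ 4), div_inv_eq_mul]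
      have : -(s - a) = -s + a := by ring
      rw [this]; ring
    have h5 : W ^ ((n : ℝ) - 1) * W ^ (-s - 2) * W ^ (-(s - a)) ≤ (W ^ 2)⁻¹ := by
      rw [← Real.rpow_add hW0, ← Real.rpow_add hW0, ← Real.rpow_natCast, ← Real.rpow_neg hW0.le]
      refine Real.rpow_le_rpow_of_exponent_le hW1 ?_
      have : (n : ℝ) = 2 * s := by rw [hs]; ring
      push_cast
      linarith
    calc _ ≤ W ^ ((n : ℝ) - 1) * W ^ (-s - 2) *
          ((K * (μ / 4 * W) ^ (-(s - a))) * Real.exp (-(μ / 4))) := by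
          gcongr
          exact h2.trans (by gcongr)
      _ = A * (W ^ ((n : ℝ) - 1) * W ^ (-s - 2) * W ^ (-(s - a))) := by rw [h4, hA]; ring
      _ ≤ _ := by gcongr
  have hB2 : ‖radialG n (b + 2) z‖ ≤ A * Q := by
    rw [hQ, ← integral_const_mul]
    refine norm_radialG_le (hQi.const_mul A) fun ρ hρ => le_trans ?_ (hmaj ρ hρ)
    have hρ0 : 0 < ρ := hρ
    rw [norm_radialIntegrand hρ0.le]
    have e : -(b + 2).re = -s - 2 := by simp [hb]; ring
    rw [e]
    have h1 : Real.exp (-(z.im * √(1 + ρ ^ 2))) ≤ Real.exp (-(μ / 2 * √(1 + ρ ^ 2))) := by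
      refine Real.exp_le_exp.2 (neg_le_neg (mul_le_mul_of_nonneg_right (by linarith) (by positivity)))
    gcongr
  have hB1 : ‖z‖ * ‖radialG n (b + 1) z‖ ≤ 2 * L * (A * Q) := by
    have h1 : μ * ‖radialG n (b + 1) z‖ ≤ 2 * (A * Q) := by
      have h2 : ‖radialG n (b + 1) z‖ ≤ ∫ ρ in Ioi (0 : ℝ), 2 / μ * A * (1 + ρ ^ 2)⁻¹ := by
        refine norm_radialG_le (hQi.const_mul _) fun ρ hρ => ?_
        rw [mul_assoc]
        refine le_trans ?_ (mul_le_mul_of_nonneg_left (hmaj ρ hρ) (by positivity))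
        have hρ0 : 0 < ρ := hρ
        rw [norm_radialIntegrand hρ0.le]
        have e : -(b + 1).re = -s - 2 + 1 := by simp [hb]; ring
        rw [e]
        set W := √(1 + ρ ^ 2)
        have hW1 : 1 ≤ W := one_le_sqrt_one_add_sq ρ
        rw [Real.rpow_add_one (by positivity)]
        have h3 : μ / 2 * W ≤ Real.exp (μ / 2 * W) := by linarith [Real.add_one_le_exp (μ / 2 * W)]
        have h4 : Real.exp (-(z.im * W)) ≤ Real.exp (-(μ / 2 * W)) * Real.exp (-(μ / 2 * W)) := by
          rw [← Real.exp_add]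
          exact Real.exp_le_exp.2 (by nlinarith)
        have h5 : W * Real.exp (-(μ / 2 * W)) ≤ 2 / μ := by
          rw [Real.exp_neg, ← div_eq_mul_inv, div_le_div_iff₀ (Real.exp_pos _) hμ]
          linarith
        calc _ ≤ ρ ^ (n - 1) * (W ^ (-s - 2) * W) *
              (Real.exp (-(μ / 2 * W)) * Real.exp (-(μ / 2 * W))) := by gcongr
          _ = (W * Real.exp (-(μ / 2 * W))) *
              (ρ ^ (n - 1) * W ^ (-s - 2) * Real.exp (-(μ / 2 * W))) := by ring
          _ ≤ _ := by gcongr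
      rw [integral_const_mul, ← hQ] at h2
      calc μ * ‖radialG n (b + 1) z‖ ≤ μ * (2 / μ * A * Q) := by gcongr
        _ = _ := by field_simp
    calc ‖z‖ * ‖radialG n (b + 1) z‖ ≤ (L * μ) * ‖radialG n (b + 1) z‖ := by gcongr
      _ = L * (μ * ‖radialG n (b + 1) z‖) := by ring
      _ ≤ L * (2 * (A * Q)) := by gcongr
      _ = _ := by ring
  calc _ ≤ ‖b * radialG n (b + 2) z‖ + ‖I * z * radialG n (b + 1) z‖ := norm_sub_le _ _
    _ = ‖b‖ * ‖radialG n (b + 2) z‖ + ‖z‖ * ‖radialG n (b + 1) z‖ := by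
      rw [norm_mul, norm_mul, norm_mul, Complex.norm_I, one_mul]
    _ ≤ ‖b‖ * (A * Q) + 2 * L * (A * Q) := by gcongr
    _ ≤ (2 * (4 ^ (s - a) * K * Q)) * (‖b‖ + L) * μ ^ (-s + a) * Real.exp (-(μ / 4)) := by
      have : (2 * (4 ^ (s - a) * K * Q)) * (‖b‖ + L) * μ ^ (-s + a) * Real.exp (-(μ / 4))
          = 2 * (‖b‖ + L) * (A * Q) := by rw [hA]; ring
      rw [this]
      nlinarith [mul_nonneg (norm_nonneg b) (mul_nonneg hA0 hQ0)]
    _ ≤ _ := by gcongr; linarith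

end RadialIntegral

/-! ### `G_b` near the real axis -/

section QuadrantBound

/-- The integrand of `radialG` in the variable `y`, where `⟨ρ⟩ = 1 + e^y`; it extends to a strip. -/
noncomputable def rotatedIntegrand (s κ : ℝ) (z y : ℂ) : ℂ :=
  cexp (s * y) * (cexp y + 2) ^ ((s - 1 : ℝ) : ℂ) * (1 + cexp y) ^ (1 - ((s : ℂ) + 2 * κ * I))
    * cexp (I * z * (1 + cexp y))

/-- The substitution `⟨ρ⟩ = 1 + e^y`. -/
lemma radialG_eq_integral_rotatedIntegrand {n : ℕ} (hn : 1 ≤ n) {s : ℝ} (hs : s = n / 2) (κ : ℝ)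
    (z : ℂ) : radialG n ((s : ℂ) + 2 * κ * I) z = ∫ y : ℝ, rotatedIntegrand s κ z y := by
  set φ : ℝ → ℝ := fun y => √(Real.exp y * (Real.exp y + 2)) with hφ
  have hpos : ∀ y : ℝ, 0 < Real.exp y * (Real.exp y + 2) := fun y => by positivity
  have hφpos : ∀ y, 0 < φ y := fun y => Real.sqrt_pos.2 (hpos y)
  have hsq : ∀ y, φ y ^ 2 = Real.exp y * (Real.exp y + 2) := fun y => Real.sq_sqrt (hpos y).le
  have hW : ∀ y, √(1 + φ y ^ 2) = 1 + Real.exp y := fun y => by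
    rw [hsq, show 1 + Real.exp y * (Real.exp y + 2) = (1 + Real.exp y) ^ 2 by ring]
    exact Real.sqrt_sq (by positivity)
  have hder : ∀ y, HasDerivAt φ (Real.exp y * (1 + Real.exp y) / φ y) y := fun y => by
    have h := ((Real.hasDerivAt_exp y).mul ((Real.hasDerivAt_exp y).add_const 2)).sqrt (hpos y).ne'
    refine h.congr_deriv ?_
    have h0 := (hφpos y).ne'
    simp only [hφ, Pi.mul_apply] at h0 ⊢
    field_simp
    ring
  have hinj : Function.Injective φ := fun x y hxy => by
    have := hW x
    rw [hxy, hW y] at this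
    exact Real.exp_injective (by linarith)
  have hrange : φ '' univ = Ioi 0 := by
    rw [image_univ]
    ext ρ
    refine ⟨fun ⟨y, hy⟩ => hy ▸ hφpos y, fun hρ => ?_⟩
    have hρ0 : 0 < ρ := hρ
    have h1 : 0 < √(1 + ρ ^ 2) - 1 := by
      rw [sub_pos, Real.lt_sqrt zero_le_one]; nlinarith
    refine ⟨Real.log (√(1 + ρ ^ 2) - 1), ?_⟩
    simp only [hφ, Real.exp_log h1]
    have : (√(1 + ρ ^ 2) - 1) * (√(1 + ρ ^ 2) - 1 + 2) = ρ ^ 2 := by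
      have := Real.sq_sqrt (show 0 ≤ 1 + ρ ^ 2 by positivity)
      nlinarith
    rw [this, Real.sqrt_sq hρ0.le]
  have h := integral_image_eq_integral_abs_deriv_smul (s := univ) (f := φ) MeasurableSet.univ
    (fun y _ => (hder y).hasDerivWithinAt) hinj.injOn (radialIntegrand n ((s : ℂ) + 2 * κ * I) z)
  rw [hrange, setIntegral_univ] at h
  rw [radialG, h]
  congr 1
  ext y
  have he : 0 < Real.exp y := Real.exp_pos y
  have h1 : 0 < 1 + Real.exp y := by positivity
  have h1c : ((1 + Real.exp y : ℝ) : ℂ) ≠ 0 := by exact_mod_cast h1.ne'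
  rw [abs_of_pos (div_pos (by positivity) (hφpos y)), radialIntegrand, hW, rotatedIntegrand,
    Complex.real_smul]
  have e1 : Real.exp y * (1 + Real.exp y) / φ y * φ y ^ (n - 1)
      = Real.exp (s * y) * (Real.exp y + 2) ^ (s - 1) * (1 + Real.exp y) := by
    have h2 : φ y ^ (n - 1) = φ y * (φ y ^ 2) ^ (s - 1) := by
      rw [pow_eq_rpow_sub_one hn, ← Real.rpow_natCast, ← Real.rpow_mul (hφpos y).le,
        show (n : ℝ) - 1 = 1 + ((2 : ℕ) : ℝ) * (s - 1) by rw [hs]; push_cast; ring,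
        Real.rpow_add (hφpos y), Real.rpow_one]
    rw [h2, hsq, Real.mul_rpow he.le (by positivity), ← Real.exp_mul]
    have h3 : Real.exp (s * y) = Real.exp y * Real.exp (y * (s - 1)) := by
      rw [← Real.exp_add]; congr 1; ring
    rw [h3]
    have := (hφpos y).ne'
    field_simp
  have e2 : (1 + cexp y) ^ (1 - ((s : ℂ) + 2 * κ * I))
      = ((1 + Real.exp y : ℝ) : ℂ) * ((1 + Real.exp y : ℝ) : ℂ) ^ (-((s : ℂ) + 2 * κ * I)) := by
    rw [sub_eq_add_neg]
    push_cast at h1c ⊢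
    rw [Complex.cpow_add _ _ h1c, Complex.cpow_one]
  have e3 : (cexp y + 2) ^ ((s - 1 : ℝ) : ℂ) = (((Real.exp y + 2) ^ (s - 1) : ℝ) : ℂ) := by
    rw [Complex.ofReal_cpow (by positivity)]; push_cast; rfl
  have e1c := congrArg (fun x : ℝ => (x : ℂ)) e1
  simp only [Complex.ofReal_mul, Complex.ofReal_pow, Complex.ofReal_exp] at e1c
  rw [e2, e3]
  push_cast at e1c ⊢
  linear_combination (((1 + cexp y) ^ (-((s : ℂ) + 2 * κ * I))) * cexp (I * z * (1 + cexp y))) * e1c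

lemma tendsto_exp_mul_exp_neg_exp_atTop {s k : ℝ} (hk : 0 < k) :
    Tendsto (fun y : ℝ => Real.exp (s * y) * Real.exp (-(k * Real.exp y))) atTop (𝓝 0) := by
  have h := (tendsto_rpow_mul_exp_neg_mul_atTop_nhds_zero s k hk).comp Real.tendsto_exp_atTop
  refine h.congr fun y => ?_
  simp only [Function.comp_apply]
  rw [← Real.exp_mul, mul_comm y s, neg_mul]

lemma tendsto_exp_mul_exp_neg_exp_atBot {s k : ℝ} (hs : 0 < s) (hk : 0 < k) :
    Tendsto (fun y : ℝ => Real.exp (s * y) * Real.exp (-(k * Real.exp y))) atBot (𝓝 0) := by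
  refine squeeze_zero (g := fun y : ℝ => Real.exp (s * y)) (fun y => by positivity) (fun y => ?_) ?_
  · exact mul_le_of_le_one_right (Real.exp_pos _).le
      (Real.exp_le_one_iff.2 (by have := Real.exp_pos y; nlinarith))
  · exact Real.tendsto_exp_atBot.comp (tendsto_id.const_mul_atBot hs)

lemma exp_add_mul_I_re (y τ : ℝ) : (cexp (y + τ * I)).re = Real.exp y * Real.cos τ := by
  rw [Complex.exp_re]; simp

lemma exp_add_mul_I_im (y τ : ℝ) : (cexp (y + τ * I)).im = Real.exp y * Real.sin τ := by
  rw [Complex.exp_im]; simp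

lemma norm_rotatedIntegrand_le {s κ y τ : ℝ} (z : ℂ) (hs : 0 < s) (h : |τ| ≤ 1 / 2)
    (hκ : |κ| * |τ| ≤ 1 / 2) :
    ‖rotatedIntegrand s κ z (y + τ * I)‖ ≤ 2 ^ s * Real.exp 2 * (Real.exp (s * y) *
      Real.exp (-(z.im + (z.im * Real.cos τ + z.re * Real.sin τ) * Real.exp y))) := by
  have hc := half_le_cos h
  set m : ℂ := cexp (y + τ * I) with hm
  have hre : m.re = Real.exp y * Real.cos τ := exp_add_mul_I_re y τ
  have him : m.im = Real.exp y * Real.sin τ := exp_add_mul_I_im y τ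
  have he := Real.exp_pos y
  have hre0 : 0 < m.re := by rw [hre]; exact mul_pos he (by linarith)
  have h1re : (1 + m).re = 1 + m.re := by simp
  have h1ne : 1 + m ≠ 0 := fun h0 => by
    have := congrArg Complex.re h0; rw [h1re] at this; simp at this; linarith
  have hn1 : 0 < ‖1 + m‖ := norm_pos_iff.2 h1ne
  have hle1 : ‖1 + m‖ ≤ ‖m + 2‖ := by
    rw [← abs_of_nonneg (norm_nonneg (1 + m)), ← abs_of_nonneg (norm_nonneg (m + 2)), ← sq_le_sq,
      ← Complex.normSq_eq_norm_sq, ← Complex.normSq_eq_norm_sq, Complex.normSq_apply,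
      Complex.normSq_apply]
    simp
    nlinarith
  have hle2 : ‖m + 2‖ ≤ 2 * ‖1 + m‖ := by
    have h2 : (1 : ℝ) ≤ ‖1 + m‖ := by
      have := (le_abs_self _).trans (Complex.abs_re_le_norm (1 + m))
      rw [h1re] at this; linarith
    have h3 : m + 2 = (1 + m) + 1 := by ring
    rw [h3]
    refine (norm_add_le _ _).trans ?_
    rw [norm_one]; linarith
  have harg : 2 * |κ| * |arg (1 + m)| ≤ 2 := by
    have h2 : |arg (1 + m)| ≤ 2 * |τ| := by
      refine (abs_arg_le_of_re_pos (by rw [h1re]; linarith)).trans ?_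
      rw [h1re, div_le_iff₀ (by linarith), hre]
      simp only [add_im, one_im, zero_add]
      rw [him, abs_mul, abs_of_pos he]
      have h3 : |Real.sin τ| ≤ |τ| := Real.abs_sin_le_abs
      have h4 := abs_nonneg τ
      nlinarith [mul_nonneg h4 he.le, mul_le_mul_of_nonneg_left h3 he.le]
    nlinarith [abs_nonneg κ]
  have hA : ‖(m + 2) ^ ((s - 1 : ℝ) : ℂ)‖ * ‖(1 + m) ^ (1 - ((s : ℂ) + 2 * κ * I))‖
      ≤ 2 ^ s * Real.exp 2 := by
    have h2 : (1 + m) ^ (1 - ((s : ℂ) + 2 * κ * I))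
        = (1 + m) * (1 + m) ^ (-((s : ℂ) + 2 * κ * I)) := by
      rw [sub_eq_add_neg, Complex.cpow_add _ _ h1ne, Complex.cpow_one]
    have h3 := norm_cpow_neg_le h1ne s κ 2 harg
    rw [h2, norm_mul, Complex.norm_cpow_real]
    have h4 : ‖m + 2‖ ^ (s - 1) ≤ 2 ^ s * ‖1 + m‖ ^ (s - 1) := by
      rcases le_total 1 s with h5 | h5
      · calc ‖m + 2‖ ^ (s - 1) ≤ (2 * ‖1 + m‖) ^ (s - 1) :=
              Real.rpow_le_rpow (norm_nonneg _) hle2 (by linarith)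
          _ = 2 ^ (s - 1) * ‖1 + m‖ ^ (s - 1) := Real.mul_rpow (by norm_num) hn1.le
          _ ≤ _ := by
            gcongr
            · norm_num
            · linarith
      · calc ‖m + 2‖ ^ (s - 1) ≤ ‖1 + m‖ ^ (s - 1) :=
              Real.rpow_le_rpow_of_nonpos hn1 hle1 (by linarith)
          _ ≤ _ := le_mul_of_one_le_left (by positivity)
            (Real.one_le_rpow (by norm_num) hs.le)
    calc _ ≤ (2 ^ s * ‖1 + m‖ ^ (s - 1)) * (‖1 + m‖ * (‖1 + m‖ ^ (-s) * Real.exp 2)) := by gcongr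
      _ = 2 ^ s * Real.exp 2 * (‖1 + m‖ ^ (s - 1) * ‖1 + m‖ ^ (1 : ℝ) * ‖1 + m‖ ^ (-s)) := by
        rw [Real.rpow_one]; ring
      _ = 2 ^ s * Real.exp 2 := by
        rw [← Real.rpow_add hn1, ← Real.rpow_add hn1]
        rw [show s - 1 + 1 + -s = 0 by ring, Real.rpow_zero, mul_one]
  have hB : ‖cexp (s * (y + τ * I))‖ = Real.exp (s * y) := by
    rw [Complex.norm_exp]; simp
  have hC : ‖cexp (I * z * (1 + m))‖
      = Real.exp (-(z.im + (z.im * Real.cos τ + z.re * Real.sin τ) * Real.exp y)) := by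
    rw [Complex.norm_exp]
    congr 1
    simp only [mul_re, I_re, zero_mul, I_im, one_mul, zero_sub, mul_im, add_re, one_re, add_im,
      one_im, hre, him]
    ring
  rw [rotatedIntegrand, norm_mul, norm_mul, norm_mul, hB, ← hm, hC]
  calc _ = Real.exp (s * y) * (‖(m + 2) ^ ((s - 1 : ℝ) : ℂ)‖ *
        ‖(1 + m) ^ (1 - ((s : ℂ) + 2 * κ * I))‖) *
        Real.exp (-(z.im + (z.im * Real.cos τ + z.re * Real.sin τ) * Real.exp y)) := by ring
    _ ≤ Real.exp (s * y) * (2 ^ s * Real.exp 2) *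
        Real.exp (-(z.im + (z.im * Real.cos τ + z.re * Real.sin τ) * Real.exp y)) := by gcongr
    _ = _ := by ring

lemma differentiableAt_rotatedIntegrand {s κ y τ : ℝ} (z : ℂ) (h : |τ| ≤ 1 / 2) :
    DifferentiableAt ℂ (rotatedIntegrand s κ z) (y + τ * I) := by
  have hre : 0 < (cexp (y + τ * I)).re := by
    rw [exp_add_mul_I_re]; exact mul_pos (Real.exp_pos y) (by linarith [half_le_cos h])
  unfold rotatedIntegrand
  refine DifferentiableAt.mul (DifferentiableAt.mul (DifferentiableAt.mul (by fun_prop) ?_) ?_)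
    (by fun_prop)
  · exact DifferentiableAt.cpow_const (by fun_prop) (Or.inl (by simp; linarith))
  · exact DifferentiableAt.cpow_const (by fun_prop) (Or.inl (by simp; linarith))

/-- The width `1/(2(1+|κ|))` of the strips in which contours are moved: small enough for the
factors `w^{2iκ}` to remain bounded there. -/
noncomputable def stripWidth (κ : ℝ) : ℝ := 1 / (2 * (1 + |κ|))

lemma stripWidth_pos (κ : ℝ) : 0 < stripWidth κ := by
  unfold stripWidth; have := abs_nonneg κ; positivity

lemma stripWidth_le (κ : ℝ) : stripWidth κ ≤ 1 / 2 := by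
  unfold stripWidth
  have := abs_nonneg κ
  exact one_div_le_one_div_of_le (by norm_num) (by linarith)

lemma abs_mul_stripWidth_le (κ : ℝ) : |κ| * stripWidth κ ≤ 1 / 2 := by
  unfold stripWidth
  have := abs_nonneg κ
  rw [mul_one_div, div_le_div_iff₀ (by positivity) (by norm_num)]
  linarith

lemma strip_abs_le {κ τ : ℝ} (h0 : 0 ≤ τ) (h1 : τ ≤ stripWidth κ) :
    |τ| ≤ 1 / 2 ∧ |κ| * |τ| ≤ 1 / 2 := by
  rw [abs_of_nonneg h0]
  exact ⟨h1.trans (stripWidth_le κ),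
    (mul_le_mul_of_nonneg_left h1 (abs_nonneg κ)).trans (abs_mul_stripWidth_le κ)⟩

/-- In the first quadrant `G_b(λ)` decays like `|λ|^{-s}` even near the real axis; this is seen by
rotating the contour of integration. -/
lemma exists_norm_radialG_le_of_quadrant {n : ℕ} (hn : 1 ≤ n) {s : ℝ} (hs : s = n / 2) :
    ∃ C : ℝ, 0 < C ∧ ∀ (κ : ℝ) (z : ℂ), 0 ≤ z.re → 0 < z.im →
      ‖radialG n ((s : ℂ) + 2 * κ * I) z‖ ≤ C * (1 + |κ|) ^ s * ‖z‖ ^ (-s) := by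
  have hs0 : 0 < s := by rw [hs]; have : (1 : ℝ) ≤ n := by exact_mod_cast hn
                         linarith
  have hΓ := Real.Gamma_pos_of_pos hs0
  refine ⟨2 ^ s * Real.exp 2 * (4 ^ s * Real.Gamma s), by positivity, fun κ z hzr hzi => ?_⟩
  set β := stripWidth κ with hβ
  have hβ0 : 0 < β := stripWidth_pos κ
  have hβ1 : β ≤ 1 / 2 := stripWidth_le κ
  have hz0 : 0 < ‖z‖ := norm_pos_iff.2 fun h => by simp [h] at hzi
  set g : ℝ → ℝ := fun y => 2 ^ s * Real.exp 2 *
    (Real.exp (s * y) * Real.exp (-((7 / 8 * z.im) * Real.exp y))) with hg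
  have hk : 0 < 7 / 8 * z.im := by positivity
  have hshift : ∫ y : ℝ, rotatedIntegrand s κ z y = ∫ y : ℝ, rotatedIntegrand s κ z (y + β * I) := by
    refine integral_shift (g := g) hβ0.le (fun w h0 h1 => ?_) (fun y τ h0 h1 => ?_)
      ((integrable_exp_mul_exp_neg_exp hs0 hk).const_mul _)
      (by simpa using (tendsto_exp_mul_exp_neg_exp_atTop hk).const_mul (2 ^ s * Real.exp 2))
      (by simpa using (tendsto_exp_mul_exp_neg_exp_atBot hs0 hk).const_mul (2 ^ s * Real.exp 2))
    · have := differentiableAt_rotatedIntegrand (s := s) (κ := κ) (y := w.re) (τ := w.im) z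
        (strip_abs_le h0 h1).1
      rwa [Complex.re_add_im] at this
    · obtain ⟨h2, h3⟩ := strip_abs_le h0 h1
      refine (norm_rotatedIntegrand_le z hs0 h2 h3).trans ?_
      have hc := half_le_cos h2
      have hsn : 0 ≤ Real.sin τ := by
        have := half_le_sin h0 (h1.trans hβ1); linarith
      simp only [hg]
      gcongr
      have h4 : 7 / 8 * z.im ≤ z.im * Real.cos τ + z.re * Real.sin τ := by
        nlinarith [mul_nonneg hzr hsn]
      have := mul_le_mul_of_nonneg_right h4 (Real.exp_pos y).le
      linarith
  rw [radialG_eq_integral_rotatedIntegrand hn hs, hshift]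
  have hk2 : 0 < β / 2 * ‖z‖ := by positivity
  have hint := (integrable_exp_mul_exp_neg_exp hs0 hk2).const_mul (2 ^ s * Real.exp 2)
  refine (norm_integral_le_of_norm_le hint (Eventually.of_forall fun y => ?_)).trans ?_
  -- on the upper edge the exponential rate is a multiple of `|z|`
  · obtain ⟨h2, h3⟩ := strip_abs_le hβ0.le (le_refl β)
    refine (norm_rotatedIntegrand_le z hs0 h2 h3).trans ?_
    have hc := half_le_cos h2
    have hsn := half_le_sin hβ0.le hβ1
    have hnz : ‖z‖ ≤ z.re + z.im := by
      have := Complex.norm_le_abs_re_add_abs_im z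
      rwa [abs_of_nonneg hzr, abs_of_pos hzi] at this
    gcongr
    have h4 : β / 2 * ‖z‖ ≤ z.im * Real.cos β + z.re * Real.sin β := by nlinarith
    have := mul_le_mul_of_nonneg_right h4 (Real.exp_pos y).le
    linarith
  · rw [integral_const_mul, integral_exp_mul_exp_neg_exp hs0 hk2, Real.mul_rpow (by positivity)
      hz0.le]
    have h5 : (β / 2) ^ (-s) = 4 ^ s * (1 + |κ|) ^ s := by
      have h6 : β / 2 = (4 * (1 + |κ|))⁻¹ := by
        rw [hβ, stripWidth]; field_simp; norm_num
      have := abs_nonneg κ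
      rw [h6, Real.inv_rpow (by positivity), Real.rpow_neg (by positivity), inv_inv,
        Real.mul_rpow (by norm_num) (by positivity)]
    rw [h5]
    apply le_of_eq
    ring

end QuadrantBound

/-! ### The phase in light-cone coordinates -/

section ConePhase

/-- The phase `r sinh θ + (t + iδ) cosh θ` in light-cone coordinates `p = t + r`, `q = t - r`. -/
noncomputable def conePhase (p q δ : ℝ) (z : ℂ) : ℂ :=
  ((p + δ * I) * cexp z + (q + δ * I) * cexp (-z)) / 2

lemma conePhase_re (p q δ θ τ : ℝ) : (conePhase p q δ (θ + τ * I)).re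
    = (Real.cos τ * (p * Real.exp θ + q * Real.exp (-θ))
      - δ * Real.sin τ * (Real.exp θ - Real.exp (-θ))) / 2 := by
  have h : -((θ : ℂ) + τ * I) = ((-θ : ℝ) : ℂ) + ((-τ : ℝ) : ℂ) * I := by push_cast; ring
  have h2 : ∀ w : ℂ, (w / 2).re = w.re / 2 := fun w => by
    rw [show (2 : ℂ) = ((2 : ℝ) : ℂ) by norm_num, Complex.div_ofReal_re]
  rw [conePhase, h2, h]
  simp only [add_re, mul_re, add_im, mul_im, exp_add_mul_I_re, exp_add_mul_I_im, ofReal_re,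
    ofReal_im, I_re, I_im, Real.cos_neg, Real.sin_neg]
  ring

lemma conePhase_im (p q δ θ τ : ℝ) : (conePhase p q δ (θ + τ * I)).im
    = (Real.sin τ * (p * Real.exp θ - q * Real.exp (-θ))
      + δ * Real.cos τ * (Real.exp θ + Real.exp (-θ))) / 2 := by
  have h : -((θ : ℂ) + τ * I) = ((-θ : ℝ) : ℂ) + ((-τ : ℝ) : ℂ) * I := by push_cast; ring
  have h2 : ∀ w : ℂ, (w / 2).im = w.im / 2 := fun w => by
    rw [show (2 : ℂ) = ((2 : ℝ) : ℂ) by norm_num, Complex.div_ofReal_im]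
  rw [conePhase, h2, h]
  simp only [add_re, mul_re, add_im, mul_im, exp_add_mul_I_re, exp_add_mul_I_im, ofReal_re,
    ofReal_im, I_re, I_im, Real.cos_neg, Real.sin_neg]
  ring

lemma hasDerivAt_conePhase (p q δ : ℝ) (z : ℂ) :
    HasDerivAt (conePhase p q δ) (conePhase p q δ z - (q + δ * I) * cexp (-z)) z := by
  have h1 : HasDerivAt (fun z => cexp (-z)) (-cexp (-z)) z := by
    simpa using (hasDerivAt_neg z).cexp
  have h2 := (((Complex.hasDerivAt_exp z).const_mul (p + δ * I : ℂ)).add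
    (h1.const_mul (q + δ * I : ℂ))).div_const 2
  refine h2.congr_deriv ?_
  rw [conePhase]; ring

lemma norm_real_add_mul_I_le (a δ : ℝ) (hδ : 0 ≤ δ) : ‖(a + δ * I : ℂ)‖ ≤ |a| + δ := by
  refine (norm_add_le _ _).trans ?_
  rw [norm_mul, Complex.norm_I, mul_one, Complex.norm_real, Complex.norm_real, Real.norm_eq_abs,
    Real.norm_of_nonneg hδ]

lemma norm_exp_add_mul_I (θ τ : ℝ) : ‖cexp (θ + τ * I)‖ = Real.exp θ := by
  rw [Complex.norm_exp]; simp

lemma norm_exp_neg_add_mul_I (θ τ : ℝ) : ‖cexp (-(θ + τ * I))‖ = Real.exp (-θ) := by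
  rw [Complex.norm_exp]; simp

lemma norm_conePhase_le {p q δ : ℝ} (hp : 0 ≤ p) (hδ : 0 ≤ δ) (θ τ : ℝ) :
    ‖conePhase p q δ (θ + τ * I)‖
      ≤ ((p + δ) * Real.exp θ + (|q| + δ) * Real.exp (-θ)) / 2 := by
  have h1 := norm_real_add_mul_I_le p δ hδ
  have h2 := norm_real_add_mul_I_le q δ hδ
  rw [abs_of_nonneg hp] at h1
  rw [conePhase, norm_div, Complex.norm_ofNat]
  gcongr
  refine (norm_add_le _ _).trans ?_
  rw [norm_mul, norm_mul, norm_exp_add_mul_I, norm_exp_neg_add_mul_I]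
  gcongr

lemma sin_le_half {τ : ℝ} (h0 : 0 ≤ τ) (h : τ ≤ 1 / 2) : Real.sin τ ≤ 1 / 2 :=
  (Real.sin_le h0).trans h

lemma le_conePhase_im {p q δ θ τ : ℝ} (hδ : 0 ≤ δ) (h0 : 0 ≤ τ) (h : τ ≤ 1 / 2) :
    Real.sin τ * ((p + δ) * Real.exp θ - (|q| + δ) * Real.exp (-θ)) / 2 + δ * Real.cosh θ / 4
      ≤ (conePhase p q δ (θ + τ * I)).im := by
  have hs0 : 0 ≤ Real.sin τ := by linarith [half_le_sin h0 h]
  have hs1 := sin_le_half h0 h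
  have hc := half_le_cos (by rwa [abs_of_nonneg h0] : |τ| ≤ 1 / 2)
  rw [conePhase_im, Real.cosh_eq]
  have e1 := Real.exp_pos θ
  have e2 := Real.exp_pos (-θ)
  have h1 : q ≤ |q| := le_abs_self q
  have h2 : Real.sin τ * (q * Real.exp (-θ)) ≤ Real.sin τ * (|q| * Real.exp (-θ)) := by gcongr
  have h3 : δ * Real.exp θ * Real.sin τ ≤ δ * Real.exp θ * (1 / 2) := by gcongr
  have h4 : δ * Real.exp θ * (7 / 8) ≤ δ * Real.exp θ * Real.cos τ := by gcongr
  have h5 : δ * Real.exp (-θ) * (7 / 8) ≤ δ * Real.exp (-θ) * Real.cos τ := by gcongr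
  have h6 : 0 ≤ δ * Real.exp (-θ) * Real.sin τ := by positivity
  have h7 : 0 ≤ δ * Real.exp θ := by positivity
  have h8 : 0 ≤ δ * Real.exp (-θ) := by positivity
  nlinarith

lemma le_conePhase_im_of_nonpos {p q δ θ τ : ℝ} (hq : q ≤ 0) (hδ : 0 ≤ δ) (h0 : 0 ≤ τ)
    (h : τ ≤ 1 / 2) :
    Real.sin τ * ((p + δ) * Real.exp θ + (|q| + δ) * Real.exp (-θ)) / 2 + δ * Real.cosh θ / 4
      ≤ (conePhase p q δ (θ + τ * I)).im := by
  have hs0 : 0 ≤ Real.sin τ := by linarith [half_le_sin h0 h]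
  have hs1 := sin_le_half h0 h
  have hc := half_le_cos (by rwa [abs_of_nonneg h0] : |τ| ≤ 1 / 2)
  rw [conePhase_im, Real.cosh_eq, abs_of_nonpos hq]
  have e1 := Real.exp_pos θ
  have e2 := Real.exp_pos (-θ)
  have h3 : δ * Real.exp θ * Real.sin τ ≤ δ * Real.exp θ * (1 / 2) := by gcongr
  have h3' : δ * Real.exp (-θ) * Real.sin τ ≤ δ * Real.exp (-θ) * (1 / 2) := by gcongr
  have h4 : δ * Real.exp θ * (7 / 8) ≤ δ * Real.exp θ * Real.cos τ := by gcongr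
  have h5 : δ * Real.exp (-θ) * (7 / 8) ≤ δ * Real.exp (-θ) * Real.cos τ := by gcongr
  have h7 : 0 ≤ δ * Real.exp θ := by positivity
  have h8 : 0 ≤ δ * Real.exp (-θ) := by positivity
  nlinarith

/-- The point where the two light-cone components of the phase balance, up to a factor. -/
noncomputable def balancePoint (P D : ℝ) : ℝ := Real.log (2 * D / P) / 2

lemma exp_two_mul_balancePoint {P D : ℝ} (hP : 0 < P) (hD : 0 < D) :
    Real.exp (2 * balancePoint P D) = 2 * D / P := by
  rw [balancePoint, mul_div_cancel₀ _ (two_ne_zero), Real.exp_log (by positivity)]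

lemma two_mul_le_of_balancePoint_le {P D θ : ℝ} (hP : 0 < P) (hD : 0 < D)
    (h : balancePoint P D ≤ θ) : 2 * (D * Real.exp (-θ)) ≤ P * Real.exp θ := by
  have h1 : 2 * D / P ≤ Real.exp (2 * θ) := by
    rw [← exp_two_mul_balancePoint hP hD]; exact Real.exp_le_exp.2 (by linarith)
  rw [div_le_iff₀ hP] at h1
  have h2 : Real.exp (2 * θ) = Real.exp θ * Real.exp θ := by rw [← Real.exp_add]; congr 1; ring
  have h3 : Real.exp θ * Real.exp (-θ) = 1 := by rw [← Real.exp_add]; simp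
  have e2 := Real.exp_pos (-θ)
  calc 2 * (D * Real.exp (-θ)) = (2 * D) * Real.exp (-θ) := by ring
    _ ≤ (Real.exp (2 * θ) * P) * Real.exp (-θ) := by gcongr
    _ = P * Real.exp θ * (Real.exp θ * Real.exp (-θ)) := by rw [h2]; ring
    _ = _ := by rw [h3, mul_one]

/-- On the upper edge of the strip the phase has a large imaginary part beyond the balance point. -/
lemma le_conePhase_im_of_balancePoint_le {p q δ θ κ : ℝ} (hp : 0 < p) (hδ : 0 < δ)
    (h : balancePoint (p + δ) (|q| + δ) ≤ θ) :
    stripWidth κ / 8 * (p + δ) * Real.exp θ ≤ (conePhase p q δ (θ + stripWidth κ * I)).im := by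
  have hD : 0 < |q| + δ := by positivity
  have h1 := two_mul_le_of_balancePoint_le (by positivity) hD h
  refine le_trans ?_ (le_conePhase_im hδ.le (stripWidth_pos κ).le (stripWidth_le κ))
  have h2 := half_le_sin (stripWidth_pos κ).le (stripWidth_le κ)
  have h3 : 0 ≤ δ * Real.cosh θ := by have := Real.cosh_pos θ; positivity
  have h4 : 0 ≤ (p + δ) * Real.exp θ := by positivity
  have h5 := stripWidth_pos κ
  have h6 : (p + δ) * Real.exp θ / 2 ≤ (p + δ) * Real.exp θ - (|q| + δ) * Real.exp (-θ) := by
    linarith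
  have h7 : stripWidth κ / 2 * ((p + δ) * Real.exp θ / 2)
      ≤ Real.sin (stripWidth κ) * ((p + δ) * Real.exp θ - (|q| + δ) * Real.exp (-θ)) := by
    gcongr
    linarith
  nlinarith

lemma conePhase_im_pos_of_balancePoint_le {p q δ θ τ : ℝ} (hp : 0 < p) (hδ : 0 < δ)
    (h0 : 0 ≤ τ) (h1 : τ ≤ 1 / 2) (h : balancePoint (p + δ) (|q| + δ) ≤ θ) :
    δ * Real.cosh θ / 4 ≤ (conePhase p q δ (θ + τ * I)).im := by
  have hD : 0 < |q| + δ := by positivity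
  have h1' := two_mul_le_of_balancePoint_le (by positivity) hD h
  refine le_trans ?_ (le_conePhase_im hδ.le h0 h1)
  have h2 := half_le_sin h0 h1
  have h4 : 0 ≤ (p + δ) * Real.exp θ := by positivity
  have : 0 ≤ Real.sin τ * ((p + δ) * Real.exp θ - (|q| + δ) * Real.exp (-θ)) :=
    mul_nonneg (by linarith) (by linarith)
  linarith

end ConePhase

/-! ### Powers of the hyperbolic cosine -/

section CoshPowers

lemma half_exp_le_cosh (θ : ℝ) : Real.exp θ / 2 ≤ Real.cosh θ := by
  rw [Real.cosh_eq]; linarith [Real.exp_pos (-θ)]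

lemma half_exp_neg_le_cosh (θ : ℝ) : Real.exp (-θ) / 2 ≤ Real.cosh θ := by
  rw [Real.cosh_eq]; linarith [Real.exp_pos θ]

lemma cosh_rpow_neg_le {a : ℝ} (ha : 0 ≤ a) (θ : ℝ) :
    Real.cosh θ ^ (-a) ≤ 2 ^ a * Real.exp (-(a * θ)) := by
  have h : Real.cosh θ ^ (-a) ≤ (Real.exp θ / 2) ^ (-a) :=
    Real.rpow_le_rpow_of_nonpos (by positivity) (half_exp_le_cosh θ) (by linarith)
  refine h.trans (le_of_eq ?_)
  rw [Real.div_rpow (Real.exp_pos _).le (by norm_num), ← Real.exp_mul,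
    Real.rpow_neg (by norm_num : (0 : ℝ) ≤ 2), div_inv_eq_mul, mul_comm]
  congr 2; ring

lemma cosh_rpow_neg_le' {a : ℝ} (ha : 0 ≤ a) (θ : ℝ) :
    Real.cosh θ ^ (-a) ≤ 2 ^ a * Real.exp (a * θ) := by
  have := cosh_rpow_neg_le ha (-θ)
  rw [Real.cosh_neg] at this
  simpa using this

lemma continuous_cosh_rpow (a : ℝ) : Continuous fun θ : ℝ => Real.cosh θ ^ a :=
  Real.continuous_cosh.rpow_const fun θ => Or.inl (Real.cosh_pos θ).ne'

lemma integrable_cosh_rpow_neg {a : ℝ} (ha : 0 < a) : Integrable fun θ : ℝ => Real.cosh θ ^ (-a) := by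
  rw [← integrableOn_univ, ← Iic_union_Ioi (a := (0 : ℝ))]
  have hm := (continuous_cosh_rpow (-a)).aestronglyMeasurable (μ := volume)
  refine IntegrableOn.union ?_ ?_
  · refine Integrable.mono' ((integrableOn_exp_mul_Iic ha 0).const_mul (2 ^ a)) hm.restrict
      (Eventually.of_forall fun θ => ?_)
    rw [Real.norm_of_nonneg (by have := Real.cosh_pos θ; positivity)]
    exact cosh_rpow_neg_le' ha.le θ
  · refine Integrable.mono' ((integrableOn_exp_mul_Ioi (neg_lt_zero.2 ha) 0).const_mul (2 ^ a))
      hm.restrict (Eventually.of_forall fun θ => ?_)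
    rw [Real.norm_of_nonneg (by have := Real.cosh_pos θ; positivity), neg_mul]
    exact cosh_rpow_neg_le ha.le θ

lemma tendsto_cosh_rpow_neg_atTop {a : ℝ} (ha : 0 < a) :
    Tendsto (fun θ : ℝ => Real.cosh θ ^ (-a)) atTop (𝓝 0) := by
  refine squeeze_zero (fun θ => by have := Real.cosh_pos θ; positivity)
    (fun θ => cosh_rpow_neg_le ha.le θ) ?_
  have h : Tendsto (fun θ : ℝ => -(a * θ)) atTop atBot :=
    tendsto_neg_atTop_atBot.comp (tendsto_id.const_mul_atTop ha)
  simpa using (Real.tendsto_exp_atBot.comp h).const_mul (2 ^ a)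

lemma tendsto_cosh_rpow_neg_atBot {a : ℝ} (ha : 0 < a) :
    Tendsto (fun θ : ℝ => Real.cosh θ ^ (-a)) atBot (𝓝 0) := by
  have := (tendsto_cosh_rpow_neg_atTop ha).comp tendsto_neg_atBot_atTop
  refine this.congr fun θ => ?_
  simp [Real.cosh_neg]

end CoshPowers

/-! ### Integration by parts on a half-line -/

section IntegrationByParts

/-- If `k u` differs from the derivative of an integrable function `v` by a small error `e`, then
the integral of `k u` over a half-line is small. -/
lemma norm_mul_integral_Ioi_le {u v e : ℝ → ℂ} {g : ℝ → ℝ} {k : ℂ} {a : ℝ}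
    (hd : ∀ θ ∈ Ici a, HasDerivAt v (k * u θ - e θ) θ) (hu : IntegrableOn u (Ioi a))
    (hv : IntegrableOn v (Ioi a)) (he : ∀ θ ∈ Ioi a, ‖e θ‖ ≤ g θ) (hg : IntegrableOn g (Ioi a)) :
    ‖k * ∫ θ in Ioi a, u θ‖ ≤ ‖v a‖ + ∫ θ in Ioi a, g θ := by
  have hee : IntegrableOn e (Ioi a) := by
    refine Integrable.mono' hg ?_ ((ae_restrict_iff' measurableSet_Ioi).2 (Eventually.of_forall he))
    have h1 : AEStronglyMeasurable (fun θ => k * u θ - deriv v θ) (volume.restrict (Ioi a)) :=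
      (hu.aestronglyMeasurable.const_mul k).sub
        (stronglyMeasurable_deriv v).aestronglyMeasurable.restrict
    refine h1.congr ((ae_restrict_iff' measurableSet_Ioi).2 (Eventually.of_forall fun θ hθ => ?_))
    simp only [(hd θ (Ioi_subset_Ici_self hθ)).deriv]
    ring
  have hku : IntegrableOn (fun θ => k * u θ) (Ioi a) := hu.const_mul k
  have hint : IntegrableOn (fun θ => k * u θ - e θ) (Ioi a) := hku.sub hee
  have hlim := tendsto_zero_of_hasDerivAt_of_integrableOn_Ioi
    (fun θ hθ => hd θ (Ioi_subset_Ici_self hθ)) hint hv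
  have h := integral_Ioi_of_hasDerivAt_of_tendsto' hd hint hlim
  rw [integral_sub hku hee, integral_const_mul] at h
  have h2 : k * ∫ θ in Ioi a, u θ = -v a + ∫ θ in Ioi a, e θ := by linear_combination h
  rw [h2]
  refine (norm_add_le _ _).trans ?_
  rw [norm_neg]
  gcongr
  exact norm_integral_le_of_norm_le hg
    ((ae_restrict_iff' measurableSet_Ioi).2 (Eventually.of_forall he))

lemma integrable_exp_mul_cosh_rpow_neg {γ a : ℝ} (h : |γ| < a) :
    Integrable fun θ : ℝ => Real.exp (γ * θ) * Real.cosh θ ^ (-a) := by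
  have hi := (integrable_cosh_rpow_neg (a := a - |γ|) (by linarith)).const_mul (2 ^ |γ|)
  refine Integrable.mono' hi ?_ (Eventually.of_forall fun θ => ?_)
  · exact ((Real.continuous_exp.comp (continuous_const.mul continuous_id)).mul
      (continuous_cosh_rpow (-a))).aestronglyMeasurable
  · have hc := Real.cosh_pos θ
    rw [Real.norm_of_nonneg (by positivity)]
    have h1 : Real.exp (γ * θ) ≤ 2 ^ |γ| * Real.cosh θ ^ |γ| := by
      rw [← Real.mul_rpow (by norm_num) hc.le]
      have h2 : Real.exp |θ| ≤ 2 * Real.cosh θ := by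
        rcases abs_cases θ with ⟨h, _⟩ | ⟨h, _⟩ <;> rw [h]
        · linarith [half_exp_le_cosh θ]
        · linarith [half_exp_neg_le_cosh θ]
      calc Real.exp (γ * θ) ≤ Real.exp (|θ| * |γ|) := by
            rw [mul_comm |θ|, ← abs_mul]; exact Real.exp_le_exp.2 (le_abs_self _)
        _ = Real.exp |θ| ^ |γ| := Real.exp_mul _ _
        _ ≤ _ := Real.rpow_le_rpow (Real.exp_pos _).le h2 (abs_nonneg _)
    calc _ ≤ 2 ^ |γ| * Real.cosh θ ^ |γ| * Real.cosh θ ^ (-a) := by gcongr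
      _ = _ := by rw [mul_assoc, ← Real.rpow_add hc]; congr 2; ring

end IntegrationByParts

/-! ### The rapidity integrand -/

section ConeIntegrand

/-- The integrand `cosh^{-b} G_b(λ)`, `b = s + 2iκ`, of the representation of the kernel as an
integral over the rapidity; `λ` is `conePhase`. -/
noncomputable def coneIntegrand (n : ℕ) (s κ p q δ : ℝ) (z : ℂ) : ℂ :=
  Complex.cosh z ^ (-((s : ℂ) + 2 * κ * I)) * radialG n ((s : ℂ) + 2 * κ * I) (conePhase p q δ z)

/-- The part of `4iκ u - u'` that is integrable uniformly in all parameters, `u` being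
`coneIntegrand`. -/
noncomputable def coneError (n : ℕ) (s κ p q δ : ℝ) (z : ℂ) : ℂ :=
  ((s : ℂ) + 2 * κ * I) * (1 + Complex.tanh z) * coneIntegrand n s κ p q δ z
  + Complex.cosh z ^ (-((s : ℂ) + 2 * κ * I)) *
    (((s : ℂ) + 2 * κ * I) * radialG n ((s : ℂ) + 2 * κ * I + 2) (conePhase p q δ z)
      - I * conePhase p q δ z * radialG n ((s : ℂ) + 2 * κ * I + 1) (conePhase p q δ z))
  + Complex.cosh z ^ (-((s : ℂ) + 2 * κ * I)) * ((q + δ * I) * cexp (-z) *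
    (I * radialG n ((s : ℂ) + 2 * κ * I - 1) (conePhase p q δ z)))

/-- The oscillation of `coneIntegrand` is that of `e^{4iκθ}`, up to the error `coneError`. This is
where the factor `κ` in the final estimate is used. -/
lemma hasDerivAt_coneIntegrand {n : ℕ} (hn : 1 ≤ n) {s κ p q δ θ τ : ℝ} (hs : s = n / 2)
    (hτ : |τ| ≤ 1 / 2) (him : 0 < (conePhase p q δ (θ + τ * I)).im) :
    HasDerivAt (coneIntegrand n s κ p q δ)
      (4 * κ * I * coneIntegrand n s κ p q δ (θ + τ * I) - coneError n s κ p q δ (θ + τ * I))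
      (θ + τ * I) := by
  set z : ℂ := θ + τ * I with hz
  set b : ℂ := (s : ℂ) + 2 * κ * I with hb
  have h1 := hasDerivAt_cosh_cpow (cosh_mem_slitPlane (θ := θ) hτ) b
  have h2 := (hasDerivAt_radialG hn b him).comp z (hasDerivAt_conePhase p q δ z)
  have h3 := radialG_dilation hn b him
  -- the homogeneity degree of `G_b` turns the rate `-b` of `cosh^{-b}` into the rate `4iκ`
  have hnb : (n : ℂ) - b = b - 4 * κ * I := by
    have : (n : ℂ) = 2 * s := by rw [hs]; push_cast; ring
    rw [this, hb]; ring
  rw [hnb] at h3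
  refine (h1.mul h2).congr_deriv ?_
  simp only [coneError, coneIntegrand, Function.comp_apply]
  rw [← hb]
  linear_combination (Complex.cosh z ^ (-b)) * h3

lemma differentiableAt_coneIntegrand {n : ℕ} (hn : 1 ≤ n) {s κ p q δ θ τ : ℝ}
    (hτ : |τ| ≤ 1 / 2) (him : 0 < (conePhase p q δ (θ + τ * I)).im) :
    DifferentiableAt ℂ (coneIntegrand n s κ p q δ) (θ + τ * I) :=
  ((hasDerivAt_cosh_cpow (cosh_mem_slitPlane hτ) _).differentiableAt).mul
    ((hasDerivAt_radialG hn _ him).comp _ (hasDerivAt_conePhase p q δ _)).differentiableAt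

lemma norm_coneIntegrand_le {n : ℕ} (hn : 1 ≤ n) {s κ p q δ θ τ μ : ℝ} (hs : s = n / 2)
    (h : |τ| ≤ 1 / 2) (hκ : |κ| * |τ| ≤ 1 / 2) (hμ : 0 < μ)
    (him : μ ≤ (conePhase p q δ (θ + τ * I)).im) :
    ‖coneIntegrand n s κ p q δ (θ + τ * I)‖
      ≤ 2 ^ s * Real.exp 2 * Real.Gamma s * (Real.cosh θ ^ (-s) * μ ^ (-s)) := by
  have hs0 : 0 ≤ s := by rw [hs]; positivity
  rw [coneIntegrand, norm_mul]
  calc _ ≤ (2 ^ s * Real.exp 2) * Real.cosh θ ^ (-s) * (Real.Gamma s * μ ^ (-s)) := by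
        have := Real.cosh_pos θ
        gcongr
        · exact norm_cosh_cpow_le hs0 h hκ
        · exact norm_radialG_le_gamma hn hs (by simp) hμ him
    _ = _ := by ring

lemma rpow_neg_mul_exp {k : ℝ} (hk : 0 < k) (s θ : ℝ) :
    (k * Real.exp θ) ^ (-s) = k ^ (-s) * Real.exp (-(s * θ)) := by
  rw [Real.mul_rpow hk.le (Real.exp_pos _).le, ← Real.exp_mul]; congr 2; ring

lemma norm_one_add_tanh_le {θ τ : ℝ} (h : |τ| ≤ 1 / 2) :
    ‖1 + Complex.tanh (θ + τ * I)‖ ≤ 2 * Real.exp θ / Real.cosh θ := by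
  have hne : Complex.cosh (θ + τ * I) ≠ 0 := Complex.slitPlane_ne_zero (cosh_mem_slitPlane h)
  have h1 : 1 + Complex.tanh (θ + τ * I) = cexp (θ + τ * I) / Complex.cosh (θ + τ * I) := by
    rw [Complex.tanh_eq_sinh_div_cosh, ← Complex.cosh_add_sinh]; field_simp
  have hc := Real.cosh_pos θ
  have h2 := half_cosh_le_norm_cosh (θ := θ) h
  rw [h1, norm_div, norm_exp_add_mul_I, div_le_div_iff₀ (norm_pos_iff.2 hne) hc]
  nlinarith [Real.exp_pos θ]

lemma norm_two_mul_add_le (s κ : ℝ) (hs : 0 ≤ s) :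
    ‖(s : ℂ) + 2 * κ * I‖ ≤ (s + 2) * (1 + |κ|) := by
  refine (norm_add_le _ _).trans ?_
  rw [Complex.norm_real, Real.norm_of_nonneg hs, norm_mul, norm_mul, Complex.norm_I,
    Complex.norm_real, Real.norm_eq_abs, Complex.norm_ofNat]
  nlinarith [abs_nonneg κ]

/-- A majorant of `coneError` beyond the balance point on the upper edge of the strip. -/
lemma exists_norm_coneError_le {n : ℕ} (hn : 1 ≤ n) {s : ℝ} (hs : s = n / 2) :
    ∃ C : ℝ, 0 < C ∧ ∀ κ p q δ θ k : ℝ, 0 < p → 0 < δ → k = stripWidth κ / 8 * (p + δ) →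
      balancePoint (p + δ) (|q| + δ) ≤ θ →
      ‖coneError n s κ p q δ (θ + stripWidth κ * I)‖ ≤ C * (1 + |κ|) * k ^ (-s) *
        (Real.exp ((1 - s) * θ) * Real.cosh θ ^ (-(s + 1))
          + k ^ (min s 1) * (Real.exp (min s 1 * θ) * Real.exp (-(k / 4 * Real.exp θ)))
          + (|q| + δ) / (p + δ) * Real.exp (-2 * θ)) := by
  have hs0 : 0 < s := by rw [hs]; have : (1 : ℝ) ≤ n := by exact_mod_cast hn
                         linarith
  obtain ⟨C, hC, hCb⟩ := exists_norm_dilation_error_le hn hs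
  have hΓ := Real.Gamma_pos_of_pos hs0
  set K : ℝ := 2 ^ s * Real.exp 2 with hK
  have hK0 : 0 < K := by positivity
  set C1 : ℝ := (s + 2) * (2 * (K * Real.Gamma s)) with hC1
  set C2 : ℝ := K * 2 ^ s * C * (s + 18) with hC2
  set C3 : ℝ := K * 2 ^ s * (2 ^ (s + 1) * Real.Gamma s) * 16 with hC3
  have hC10 : 0 < C1 := by positivity
  have hC20 : 0 < C2 := by positivity
  have hC30 : 0 < C3 := by positivity
  refine ⟨C1 + C2 + C3, by positivity, fun κ p q δ θ k hp hδ hk hθ => ?_⟩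
  set α := stripWidth κ with hα
  set X := 1 + |κ| with hX
  have hX0 : 0 < X := by positivity
  have hα0 : 0 < α := stripWidth_pos κ
  have hαX : α / 8 = 1 / (16 * X) := by rw [hα, stripWidth, ← hX]; field_simp; norm_num
  have hk0 : 0 < k := by rw [hk]; positivity
  have hPk : p + δ = 16 * X * k := by rw [hk, hαX]; field_simp
  obtain ⟨h2, h3⟩ := strip_abs_le (κ := κ) hα0.le le_rfl
  have him := le_conePhase_im_of_balancePoint_le (κ := κ) hp hδ hθ
  rw [← hα, ← hk] at him
  set μ := k * Real.exp θ with hμ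
  have hμ0 : 0 < μ := by positivity
  have hD : 0 < |q| + δ := by positivity
  -- beyond the balance point `e^θ` dominates in the phase, so `|λ|` and `Im λ` are comparable
  have hz : ‖conePhase p q δ (θ + α * I)‖ ≤ 16 * X * μ := by
    refine (norm_conePhase_le hp.le hδ.le θ α).trans ?_
    have h4 := two_mul_le_of_balancePoint_le (by positivity) hD hθ
    have h5 : 16 * X * μ = (p + δ) * Real.exp θ := by rw [hPk, hμ]; ring
    rw [h5]
    have : 0 < (p + δ) * Real.exp θ := by positivity
    linarith
  set b : ℂ := (s : ℂ) + 2 * κ * I with hb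
  have hbn : ‖b‖ ≤ (s + 2) * X := norm_two_mul_add_le s κ hs0.le
  have hbre : b.re = s := by simp [hb]
  have hcosh := norm_cosh_cpow_le (θ := θ) hs0.le h2 h3
  rw [← hb, ← hK] at hcosh
  have hch := Real.cosh_pos θ
  have hcosh2 : K * Real.cosh θ ^ (-s) ≤ K * (2 ^ s * Real.exp (s * θ)) := by
    gcongr; exact cosh_rpow_neg_le' hs0.le θ
  have hμs : μ ^ (-s) = k ^ (-s) * Real.exp (-(s * θ)) := rpow_neg_mul_exp hk0 s θ
  have hee : Real.exp (s * θ) * Real.exp (-(s * θ)) = 1 := by rw [← Real.exp_add]; simp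
  have t1 : ‖b * (1 + Complex.tanh (θ + α * I)) * coneIntegrand n s κ p q δ (θ + α * I)‖
      ≤ C1 * X * k ^ (-s) * (Real.exp ((1 - s) * θ) * Real.cosh θ ^ (-(s + 1))) := by
    rw [norm_mul, norm_mul]
    calc _ ≤ ((s + 2) * X) * (2 * Real.exp θ / Real.cosh θ) *
          (K * Real.Gamma s * (Real.cosh θ ^ (-s) * μ ^ (-s))) := by
          gcongr
          · exact norm_one_add_tanh_le h2
          · exact norm_coneIntegrand_le hn hs h2 h3 hμ0 him
      _ = _ := by
          have e1 : Real.cosh θ ^ (-(s + 1)) = Real.cosh θ ^ (-s) / Real.cosh θ := by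
            rw [neg_add, Real.rpow_add hch, Real.rpow_neg_one]; rfl
          have e2 : Real.exp ((1 - s) * θ) = Real.exp θ * Real.exp (-(s * θ)) := by
            rw [← Real.exp_add]; congr 1; ring
          rw [hμs, e1, e2, hC1]; ring
  have t2 : ‖Complex.cosh (θ + α * I) ^ (-b) * (b * radialG n (b + 2) (conePhase p q δ (θ + α * I))
      - I * conePhase p q δ (θ + α * I) * radialG n (b + 1) (conePhase p q δ (θ + α * I)))‖
      ≤ C2 * X * k ^ (-s) * (k ^ (min s 1) *
        (Real.exp (min s 1 * θ) * Real.exp (-(k / 4 * Real.exp θ)))) := by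
    rw [norm_mul]
    calc _ ≤ (K * (2 ^ s * Real.exp (s * θ))) * (C * ((s + 2) * X + 16 * X) *
          μ ^ (-s + min s 1) * Real.exp (-(μ / 4))) := by
          gcongr
          · exact hcosh.trans hcosh2
          · refine (hCb b _ μ (16 * X) hbre hμ0 him hz).trans ?_
            gcongr
      _ = C2 * X * k ^ (-s) * (k ^ (min s 1) *
          (Real.exp (min s 1 * θ) * Real.exp (-(k / 4 * Real.exp θ)))) *
          (Real.exp (s * θ) * Real.exp (-(s * θ))) := by
          have e1 : μ ^ min s 1 = k ^ min s 1 * Real.exp (min s 1 * θ) := by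
            have := rpow_neg_mul_exp hk0 (-(min s 1)) θ
            simpa using this
          rw [Real.rpow_add hμ0, hμs, e1, hC2, show μ / 4 = k / 4 * Real.exp θ by rw [hμ]; ring]
          ring
      _ = _ := by rw [hee, mul_one]
  have t3 : ‖Complex.cosh (θ + α * I) ^ (-b) * ((q + δ * I) * cexp (-(θ + α * I)) *
      (I * radialG n (b - 1) (conePhase p q δ (θ + α * I))))‖
      ≤ C3 * X * k ^ (-s) * ((|q| + δ) / (p + δ) * Real.exp (-2 * θ)) := by
    rw [norm_mul, norm_mul, norm_mul, norm_mul, Complex.norm_I, one_mul, norm_exp_neg_add_mul_I]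
    calc _ ≤ (K * (2 ^ s * Real.exp (s * θ))) * ((|q| + δ) * Real.exp (-θ) *
          (2 ^ (s + 1) * Real.Gamma s * μ ^ (-s) * μ⁻¹)) := by
          gcongr
          · exact hcosh.trans hcosh2
          · exact norm_real_add_mul_I_le q δ hδ.le
          · exact norm_radialG_sub_one_le hn hs hbre hμ0 him
      _ = C3 * X * k ^ (-s) * ((|q| + δ) / (p + δ) * Real.exp (-2 * θ)) *
          (Real.exp (s * θ) * Real.exp (-(s * θ))) := by
          have e1 : Real.exp (-2 * θ) = Real.exp (-θ) * (Real.exp θ)⁻¹ := by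
            rw [← Real.exp_neg, ← Real.exp_add]; congr 1; ring
          rw [hμs, hPk, e1, hC3, hμ]
          field_simp
      _ = _ := by rw [hee, mul_one]
  rw [coneError, ← hb]
  refine (norm_add₃_le).trans ((add_le_add_three t1 t2 t3).trans ?_)
  set A1 := Real.exp ((1 - s) * θ) * Real.cosh θ ^ (-(s + 1))
  set A2 := k ^ (min s 1) * (Real.exp (min s 1 * θ) * Real.exp (-(k / 4 * Real.exp θ)))
  set A3 := (|q| + δ) / (p + δ) * Real.exp (-2 * θ)
  have hA1 : 0 ≤ A1 := by positivity
  have hA2 : 0 ≤ A2 := by positivity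
  have hA3 : 0 ≤ A3 := by positivity
  have hkx : 0 ≤ X * k ^ (-s) := by positivity
  calc _ = (X * k ^ (-s)) * (C1 * A1 + C2 * A2 + C3 * A3) := by ring
    _ ≤ (X * k ^ (-s)) * ((C1 + C2 + C3) * A1 + (C1 + C2 + C3) * A2 + (C1 + C2 + C3) * A3) := by
      gcongr <;> linarith
    _ = _ := by ring

end ConeIntegrand

/-! ### The rapidity integral -/

section ConeIntegral

lemma norm_coneIntegrand_le_cosh {n : ℕ} (hn : 1 ≤ n) {s κ p q δ θ τ : ℝ} (hs : s = n / 2)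
    (h : |τ| ≤ 1 / 2) (hκ : |κ| * |τ| ≤ 1 / 2) (hδ : 0 < δ)
    (him : δ * Real.cosh θ / 4 ≤ (conePhase p q δ (θ + τ * I)).im) :
    ‖coneIntegrand n s κ p q δ (θ + τ * I)‖
      ≤ 2 ^ s * Real.exp 2 * Real.Gamma s * (δ / 4) ^ (-s) * Real.cosh θ ^ (-(2 * s)) := by
  have hc := Real.cosh_pos θ
  refine (norm_coneIntegrand_le hn hs h hκ (by positivity) him).trans (le_of_eq ?_)
  rw [show δ * Real.cosh θ / 4 = δ / 4 * Real.cosh θ by ring,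
    Real.mul_rpow (by positivity) hc.le, show -(2 * s) = -s + -s by ring, Real.rpow_add hc]
  ring

lemma exp_neg_two_mul_balancePoint {P D : ℝ} (hP : 0 < P) (hD : 0 < D) :
    Real.exp (-2 * balancePoint P D) = P / (2 * D) := by
  rw [neg_mul, Real.exp_neg, exp_two_mul_balancePoint hP hD, inv_div]

/-- The contribution of the rapidities beyond the balance point, on the upper edge of the strip. -/
lemma exists_norm_integral_coneIntegrand_right_le {n : ℕ} (hn : 1 ≤ n) {s : ℝ} (hs : s = n / 2) :
    ∃ C : ℝ, 0 < C ∧ ∀ κ p q δ : ℝ, 0 < p → 0 < δ →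
      ‖(κ : ℂ) * ∫ θ in Ioi (balancePoint (p + δ) (|q| + δ)),
          coneIntegrand n s κ p q δ (θ + stripWidth κ * I)‖
        ≤ C * (1 + |κ|) ^ (s + 1) * (p + δ) ^ (-s) := by
  have hs0 : 0 < s := by rw [hs]; have : (1 : ℝ) ≤ n := by exact_mod_cast hn
                         linarith
  obtain ⟨C, hC, hCb⟩ := exists_norm_coneError_le hn hs
  have hΓ := Real.Gamma_pos_of_pos hs0
  set a := min s 1 with ha
  have ha0 : 0 < a := lt_min hs0 one_pos
  have hΓa := Real.Gamma_pos_of_pos ha0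
  have hi1 : Integrable fun θ : ℝ => Real.exp ((1 - s) * θ) * Real.cosh θ ^ (-(s + 1)) :=
    integrable_exp_mul_cosh_rpow_neg (abs_lt.2 ⟨by linarith, by linarith⟩)
  set I1 : ℝ := ∫ θ : ℝ, Real.exp ((1 - s) * θ) * Real.cosh θ ^ (-(s + 1)) with hI1
  have hpos1 : ∀ θ : ℝ, 0 ≤ Real.exp ((1 - s) * θ) * Real.cosh θ ^ (-(s + 1)) := fun θ => by
    have := Real.cosh_pos θ; positivity
  have hI10 : 0 ≤ I1 := integral_nonneg hpos1
  set K : ℝ := 2 ^ s * Real.exp 2 * Real.Gamma s with hK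
  refine ⟨(K * 2 ^ s + C * (I1 + 4 ^ a * Real.Gamma a + 1 / 4)) * 16 ^ s, by positivity,
    fun κ p q δ hp hδ => ?_⟩
  set α := stripWidth κ with hα
  set X := 1 + |κ| with hX
  have hX1 : 1 ≤ X := by have := abs_nonneg κ; linarith
  have hX0 : 0 < X := by positivity
  have hα0 : 0 < α := stripWidth_pos κ
  have hα1 : α ≤ 1 / 2 := stripWidth_le κ
  set P := p + δ with hP
  set D := |q| + δ with hD
  have hP0 : 0 < P := by positivity
  have hD0 : 0 < D := by positivity
  set k := α / 8 * P with hk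
  have hk0 : 0 < k := by positivity
  have hks : k ^ (-s) = 16 ^ s * X ^ s * P ^ (-s) := by
    have : α / 8 = (16 * X)⁻¹ := by rw [hα, stripWidth, ← hX]; field_simp; norm_num
    rw [hk, Real.mul_rpow (by positivity) hP0.le, this, Real.inv_rpow (by positivity),
      Real.rpow_neg (by positivity), inv_inv, Real.mul_rpow (by norm_num) hX0.le]
  set θ₁ := balancePoint P D with hθ₁
  obtain ⟨h2, h3⟩ := strip_abs_le (κ := κ) hα0.le le_rfl
  have him : ∀ θ ∈ Ici θ₁, δ * Real.cosh θ / 4 ≤ (conePhase p q δ (θ + α * I)).im := fun θ hθ =>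
    conePhase_im_pos_of_balancePoint_le hp hδ hα0.le hα1 hθ
  have him0 : ∀ θ ∈ Ici θ₁, 0 < (conePhase p q δ (θ + α * I)).im := fun θ hθ =>
    lt_of_lt_of_le (by have := Real.cosh_pos θ; positivity) (him θ hθ)
  set u : ℝ → ℂ := fun θ => coneIntegrand n s κ p q δ (θ + α * I) with hu
  have hui : IntegrableOn u (Ioi θ₁) := by
    refine integrableOn_line_of_bound (g := fun θ => 2 ^ s * Real.exp 2 * Real.Gamma s *
      (δ / 4) ^ (-s) * Real.cosh θ ^ (-(2 * s))) measurableSet_Ioi (fun θ hθ => ?_)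
      (fun θ hθ => ?_) ((integrable_cosh_rpow_neg (by positivity)).const_mul _).integrableOn
    · exact differentiableAt_coneIntegrand hn h2 (him0 θ (Ioi_subset_Ici_self hθ))
    · exact norm_coneIntegrand_le_cosh hn hs h2 h3 hδ (him θ (Ioi_subset_Ici_self hθ))
  have hder : ∀ θ ∈ Ici θ₁, HasDerivAt u
      ((4 * κ * I) * u θ - coneError n s κ p q δ (θ + α * I)) θ := fun θ hθ => by
    have := hasDerivAt_coneIntegrand hn (s := s) (κ := κ) hs h2 (him0 θ hθ)
    exact (HasDerivAt.comp_add_const (θ : ℂ) (α * I : ℂ) this).comp_ofReal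
  have hi2 : Integrable fun θ : ℝ => k ^ a * (Real.exp (a * θ) *
      Real.exp (-(k / 4 * Real.exp θ))) :=
    (integrable_exp_mul_exp_neg_exp ha0 (by positivity)).const_mul _
  have hi3 : IntegrableOn (fun θ : ℝ => D / P * Real.exp (-2 * θ)) (Ioi θ₁) :=
    (integrableOn_exp_mul_Ioi (by norm_num) θ₁).const_mul _
  have hg := (((hi1.integrableOn (s := Ioi θ₁)).add (hi2.integrableOn (s := Ioi θ₁))).add hi3
    ).const_mul (C * X * k ^ (-s))
  have hmain := norm_mul_integral_Ioi_le hder hui hui (fun θ hθ =>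
    hCb κ p q δ θ k hp hδ hk (Ioi_subset_Ici_self hθ)) hg
  -- the boundary term
  have hb1 : ‖u θ₁‖ ≤ K * (2 ^ s * k ^ (-s)) := by
    have hkθ : 0 < k * Real.exp θ₁ := by positivity
    refine (norm_coneIntegrand_le hn hs h2 h3 hkθ
      (le_conePhase_im_of_balancePoint_le (κ := κ) hp hδ le_rfl)).trans ?_
    rw [rpow_neg_mul_exp hk0]
    have h4 := cosh_rpow_neg_le' hs0.le θ₁
    have hee : Real.exp (s * θ₁) * Real.exp (-(s * θ₁)) = 1 := by rw [← Real.exp_add]; simp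
    calc _ ≤ K * (2 ^ s * Real.exp (s * θ₁) * (k ^ (-s) * Real.exp (-(s * θ₁)))) := by gcongr
      _ = K * (2 ^ s * k ^ (-s)) * (Real.exp (s * θ₁) * Real.exp (-(s * θ₁))) := by ring
      _ = _ := by rw [hee, mul_one]
  -- the three parts of the error are scale invariant, the last one by the choice of `θ₁`
  have hb2 : ∫ θ in Ioi θ₁, C * X * k ^ (-s) *
      (Real.exp ((1 - s) * θ) * Real.cosh θ ^ (-(s + 1))
        + k ^ a * (Real.exp (a * θ) * Real.exp (-(k / 4 * Real.exp θ)))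
        + D / P * Real.exp (-2 * θ))
      ≤ C * X * k ^ (-s) * (I1 + 4 ^ a * Real.Gamma a + 1 / 4) := by
    rw [integral_const_mul]
    have hi12 : IntegrableOn (fun θ : ℝ => Real.exp ((1 - s) * θ) * Real.cosh θ ^ (-(s + 1))
        + k ^ a * (Real.exp (a * θ) * Real.exp (-(k / 4 * Real.exp θ)))) (Ioi θ₁) :=
      hi1.integrableOn.add hi2.integrableOn
    rw [integral_add hi12 hi3, integral_add hi1.integrableOn hi2.integrableOn]
    gcongr
    · exact setIntegral_le_integral hi1 (Eventually.of_forall hpos1)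
    · refine (setIntegral_le_integral hi2 (Eventually.of_forall fun θ => by positivity)).trans
        (le_of_eq ?_)
      rw [integral_const_mul, integral_exp_mul_exp_neg_exp ha0 (by positivity),
        Real.div_rpow hk0.le (by norm_num), Real.rpow_neg hk0.le,
        Real.rpow_neg (by norm_num : (0 : ℝ) ≤ 4)]
      have : k ^ a ≠ 0 := by positivity
      field_simp
    · rw [integral_const_mul, integral_exp_mul_Ioi (by norm_num), exp_neg_two_mul_balancePoint hP0 hD0]
      apply le_of_eq
      field_simp
      norm_num
  have hfin : ‖(4 * κ * I : ℂ) * ∫ θ in Ioi θ₁, u θ‖ = 4 * ‖(κ : ℂ) * ∫ θ in Ioi θ₁, u θ‖ := by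
    simp only [norm_mul, Complex.norm_I, Complex.norm_ofNat]; ring
  rw [hfin] at hmain
  have hmain2 := hmain.trans (add_le_add hb1 hb2)
  have hn0 := norm_nonneg ((κ : ℂ) * ∫ θ in Ioi θ₁, u θ)
  calc ‖(κ : ℂ) * ∫ θ in Ioi θ₁, u θ‖
      ≤ K * (2 ^ s * k ^ (-s)) * 1 + C * X * k ^ (-s) * (I1 + 4 ^ a * Real.Gamma a + 1 / 4) := by
        linarith
    _ ≤ K * (2 ^ s * k ^ (-s)) * X + C * X * k ^ (-s) * (I1 + 4 ^ a * Real.Gamma a + 1 / 4) := by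
        gcongr
    _ = _ := by
        rw [hks, Real.rpow_add_one hX0.ne']; ring

lemma two_mul_div_rpow_mul {P D s : ℝ} (hP : 0 < P) (hD : 0 < D) :
    D ^ (-s) * Real.exp (2 * s * balancePoint P D) = 2 ^ s * P ^ (-s) := by
  rw [show 2 * s * balancePoint P D = 2 * balancePoint P D * s by ring, Real.exp_mul,
    exp_two_mul_balancePoint hP hD, Real.div_rpow (by positivity) hP.le,
    Real.mul_rpow (by norm_num) hD.le, Real.rpow_neg hD.le, Real.rpow_neg hP.le]
  have : D ^ s ≠ 0 := by positivity
  field_simp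

/-- The contribution of the rapidities before the balance point needs no oscillation. -/
lemma norm_integral_Iic_balancePoint_le {f : ℝ → ℂ} {s P D M : ℝ} (hs : 0 < s) (hP : 0 < P)
    (hD : 0 < D) (h : ∀ θ ∈ Iic (balancePoint P D), ‖f θ‖ ≤ M * (D ^ (-s) * Real.exp (2 * s * θ))) :
    ‖∫ θ in Iic (balancePoint P D), f θ‖ ≤ M * (2 ^ s / (2 * s)) * P ^ (-s) := by
  have h2s : 0 < 2 * s := by positivity
  have hi := ((integrableOn_exp_mul_Iic h2s (balancePoint P D)).const_mul (D ^ (-s))).const_mul M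
  refine (norm_integral_le_of_norm_le hi ((ae_restrict_iff' measurableSet_Iic).2
    (Eventually.of_forall h))).trans (le_of_eq ?_)
  rw [integral_const_mul, integral_const_mul, integral_exp_mul_Iic h2s, ← mul_div_assoc,
    two_mul_div_rpow_mul hP hD]
  ring

lemma integrable_coneIntegrand {n : ℕ} (hn : 1 ≤ n) {s κ p q δ : ℝ} (hs : s = n / 2) (hδ : 0 < δ) :
    Integrable fun θ : ℝ => coneIntegrand n s κ p q δ θ := by
  have hs0 : 0 < s := by rw [hs]; have : (1 : ℝ) ≤ n := by exact_mod_cast hn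
                         linarith
  have him : ∀ θ : ℝ, δ * Real.cosh θ / 4 ≤ (conePhase p q δ (θ + (0 : ℝ) * I)).im := fun θ => by
    simpa using le_conePhase_im (p := p) (q := q) (θ := θ) (τ := 0) hδ.le le_rfl (by norm_num)
  have h := integrableOn_line_of_bound (f := coneIntegrand n s κ p q δ) (s := univ) (y := 0)
    (g := fun θ => 2 ^ s * Real.exp 2 * Real.Gamma s * (δ / 4) ^ (-s) * Real.cosh θ ^ (-(2 * s)))
    MeasurableSet.univ (fun θ _ => differentiableAt_coneIntegrand hn (by norm_num)
      (lt_of_lt_of_le (by have := Real.cosh_pos θ; positivity) (him θ)))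
    (fun θ _ => norm_coneIntegrand_le_cosh hn hs (by norm_num) (by norm_num) hδ (him θ))
    ((integrable_cosh_rpow_neg (by positivity)).const_mul _).integrableOn
  simpa using h

/-- A shift of the whole contour handles the exterior of the light cone. -/
lemma exists_norm_integral_coneIntegrand_le_of_nonpos {n : ℕ} (hn : 1 ≤ n) {s : ℝ}
    (hs : s = n / 2) : ∃ C : ℝ, 0 < C ∧ ∀ κ p q δ : ℝ, 0 < p → 0 < δ → q ≤ 0 →
      ‖(κ : ℂ) * ∫ θ : ℝ, coneIntegrand n s κ p q δ θ‖
        ≤ C * (1 + |κ|) ^ (s + 1) * (p + δ) ^ (-s) := by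
  have hs0 : 0 < s := by rw [hs]; have : (1 : ℝ) ≤ n := by exact_mod_cast hn
                         linarith
  obtain ⟨C, hC, hCb⟩ := exists_norm_integral_coneIntegrand_right_le hn hs
  have hΓ := Real.Gamma_pos_of_pos hs0
  set K : ℝ := 2 ^ s * Real.exp 2 * Real.Gamma s with hK
  refine ⟨K * (2 ^ s * 16 ^ s) * (2 ^ s / (2 * s)) + C, by positivity,
    fun κ p q δ hp hδ hq => ?_⟩
  set α := stripWidth κ with hα
  set X := 1 + |κ| with hX
  have hX1 : 1 ≤ X := by have := abs_nonneg κ; linarith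
  have hX0 : 0 < X := by positivity
  have hα0 : 0 < α := stripWidth_pos κ
  have hα1 : α ≤ 1 / 2 := stripWidth_le κ
  have hP0 : 0 < p + δ := by positivity
  have hD0 : 0 < |q| + δ := by positivity
  set M := 2 ^ s * Real.exp 2 * Real.Gamma s * (δ / 4) ^ (-s) with hM
  have him : ∀ θ τ : ℝ, 0 ≤ τ → τ ≤ α →
      δ * Real.cosh θ / 4 ≤ (conePhase p q δ (θ + τ * I)).im := fun θ τ h0 h1 => by
    refine le_trans ?_ (le_conePhase_im_of_nonpos hq hδ.le h0 (h1.trans hα1))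
    have := half_le_sin h0 (h1.trans hα1)
    have : 0 ≤ Real.sin τ * ((p + δ) * Real.exp θ + (|q| + δ) * Real.exp (-θ)) :=
      mul_nonneg (by linarith) (by positivity)
    linarith
  have him0 : ∀ θ τ : ℝ, 0 ≤ τ → τ ≤ α → 0 < (conePhase p q δ (θ + τ * I)).im :=
    fun θ τ h0 h1 => lt_of_lt_of_le (by have := Real.cosh_pos θ; positivity) (him θ τ h0 h1)
  have h2s : 0 < 2 * s := by positivity
  have hg := (integrable_cosh_rpow_neg h2s).const_mul M
  have hdiff : ∀ z : ℂ, 0 ≤ z.im → z.im ≤ α →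
      DifferentiableAt ℂ (coneIntegrand n s κ p q δ) z := fun z h0 h1 => by
    have := differentiableAt_coneIntegrand hn (s := s) (κ := κ) (strip_abs_le h0 h1).1
      (him0 z.re z.im h0 h1)
    rwa [Complex.re_add_im] at this
  have hbd : ∀ θ τ : ℝ, 0 ≤ τ → τ ≤ α → ‖coneIntegrand n s κ p q δ (θ + τ * I)‖
      ≤ M * Real.cosh θ ^ (-(2 * s)) := fun θ τ h0 h1 =>
    norm_coneIntegrand_le_cosh hn hs (strip_abs_le h0 h1).1 (strip_abs_le h0 h1).2 hδ
      (him θ τ h0 h1)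
  rw [integral_shift hα0.le hdiff hbd hg
    (by simpa using (tendsto_cosh_rpow_neg_atTop h2s).const_mul M)
    (by simpa using (tendsto_cosh_rpow_neg_atBot h2s).const_mul M)]
  have hui : Integrable fun θ : ℝ => coneIntegrand n s κ p q δ (θ + α * I) :=
    integrableOn_univ.1 (integrableOn_line_of_bound MeasurableSet.univ
      (fun θ _ => hdiff _ (by simpa using hα0.le) (by simp)) (fun θ _ => hbd θ α hα0.le le_rfl)
      hg.integrableOn)
  rw [← intervalIntegral.integral_Iic_add_Ioi (b := balancePoint (p + δ) (|q| + δ))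
    hui.integrableOn hui.integrableOn, mul_add]
  refine (norm_add_le _ _).trans ?_
  have hleft : ‖∫ θ in Iic (balancePoint (p + δ) (|q| + δ)),
      coneIntegrand n s κ p q δ (θ + α * I)‖
      ≤ K * (2 ^ s * 16 ^ s * X ^ s) * (2 ^ s / (2 * s)) * (p + δ) ^ (-s) := by
    refine norm_integral_Iic_balancePoint_le hs0 hP0 hD0 fun θ _ => ?_
    obtain ⟨h2, h3⟩ := strip_abs_le (κ := κ) hα0.le le_rfl
    have hk0 : 0 < α / 8 * (|q| + δ) := by positivity
    have hμ : α / 8 * (|q| + δ) * Real.exp (-θ) ≤ (conePhase p q δ (θ + α * I)).im := by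
      refine le_trans ?_ (le_conePhase_im_of_nonpos hq hδ.le hα0.le hα1)
      have h4 := half_le_sin hα0.le hα1
      have h5 : 0 ≤ δ * Real.cosh θ := by have := Real.cosh_pos θ; positivity
      have h6 : 0 ≤ (p + δ) * Real.exp θ := by positivity
      have h7 : 0 ≤ (|q| + δ) * Real.exp (-θ) := by positivity
      have h8 : α / 2 * ((|q| + δ) * Real.exp (-θ))
          ≤ Real.sin α * ((p + δ) * Real.exp θ + (|q| + δ) * Real.exp (-θ)) := by
        gcongr
        · linarith
        · linarith
      nlinarith
    have hks : (α / 8 * (|q| + δ)) ^ (-s) = 16 ^ s * X ^ s * (|q| + δ) ^ (-s) := by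
      have : α / 8 = (16 * X)⁻¹ := by rw [hα, stripWidth, ← hX]; field_simp; norm_num
      rw [Real.mul_rpow (by positivity) hD0.le, this, Real.inv_rpow (by positivity),
        Real.rpow_neg (by positivity), inv_inv, Real.mul_rpow (by norm_num) hX0.le]
    refine (norm_coneIntegrand_le hn hs h2 h3 (by positivity) hμ).trans ?_
    rw [rpow_neg_mul_exp hk0, hks]
    have h4 := cosh_rpow_neg_le' hs0.le θ
    calc _ ≤ K * ((2 ^ s * Real.exp (s * θ)) *
          (16 ^ s * X ^ s * (|q| + δ) ^ (-s) * Real.exp (-(s * -θ)))) := by gcongr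
      _ = K * (2 ^ s * 16 ^ s * X ^ s) * ((|q| + δ) ^ (-s) *
          (Real.exp (s * θ) * Real.exp (-(s * -θ)))) := by ring
      _ = _ := by rw [← Real.exp_add]; congr 4; ring
  have hκX : |κ| ≤ X := by linarith
  have h1 : ‖(κ : ℂ) * ∫ θ in Iic (balancePoint (p + δ) (|q| + δ)),
      coneIntegrand n s κ p q δ (θ + α * I)‖
      ≤ X * (K * (2 ^ s * 16 ^ s * X ^ s) * (2 ^ s / (2 * s)) * (p + δ) ^ (-s)) := by
    rw [norm_mul, Complex.norm_real, Real.norm_eq_abs]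
    gcongr
  refine (add_le_add h1 (hCb κ p q δ hp hδ)).trans (le_of_eq ?_)
  rw [← hX, Real.rpow_add_one hX0.ne']
  ring

/-- Inside the light cone the contour is moved only beyond the balance point. -/
lemma exists_norm_integral_coneIntegrand_le_of_pos {n : ℕ} (hn : 1 ≤ n) {s : ℝ}
    (hs : s = n / 2) : ∃ C : ℝ, 0 < C ∧ ∀ κ p q δ : ℝ, 0 < p → 0 < δ → δ ≤ p → 0 < q →
      ‖(κ : ℂ) * ∫ θ : ℝ, coneIntegrand n s κ p q δ θ‖
        ≤ C * (1 + |κ|) ^ (s + 1) * (p + δ) ^ (-s) := by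
  have hs0 : 0 < s := by rw [hs]; have : (1 : ℝ) ≤ n := by exact_mod_cast hn
                         linarith
  obtain ⟨C, hC, hCb⟩ := exists_norm_integral_coneIntegrand_right_le hn hs
  obtain ⟨C', hC', hCq⟩ := exists_norm_radialG_le_of_quadrant hn hs
  set K : ℝ := 2 ^ s * Real.exp 2 with hK
  refine ⟨K * C' * (2 ^ s * 4 ^ s) * (2 ^ s / (2 * s)) + C + K * C' * (2 ^ s * 16 ^ s),
    by positivity, fun κ p q δ hp hδ hδp hq => ?_⟩
  set α := stripWidth κ with hα
  set X := 1 + |κ| with hX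
  have hX1 : 1 ≤ X := by have := abs_nonneg κ; linarith
  have hX0 : 0 < X := by positivity
  have hα0 : 0 < α := stripWidth_pos κ
  have hα1 : α ≤ 1 / 2 := stripWidth_le κ
  have hP0 : 0 < p + δ := by positivity
  have hD0 : 0 < |q| + δ := by positivity
  set θ₁ := balancePoint (p + δ) (|q| + δ) with hθ₁
  set M := 2 ^ s * Real.exp 2 * Real.Gamma s * (δ / 4) ^ (-s) with hM
  have h2s : 0 < 2 * s := by positivity
  have hg := (integrable_cosh_rpow_neg h2s).const_mul M
  have him : ∀ θ τ : ℝ, θ₁ ≤ θ → 0 ≤ τ → τ ≤ α →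
      δ * Real.cosh θ / 4 ≤ (conePhase p q δ (θ + τ * I)).im := fun θ τ hθ h0 h1 =>
    conePhase_im_pos_of_balancePoint_le hp hδ h0 (h1.trans hα1) hθ
  have him0 : ∀ θ τ : ℝ, θ₁ ≤ θ → 0 ≤ τ → τ ≤ α → 0 < (conePhase p q δ (θ + τ * I)).im :=
    fun θ τ hθ h0 h1 => lt_of_lt_of_le (by have := Real.cosh_pos θ; positivity) (him θ τ hθ h0 h1)
  -- near the real axis the decay comes from the size of the phase, not of its imaginary part
  have hquad : ∀ θ τ m : ℝ, 0 < m → 0 ≤ τ → τ ≤ α → 0 ≤ (conePhase p q δ (θ + τ * I)).re →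
      0 < (conePhase p q δ (θ + τ * I)).im → m ≤ ‖conePhase p q δ (θ + τ * I)‖ →
      ‖coneIntegrand n s κ p q δ (θ + τ * I)‖
        ≤ K * C' * X ^ s * (2 ^ s * Real.exp (s * θ) * m ^ (-s)) := by
    intro θ τ m hm h0 h1 hre hi hnm
    rw [coneIntegrand, norm_mul]
    obtain ⟨h2, h3⟩ := strip_abs_le h0 h1
    have h4 : ‖conePhase p q δ (θ + τ * I)‖ ^ (-s) ≤ m ^ (-s) :=
      Real.rpow_le_rpow_of_nonpos hm hnm (by linarith)
    calc _ ≤ (K * (2 ^ s * Real.exp (s * θ))) * (C' * X ^ s * m ^ (-s)) := by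
          gcongr
          · refine (norm_cosh_cpow_le hs0.le h2 h3).trans ?_
            rw [← hK]
            gcongr
            exact cosh_rpow_neg_le' hs0.le θ
          · refine (hCq κ _ hre hi).trans ?_
            rw [← hX]
            gcongr
      _ = _ := by ring
  have hui := integrable_coneIntegrand hn (κ := κ) (p := p) (q := q) hs hδ
  rw [← intervalIntegral.integral_Iic_add_Ioi (b := θ₁) hui.integrableOn hui.integrableOn,
    integral_Ioi_shift (α := α) (g := fun θ => M * Real.cosh θ ^ (-(2 * s))) hα0.le
      (fun z hz h0 h1 => ?_) (fun θ τ hθ h0 h1 => norm_coneIntegrand_le_cosh hn hs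
        (strip_abs_le h0 h1).1 (strip_abs_le h0 h1).2 hδ (him θ τ hθ h0 h1))
      hg.integrableOn (by simpa using (tendsto_cosh_rpow_neg_atTop h2s).const_mul M)]
  swap
  · have := differentiableAt_coneIntegrand hn (s := s) (κ := κ) (strip_abs_le h0 h1).1
      (him0 z.re z.im hz h0 h1)
    rwa [Complex.re_add_im] at this
  have hleft : ‖∫ θ in Iic θ₁, coneIntegrand n s κ p q δ θ‖
      ≤ K * C' * X ^ s * (2 ^ s * 4 ^ s) * (2 ^ s / (2 * s)) * (p + δ) ^ (-s) := by
    refine norm_integral_Iic_balancePoint_le hs0 hP0 hD0 fun θ _ => ?_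
    have e0 := Real.exp_pos θ
    have e1 := Real.exp_pos (-θ)
    have hre := conePhase_re p q δ θ 0
    have him' := conePhase_im p q δ θ 0
    rw [Real.cos_zero, Real.sin_zero] at hre him'
    have hre2 : q * Real.exp (-θ) / 2 ≤ (conePhase p q δ (θ + (0 : ℝ) * I)).re := by
      rw [hre]; nlinarith [mul_pos hp e0]
    have him2 : δ * Real.exp (-θ) / 2 ≤ (conePhase p q δ (θ + (0 : ℝ) * I)).im := by
      rw [him']; nlinarith [mul_pos hδ e0]
    have hq0 : 0 < q * Real.exp (-θ) / 2 := by positivity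
    have hd0 : 0 < δ * Real.exp (-θ) / 2 := by positivity
    have hnm : (|q| + δ) * Real.exp (-θ) / 4 ≤ ‖conePhase p q δ (θ + (0 : ℝ) * I)‖ := by
      have h4 := (le_abs_self _).trans (Complex.abs_re_le_norm (conePhase p q δ (θ + (0 : ℝ) * I)))
      have h5 := (le_abs_self _).trans (Complex.abs_im_le_norm (conePhase p q δ (θ + (0 : ℝ) * I)))
      rw [abs_of_pos hq]
      nlinarith
    have h6 := hquad θ 0 _ (by positivity) le_rfl hα0.le (hq0.le.trans hre2) (hd0.trans_le him2) hnm
    rw [show (|q| + δ) * Real.exp (-θ) / 4 = (|q| + δ) / 4 * Real.exp (-θ) by ring,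
      rpow_neg_mul_exp (by positivity), Real.div_rpow hD0.le (by norm_num),
      Real.rpow_neg (by norm_num : (0 : ℝ) ≤ 4), div_inv_eq_mul] at h6
    simp only [ofReal_zero, zero_mul, add_zero] at h6
    refine h6.trans (le_of_eq ?_)
    calc _ = K * C' * X ^ s * (2 ^ s * 4 ^ s) * ((|q| + δ) ^ (-s) *
          (Real.exp (s * θ) * Real.exp (-(s * -θ)))) := by ring
      _ = _ := by rw [← Real.exp_add]; congr 4; ring
  have hvert : ‖∫ τ : ℝ in (0 : ℝ)..α, coneIntegrand n s κ p q δ (θ₁ + τ * I)‖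
      ≤ K * C' * X ^ s * (2 ^ s * 16 ^ s * (p + δ) ^ (-s)) * α := by
    refine norm_intervalIntegral_vertical_le hα0.le fun τ h0 h1 => ?_
    have e0 := Real.exp_pos θ₁
    have e1 := Real.exp_pos (-θ₁)
    have hre := conePhase_re p q δ θ₁ τ
    have hτ1 : τ ≤ 1 / 2 := h1.trans hα1
    have hs1 := sin_le_half h0 hτ1
    have hs2 : 0 ≤ Real.sin τ := by linarith [half_le_sin h0 hτ1]
    have hc := half_le_cos (by rwa [abs_of_nonneg h0] : |τ| ≤ 1 / 2)
    -- `δ ≤ p` keeps the phase in the first quadrant along the vertical segment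
    have hre2 : (p + δ) / 16 * Real.exp θ₁ ≤ (conePhase p q δ (θ₁ + τ * I)).re := by
      rw [hre]
      have h4 : 7 / 8 * (p * Real.exp θ₁)
          ≤ Real.cos τ * (p * Real.exp θ₁ + q * Real.exp (-θ₁)) := by
        have : 0 ≤ q * Real.exp (-θ₁) := by positivity
        gcongr
        linarith
      have h5 : δ * Real.sin τ * (Real.exp θ₁ - Real.exp (-θ₁)) ≤ p * (1 / 2) * Real.exp θ₁ := by
        have h6 : δ * Real.sin τ ≤ p * (1 / 2) := by gcongr
        have h7 : 0 ≤ δ * Real.sin τ := by positivity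
        calc _ ≤ δ * Real.sin τ * Real.exp θ₁ := by gcongr; linarith
          _ ≤ _ := by gcongr
      have h8 : δ * Real.exp θ₁ ≤ p * Real.exp θ₁ := by gcongr
      have h9 : 0 < p * Real.exp θ₁ := by positivity
      linarith
    have hpos : 0 < (p + δ) / 16 * Real.exp θ₁ := by positivity
    have h6 := hquad θ₁ τ _ hpos h0 h1 (hpos.le.trans hre2) (him0 θ₁ τ le_rfl h0 h1)
      (hre2.trans ((le_abs_self _).trans (Complex.abs_re_le_norm _)))
    rw [rpow_neg_mul_exp (by positivity), Real.div_rpow hP0.le (by norm_num),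
      Real.rpow_neg (by norm_num : (0 : ℝ) ≤ 16), div_inv_eq_mul] at h6
    refine h6.trans (le_of_eq ?_)
    have hee : Real.exp (s * θ₁) * Real.exp (-(s * θ₁)) = 1 := by rw [← Real.exp_add]; simp
    linear_combination (K * C' * X ^ s * (2 ^ s * 16 ^ s * (p + δ) ^ (-s))) * hee
  have hκX : |κ| ≤ X := by linarith
  have h1 : ‖(κ : ℂ) * ∫ θ in Iic θ₁, coneIntegrand n s κ p q δ θ‖
      ≤ X * (K * C' * X ^ s * (2 ^ s * 4 ^ s) * (2 ^ s / (2 * s)) * (p + δ) ^ (-s)) := by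
    rw [norm_mul, Complex.norm_real, Real.norm_eq_abs]
    gcongr
  have h3 : ‖(κ : ℂ) * (I * ∫ τ : ℝ in (0 : ℝ)..α, coneIntegrand n s κ p q δ (θ₁ + τ * I))‖
      ≤ X * (K * C' * X ^ s * (2 ^ s * 16 ^ s * (p + δ) ^ (-s))) := by
    rw [norm_mul, norm_mul, Complex.norm_I, one_mul, Complex.norm_real, Real.norm_eq_abs]
    have : K * C' * X ^ s * (2 ^ s * 16 ^ s * (p + δ) ^ (-s)) * α
        ≤ K * C' * X ^ s * (2 ^ s * 16 ^ s * (p + δ) ^ (-s)) :=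
      mul_le_of_le_one_right (by positivity) (by linarith)
    gcongr
    exact hvert.trans this
  rw [mul_add, mul_add]
  refine (norm_add_le _ _).trans ((add_le_add h1 ((norm_add_le _ _).trans
    (add_le_add (hCb κ p q δ hp hδ) h3))).trans (le_of_eq ?_))
  rw [← hX, Real.rpow_add_one hX0.ne']
  ring

/-- The bound of the rapidity integral for `n ≥ 1`. -/
lemma exists_norm_integral_coneIntegrand_le {n : ℕ} (hn : 1 ≤ n) {s : ℝ} (hs : s = n / 2) :
    ∃ C : ℝ, 0 < C ∧ ∀ κ p q δ : ℝ, 0 < p → 0 < δ → δ ≤ p →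
      ‖(κ : ℂ) * ∫ θ : ℝ, coneIntegrand n s κ p q δ θ‖
        ≤ C * (1 + |κ|) ^ (s + 1) * p ^ (-s) := by
  have hs0 : 0 ≤ s := by rw [hs]; positivity
  obtain ⟨C, hC, hCb⟩ := exists_norm_integral_coneIntegrand_le_of_nonpos hn hs
  obtain ⟨C', hC', hCb'⟩ := exists_norm_integral_coneIntegrand_le_of_pos hn hs
  refine ⟨C + C', by positivity, fun κ p q δ hp hδ hδp => ?_⟩
  have h0 : (p + δ) ^ (-s) ≤ p ^ (-s) :=
    Real.rpow_le_rpow_of_nonpos hp (by linarith) (by linarith)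
  have h1 := abs_nonneg κ
  rcases le_or_gt q 0 with hq | hq
  · refine (hCb κ p q δ hp hδ hq).trans ?_
    gcongr
    linarith
  · refine (hCb' κ p q δ hp hδ hδp hq).trans ?_
    gcongr
    linarith

end ConeIntegral

/-! ### Space dimension one -/

section OneDimensional

/-- The analogue of `coneIntegrand` in space dimension one, where there are no transversal
variables to integrate over. -/
noncomputable def lineIntegrand (κ p q δ : ℝ) (z : ℂ) : ℂ :=
  Complex.cosh z ^ (-(2 * κ * I)) * cexp (I * conePhase p q δ z)

/-- The difference between `2iκ u` and the derivative of `-u tanh`, for `u = lineIntegrand`. -/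
noncomputable def lineError (κ p q δ : ℝ) (z : ℂ) : ℂ :=
  ((1 + 2 * κ * I) / Complex.cosh z ^ 2
    + I * (conePhase p q δ z - (q + δ * I) * cexp (-z)) * Complex.tanh z) * lineIntegrand κ p q δ z

lemma hasDerivAt_lineIntegrand (κ p q δ : ℝ) {z : ℂ} (hz : Complex.cosh z ∈ slitPlane) :
    HasDerivAt (lineIntegrand κ p q δ) ((-(2 * κ * I) * Complex.tanh z
      + I * (conePhase p q δ z - (q + δ * I) * cexp (-z))) * lineIntegrand κ p q δ z) z := by
  refine ((hasDerivAt_cosh_cpow hz (2 * κ * I)).mul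
    ((hasDerivAt_conePhase p q δ z).const_mul I).cexp).congr_deriv ?_
  rw [lineIntegrand]; ring

/-- As `θ → ±∞` the factor `cosh^{-2iκ}` oscillates like `e^{∓2iκθ}`; multiplying by `tanh` makes up
for the change of sign. -/
lemma hasDerivAt_neg_tanh_mul_lineIntegrand (κ p q δ : ℝ) {z : ℂ}
    (hz : Complex.cosh z ∈ slitPlane) :
    HasDerivAt (fun z => -(Complex.tanh z * lineIntegrand κ p q δ z))
      (2 * κ * I * lineIntegrand κ p q δ z - lineError κ p q δ z) z := by
  have hne := slitPlane_ne_zero hz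
  have h1 : HasDerivAt Complex.tanh (1 / Complex.cosh z ^ 2) z := by
    have h := (Complex.hasDerivAt_sinh z).div (Complex.hasDerivAt_cosh z) hne
    have h2 : Complex.tanh = Complex.sinh / Complex.cosh := by
      ext w; exact Complex.tanh_eq_sinh_div_cosh w
    rw [h2]
    refine h.congr_deriv ?_
    congr 1
    linear_combination Complex.cosh_sq_sub_sinh_sq z
  refine (h1.mul (hasDerivAt_lineIntegrand κ p q δ hz)).neg.congr_deriv ?_
  have h3 : Complex.tanh z * Complex.tanh z = 1 - 1 / Complex.cosh z ^ 2 := by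
    rw [Complex.tanh_eq_sinh_div_cosh]
    field_simp
    linear_combination -Complex.cosh_sq_sub_sinh_sq z
  rw [lineError]
  linear_combination (2 * κ * I * lineIntegrand κ p q δ z) * h3

lemma norm_lineIntegrand_le {κ p q δ θ τ μ : ℝ} (h : |τ| ≤ 1 / 2) (hκ : |κ| * |τ| ≤ 1 / 2)
    (him : μ ≤ (conePhase p q δ (θ + τ * I)).im) :
    ‖lineIntegrand κ p q δ (θ + τ * I)‖ ≤ Real.exp 2 * Real.exp (-μ) := by
  have h1 := norm_cosh_cpow_le (s := 0) (θ := θ) le_rfl h hκ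
  simp only [ofReal_zero, zero_add, Real.rpow_zero, one_mul, neg_zero, mul_one] at h1
  rw [lineIntegrand, norm_mul, Complex.norm_exp]
  gcongr
  simpa using him

lemma exp_neg_le_inv {x : ℝ} (hx : 0 < x) : Real.exp (-x) ≤ x⁻¹ := by
  rw [Real.exp_neg]
  exact inv_anti₀ hx (by linarith [Real.add_one_le_exp x])

lemma norm_lineIntegrand_le_cosh {κ p q δ θ τ : ℝ} (h : |τ| ≤ 1 / 2) (hκ : |κ| * |τ| ≤ 1 / 2)
    (hδ : 0 < δ) (him : δ * Real.cosh θ / 4 ≤ (conePhase p q δ (θ + τ * I)).im) :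
    ‖lineIntegrand κ p q δ (θ + τ * I)‖ ≤ Real.exp 2 * (4 / δ) * Real.cosh θ ^ (-1 : ℝ) := by
  have hc := Real.cosh_pos θ
  refine (norm_lineIntegrand_le h hκ him).trans ?_
  rw [mul_assoc, Real.rpow_neg_one]
  gcongr
  refine (exp_neg_le_inv (by positivity)).trans (le_of_eq ?_)
  field_simp

lemma norm_tanh_le {θ τ : ℝ} (h : |τ| ≤ 1 / 2) : ‖Complex.tanh (θ + τ * I)‖ ≤ 2 := by
  have hne : Complex.cosh (θ + τ * I) ≠ 0 := Complex.slitPlane_ne_zero (cosh_mem_slitPlane h)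
  have h2 := half_cosh_le_norm_cosh (θ := θ) h
  rw [Complex.tanh_eq_sinh_div_cosh, norm_div, div_le_iff₀ (norm_pos_iff.2 hne)]
  have h3 : ‖Complex.sinh (θ + τ * I)‖ ≤ Real.cosh θ := by
    rw [Complex.sinh, norm_div, Complex.norm_ofNat, Real.cosh_eq]
    gcongr
    refine (norm_sub_le _ _).trans (le_of_eq ?_)
    rw [norm_exp_add_mul_I, norm_exp_neg_add_mul_I]
  linarith

/-- A majorant of `lineError` where the phase has a large imaginary part. -/
lemma norm_lineError_le {κ p q δ θ τ k : ℝ} (hp : 0 ≤ p) (hδ : 0 < δ) (h : |τ| ≤ 1 / 2)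
    (hκ : |κ| * |τ| ≤ 1 / 2) (hk : 0 < k)
    (him : k * ((p + δ) * Real.exp θ + (|q| + δ) * Real.exp (-θ))
      ≤ (conePhase p q δ (θ + τ * I)).im) :
    ‖lineError κ p q δ (θ + τ * I)‖ ≤ Real.exp 2 * (8 * (1 + |κ|) * Real.cosh θ ^ (-2 : ℝ)
      + ((p + δ) * (Real.exp (1 * θ) * Real.exp (-(k * (p + δ) * Real.exp θ)))
      + (|q| + δ) * (Real.exp (1 * -θ) * Real.exp (-(k * (|q| + δ) * Real.exp (-θ)))))) := by
  have hc := Real.cosh_pos θ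
  set A := (p + δ) * Real.exp θ with hA
  set B := (|q| + δ) * Real.exp (-θ) with hB
  have hA0 : 0 < A := by positivity
  have hB0 : 0 < B := by positivity
  have hu := norm_lineIntegrand_le h hκ him
  have hne : Complex.cosh (θ + τ * I) ≠ 0 := Complex.slitPlane_ne_zero (cosh_mem_slitPlane h)
  have h2 := half_cosh_le_norm_cosh (θ := θ) h
  have h3 : ‖(1 + 2 * κ * I) / Complex.cosh (θ + τ * I) ^ 2‖
      ≤ 8 * (1 + |κ|) * Real.cosh θ ^ (-2 : ℝ) := by
    rw [norm_div, norm_pow, Real.rpow_neg hc.le, Real.rpow_two, ← div_eq_mul_inv]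
    have h4 : ‖(1 + 2 * κ * I : ℂ)‖ ≤ 2 * (1 + |κ|) := by
      refine (norm_add_le _ _).trans ?_
      rw [norm_mul, norm_mul, Complex.norm_I, Complex.norm_real, Real.norm_eq_abs,
        Complex.norm_ofNat, norm_one]
      linarith
    rw [div_le_div_iff₀ (by positivity) (by positivity)]
    have h5 : Real.cosh θ ^ 2 ≤ 4 * ‖Complex.cosh (θ + τ * I)‖ ^ 2 := by nlinarith
    calc _ ≤ 2 * (1 + |κ|) * (4 * ‖Complex.cosh (θ + τ * I)‖ ^ 2) := by gcongr
      _ = _ := by ring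
  have h4 : ‖conePhase p q δ (θ + τ * I) - (q + δ * I) * cexp (-(θ + τ * I))‖ ≤ (A + B) / 2 := by
    have e1 : conePhase p q δ (θ + τ * I) - (q + δ * I) * cexp (-(θ + τ * I))
        = ((p + δ * I) * cexp (θ + τ * I) - (q + δ * I) * cexp (-(θ + τ * I))) / 2 := by
      rw [conePhase]; ring
    rw [e1, norm_div, Complex.norm_ofNat]
    gcongr
    refine (norm_sub_le _ _).trans ?_
    rw [norm_mul, norm_mul, norm_exp_add_mul_I, norm_exp_neg_add_mul_I]
    have h5 := norm_real_add_mul_I_le p δ hδ.le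
    rw [abs_of_nonneg hp] at h5
    exact add_le_add (mul_le_mul_of_nonneg_right h5 (Real.exp_pos _).le)
      (mul_le_mul_of_nonneg_right (norm_real_add_mul_I_le q δ hδ.le) (Real.exp_pos _).le)
  have e1 : Real.exp (-(k * (A + B))) ≤ 1 := Real.exp_le_one_iff.2 (by
    have : 0 < k * (A + B) := by positivity
    linarith)
  have e2 : Real.exp (-(k * (A + B))) ≤ Real.exp (-(k * (p + δ) * Real.exp θ)) := by
    refine Real.exp_le_exp.2 ?_
    have : 0 < k * B := by positivity
    rw [mul_assoc, ← hA]; linarith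
  have e3 : Real.exp (-(k * (A + B))) ≤ Real.exp (-(k * (|q| + δ) * Real.exp (-θ))) := by
    refine Real.exp_le_exp.2 ?_
    have : 0 < k * A := by positivity
    rw [mul_assoc k, ← hB]; linarith
  have hX : 0 < 1 + |κ| := by positivity
  rw [lineError, norm_mul]
  have h6 : ‖(1 + 2 * κ * I) / Complex.cosh (θ + τ * I) ^ 2
      + I * (conePhase p q δ (θ + τ * I) - (q + δ * I) * cexp (-(θ + τ * I)))
        * Complex.tanh (θ + τ * I)‖ ≤ 8 * (1 + |κ|) * Real.cosh θ ^ (-2 : ℝ) + (A + B) := by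
    refine (norm_add_le _ _).trans (add_le_add h3 ?_)
    rw [norm_mul, norm_mul, Complex.norm_I, one_mul]
    calc _ ≤ (A + B) / 2 * 2 := by
          gcongr
          exact norm_tanh_le h
      _ = A + B := by ring
  calc _ ≤ (8 * (1 + |κ|) * Real.cosh θ ^ (-2 : ℝ) + (A + B)) *
        (Real.exp 2 * Real.exp (-(k * (A + B)))) := by gcongr
    _ = Real.exp 2 * (8 * (1 + |κ|) * Real.cosh θ ^ (-2 : ℝ) * Real.exp (-(k * (A + B)))
        + (A * Real.exp (-(k * (A + B))) + B * Real.exp (-(k * (A + B))))) := by ring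
    _ ≤ Real.exp 2 * (8 * (1 + |κ|) * Real.cosh θ ^ (-2 : ℝ) * 1
        + (A * Real.exp (-(k * (p + δ) * Real.exp θ))
          + B * Real.exp (-(k * (|q| + δ) * Real.exp (-θ))))) := by gcongr
    _ = _ := by rw [one_mul, one_mul, hA, hB]; ring

/-- The integral over a half-line on which the contour can be moved into the region of decay. -/
lemma exists_norm_integral_lineIntegrand_Ioi_le : ∃ C : ℝ, 0 < C ∧ ∀ κ p q δ a : ℝ, 0 ≤ p → 0 < δ →
    (∀ θ τ : ℝ, a ≤ θ → 0 ≤ τ → τ ≤ stripWidth κ →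
      δ * Real.cosh θ / 4 ≤ (conePhase p q δ (θ + τ * I)).im) →
    (∀ θ : ℝ, a ≤ θ → stripWidth κ / 16 * ((p + δ) * Real.exp θ + (|q| + δ) * Real.exp (-θ))
      ≤ (conePhase p q δ (θ + stripWidth κ * I)).im) →
    ‖(κ : ℂ) * ∫ θ in Ioi a, lineIntegrand κ p q δ θ‖ ≤ C * (1 + |κ|) := by
  set Q : ℝ := ∫ θ : ℝ, Real.cosh θ ^ (-2 : ℝ) with hQ
  have hQi : Integrable fun θ : ℝ => Real.cosh θ ^ (-2 : ℝ) := integrable_cosh_rpow_neg two_pos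
  have hQ0 : 0 ≤ Q := integral_nonneg fun θ => by have := Real.cosh_pos θ; positivity
  refine ⟨Real.exp 2 * (2 + (8 * Q + 64)), by positivity, fun κ p q δ a hp hδ h1 h2 => ?_⟩
  set α := stripWidth κ with hα
  set X := 1 + |κ| with hX
  have hκ0 := abs_nonneg κ
  have hX1 : 1 ≤ X := by linarith
  have hX0 : 0 < X := by positivity
  have hα0 : 0 < α := stripWidth_pos κ
  have hα1 : α ≤ 1 / 2 := stripWidth_le κ
  set k := α / 16 with hk
  have hk0 : 0 < k := by positivity
  have hkX : k⁻¹ = 32 * X := by rw [hk, hα, stripWidth, ← hX]; field_simp; norm_num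
  have hP0 : 0 < p + δ := by positivity
  have hD0 : 0 < |q| + δ := by positivity
  obtain ⟨hα2, hα3⟩ := strip_abs_le (κ := κ) hα0.le le_rfl
  have hg := (integrable_cosh_rpow_neg one_pos).const_mul (Real.exp 2 * (4 / δ))
  have hbd : ∀ θ τ : ℝ, a ≤ θ → 0 ≤ τ → τ ≤ α → ‖lineIntegrand κ p q δ (θ + τ * I)‖
      ≤ Real.exp 2 * (4 / δ) * Real.cosh θ ^ (-1 : ℝ) := fun θ τ hθ h3 h4 =>
    norm_lineIntegrand_le_cosh (strip_abs_le h3 h4).1 (strip_abs_le h3 h4).2 hδ (h1 θ τ hθ h3 h4)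
  have hdiff : ∀ z : ℂ, a ≤ z.re → 0 ≤ z.im → z.im ≤ α →
      DifferentiableAt ℂ (lineIntegrand κ p q δ) z := fun z _ h3 h4 => by
    have := hasDerivAt_lineIntegrand κ p q δ
      (cosh_mem_slitPlane (θ := z.re) (strip_abs_le h3 h4).1)
    rw [Complex.re_add_im] at this
    exact this.differentiableAt
  rw [integral_Ioi_shift hα0.le hdiff hbd hg.integrableOn
    (by simpa using (tendsto_cosh_rpow_neg_atTop one_pos).const_mul (Real.exp 2 * (4 / δ))), mul_add]
  set u : ℝ → ℂ := fun θ => lineIntegrand κ p q δ (θ + α * I) with hu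
  have hui : IntegrableOn u (Ioi a) := integrableOn_line_of_bound measurableSet_Ioi
    (fun θ hθ => hdiff _ (by simpa using le_of_lt hθ) (by simpa using hα0.le) (by simp))
    (fun θ hθ => hbd θ α (le_of_lt hθ) hα0.le le_rfl) hg.integrableOn
  set v : ℝ → ℂ := fun θ => -(Complex.tanh (θ + α * I) * u θ) with hv
  have hder : ∀ θ ∈ Ici a, HasDerivAt v ((2 * κ * I) * u θ - lineError κ p q δ (θ + α * I)) θ :=
    fun θ _ => by
      have := hasDerivAt_neg_tanh_mul_lineIntegrand κ p q δ (cosh_mem_slitPlane (θ := θ) hα2)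
      exact (HasDerivAt.comp_add_const (θ : ℂ) (α * I : ℂ) this).comp_ofReal
  have hvi : IntegrableOn v (Ioi a) := by
    refine Integrable.mono' (hui.norm.const_mul 2) ?_ (Eventually.of_forall fun θ => ?_)
    · exact ContinuousOn.aestronglyMeasurable (fun θ hθ =>
        (hder θ (Ioi_subset_Ici_self hθ)).continuousAt.continuousWithinAt) measurableSet_Ioi
    · rw [hv, norm_neg, norm_mul]
      gcongr
      exact norm_tanh_le hα2
  have hi1 := integrable_exp_mul_exp_neg_exp one_pos (mul_pos hk0 hP0)
  have hi2 := (integrable_exp_mul_exp_neg_exp one_pos (mul_pos hk0 hD0)).comp_neg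
  have hiC : Integrable fun θ : ℝ =>
    (p + δ) * (Real.exp (1 * θ) * Real.exp (-(k * (p + δ) * Real.exp θ))) := hi1.const_mul _
  have hiD : Integrable fun θ : ℝ => (|q| + δ) * (Real.exp (1 * -θ) *
    Real.exp (-(k * (|q| + δ) * Real.exp (-θ)))) := hi2.const_mul _
  have hiA : Integrable fun θ : ℝ => 8 * X * Real.cosh θ ^ (-2 : ℝ) := hQi.const_mul _
  have hiB : Integrable fun θ : ℝ =>
    (p + δ) * (Real.exp (1 * θ) * Real.exp (-(k * (p + δ) * Real.exp θ)))
    + (|q| + δ) * (Real.exp (1 * -θ) * Real.exp (-(k * (|q| + δ) * Real.exp (-θ)))) := hiC.add hiD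
  have hi3 : Integrable fun θ : ℝ => 8 * X * Real.cosh θ ^ (-2 : ℝ)
    + ((p + δ) * (Real.exp (1 * θ) * Real.exp (-(k * (p + δ) * Real.exp θ)))
    + (|q| + δ) * (Real.exp (1 * -θ) * Real.exp (-(k * (|q| + δ) * Real.exp (-θ))))) := hiA.add hiB
  have hi := hi3.const_mul (Real.exp 2)
  have hmain := norm_mul_integral_Ioi_le hder hui hvi (fun θ hθ =>
    norm_lineError_le hp hδ hα2 hα3 hk0 (h2 θ (le_of_lt hθ))) hi.integrableOn
  have hb1 : ‖v a‖ ≤ 2 * Real.exp 2 := by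
    have h3 := norm_lineIntegrand_le (μ := 0) hα2 hα3
      ((by have := Real.cosh_pos a; positivity : 0 ≤ δ * Real.cosh a / 4).trans
        (h1 a α le_rfl hα0.le le_rfl))
    rw [neg_zero, Real.exp_zero, mul_one] at h3
    rw [hv, norm_neg, norm_mul]
    gcongr
    exact norm_tanh_le hα2
  have hb2 : ∫ θ in Ioi a, Real.exp 2 * (8 * X * Real.cosh θ ^ (-2 : ℝ)
      + ((p + δ) * (Real.exp (1 * θ) * Real.exp (-(k * (p + δ) * Real.exp θ)))
      + (|q| + δ) * (Real.exp (1 * -θ) * Real.exp (-(k * (|q| + δ) * Real.exp (-θ))))))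
      ≤ Real.exp 2 * (8 * X * Q + 64 * X) := by
    refine (setIntegral_le_integral hi (Eventually.of_forall fun θ => ?_)).trans (le_of_eq ?_)
    · have := Real.cosh_pos θ
      simp only [Pi.zero_apply]
      positivity
    · have e1 : ∫ θ : ℝ, Real.exp (1 * -θ) * Real.exp (-(k * (|q| + δ) * Real.exp (-θ)))
          = (k * (|q| + δ))⁻¹ := by
        rw [integral_neg_eq_self (fun θ : ℝ => Real.exp (1 * θ) *
          Real.exp (-(k * (|q| + δ) * Real.exp θ))), integral_exp_mul_exp_neg_exp one_pos
          (by positivity), Real.Gamma_one, mul_one, Real.rpow_neg_one]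
      have e2 : ∫ θ : ℝ, Real.exp (1 * θ) * Real.exp (-(k * (p + δ) * Real.exp θ))
          = (k * (p + δ))⁻¹ := by
        rw [integral_exp_mul_exp_neg_exp one_pos
          (by positivity), Real.Gamma_one, mul_one, Real.rpow_neg_one]
      rw [integral_const_mul, integral_add hiA hiB, integral_add hiC hiD, integral_const_mul,
        integral_const_mul, integral_const_mul, e1, e2, mul_inv, mul_inv, hkX]
      field_simp
      ring
  have hvert := norm_intervalIntegral_vertical_le (f := lineIntegrand κ p q δ) (a := a)
    (M := Real.exp 2) hα0.le (fun τ h3 h4 => by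
      have h5 := norm_lineIntegrand_le (μ := 0) (strip_abs_le h3 h4).1 (strip_abs_le h3 h4).2
        ((by have := Real.cosh_pos a; positivity : 0 ≤ δ * Real.cosh a / 4).trans
          (h1 a τ le_rfl h3 h4))
      rwa [neg_zero, Real.exp_zero, mul_one] at h5)
  have hfin : ‖(2 * κ * I : ℂ) * ∫ θ in Ioi a, u θ‖ = 2 * ‖(κ : ℂ) * ∫ θ in Ioi a, u θ‖ := by
    simp only [norm_mul, Complex.norm_I, Complex.norm_ofNat]; ring
  rw [hfin] at hmain
  have hmain2 := hmain.trans (add_le_add hb1 hb2)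
  have hn0 := norm_nonneg ((κ : ℂ) * ∫ θ in Ioi a, u θ)
  have h5 : ‖(κ : ℂ) * (I * ∫ τ : ℝ in (0 : ℝ)..α, lineIntegrand κ p q δ (a + τ * I))‖
      ≤ Real.exp 2 := by
    rw [norm_mul, norm_mul, Complex.norm_I, one_mul, Complex.norm_real, Real.norm_eq_abs]
    calc _ ≤ |κ| * (Real.exp 2 * α) := by gcongr
      _ = Real.exp 2 * (|κ| * α) := by ring
      _ ≤ Real.exp 2 * 1 := by
        gcongr
        exact (abs_mul_stripWidth_le κ).trans (by norm_num)
      _ = _ := mul_one _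
  refine (norm_add_le _ _).trans ?_
  have hE := Real.exp_pos 2
  have h6 : 0 ≤ Real.exp 2 * (8 * X * Q + 64 * X) := by positivity
  calc _ ≤ 2 * Real.exp 2 * 1 + Real.exp 2 * (8 * X * Q + 64 * X) := by linarith
    _ ≤ 2 * Real.exp 2 * X + Real.exp 2 * (8 * X * Q + 64 * X) := by gcongr
    _ = _ := by ring

lemma conePhase_neg (p q δ : ℝ) (z : ℂ) : conePhase p q δ (-z) = conePhase q p δ z := by
  rw [conePhase, conePhase, neg_neg, add_comm]

lemma lineIntegrand_neg (κ p q δ : ℝ) (z : ℂ) :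
    lineIntegrand κ p q δ (-z) = lineIntegrand κ q p δ z := by
  rw [lineIntegrand, lineIntegrand, conePhase_neg, Complex.cosh_neg]

lemma norm_lineIntegrand_ofReal_le (κ p q : ℝ) {δ : ℝ} (hδ : 0 < δ) (θ : ℝ) :
    ‖lineIntegrand κ p q δ θ‖ ≤ Real.exp 2 * (4 / δ) * Real.cosh θ ^ (-1 : ℝ) ∧
    ‖lineIntegrand κ p q δ θ‖ ≤ Real.exp 2 := by
  have him : δ * Real.cosh θ / 4 ≤ (conePhase p q δ (θ + (0 : ℝ) * I)).im := by
    simpa using le_conePhase_im (p := p) (q := q) (θ := θ) (τ := 0) hδ.le le_rfl (by norm_num)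
  have h1 := norm_lineIntegrand_le_cosh (κ := κ) (by norm_num) (by norm_num) hδ him
  have h2 := norm_lineIntegrand_le (κ := κ) (μ := 0) (by norm_num) (by norm_num)
    ((by have := Real.cosh_pos θ; positivity : 0 ≤ δ * Real.cosh θ / 4).trans him)
  simp only [ofReal_zero, zero_mul, add_zero, neg_zero, Real.exp_zero, mul_one] at h1 h2
  exact ⟨h1, h2⟩

lemma integrable_lineIntegrand (κ p q : ℝ) {δ : ℝ} (hδ : 0 < δ) :
    Integrable fun θ : ℝ => lineIntegrand κ p q δ θ := by
  have h := integrableOn_line_of_bound (f := lineIntegrand κ p q δ) (s := univ) (y := 0)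
    MeasurableSet.univ
    (fun θ _ => (hasDerivAt_lineIntegrand κ p q δ
      (cosh_mem_slitPlane (θ := θ) (by norm_num))).differentiableAt)
    (fun θ _ => by simpa using (norm_lineIntegrand_ofReal_le κ p q hδ θ).1)
    ((integrable_cosh_rpow_neg one_pos).const_mul _).integrableOn
  simpa using h

/-- The bound of the rapidity integral in space dimension one. -/
lemma exists_norm_integral_lineIntegrand_le : ∃ C : ℝ, 0 < C ∧ ∀ κ p q δ : ℝ, 0 ≤ p → 0 < δ →
    (q ≤ 0 ∨ 0 < p) → ‖(κ : ℂ) * ∫ θ : ℝ, lineIntegrand κ p q δ θ‖ ≤ C * (1 + |κ|) := by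
  obtain ⟨C, hC, hCb⟩ := exists_norm_integral_lineIntegrand_Ioi_le
  refine ⟨2 * C + Real.exp 2, by positivity, fun κ p q δ hp hδ hpq => ?_⟩
  have hκ0 := abs_nonneg κ
  have hα0 := stripWidth_pos κ
  have hα1 := stripWidth_le κ
  have hui := integrable_lineIntegrand κ p q hδ
  have hE := Real.exp_pos 2
  rcases le_or_gt q 0 with hq | hq
  -- outside the light cone every half-line can be shifted; let its end point tend to `-∞`
  · have hlim : Tendsto (fun a : ℝ => ∫ θ in Ioi a, lineIntegrand κ p q δ θ) atBot
        (𝓝 (∫ θ : ℝ, lineIntegrand κ p q δ θ)) :=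
      (aecover_Ioi tendsto_id).integral_tendsto_of_countably_generated hui
    refine le_of_tendsto (hlim.const_mul (κ : ℂ)).norm (Eventually.of_forall fun a => ?_)
    refine (hCb κ p q δ a hp hδ (fun θ τ _ h0 h1 => ?_) (fun θ _ => ?_)).trans ?_
    · refine le_trans ?_ (le_conePhase_im_of_nonpos hq hδ.le h0 (h1.trans hα1))
      have := half_le_sin h0 (h1.trans hα1)
      have : 0 ≤ Real.sin τ * ((p + δ) * Real.exp θ + (|q| + δ) * Real.exp (-θ)) :=
        mul_nonneg (by linarith) (by positivity)
      linarith
    · refine le_trans ?_ (le_conePhase_im_of_nonpos hq hδ.le hα0.le hα1)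
      have h4 := half_le_sin hα0.le hα1
      have h5 : 0 ≤ δ * Real.cosh θ := by have := Real.cosh_pos θ; positivity
      have h6 : 0 ≤ (p + δ) * Real.exp θ + (|q| + δ) * Real.exp (-θ) := by positivity
      nlinarith [mul_le_mul_of_nonneg_right h4 h6, mul_nonneg hα0.le h6]
    · gcongr; linarith
  -- inside the light cone both ends are shifted, after a reflection exchanging `p` and `q` for the
  -- left one, and what is left in between has length `log 2`
  · have hp0 : 0 < p := hpq.resolve_left (not_le.2 hq)
    have hP0 : 0 < p + δ := by positivity
    have hD0 : 0 < q + δ := by positivity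
    have hright : ∀ p q : ℝ, 0 < p → 0 < q →
        ‖(κ : ℂ) * ∫ θ in Ioi (balancePoint (p + δ) (q + δ)), lineIntegrand κ p q δ θ‖
          ≤ C * (1 + |κ|) := fun p q hp hq => by
      have hbal : balancePoint (p + δ) (q + δ) = balancePoint (p + δ) (|q| + δ) := by
        rw [abs_of_pos hq]
      refine hCb κ p q δ _ hp.le hδ (fun θ τ hθ h0 h1 =>
        conePhase_im_pos_of_balancePoint_le hp hδ h0 (h1.trans hα1) (hbal ▸ hθ)) (fun θ hθ => ?_)
      rw [hbal] at hθ
      refine le_trans ?_ (le_conePhase_im_of_balancePoint_le hp hδ hθ)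
      have h4 := two_mul_le_of_balancePoint_le (P := p + δ) (D := |q| + δ) (by positivity)
        (by positivity) hθ
      have h5 : 0 < (|q| + δ) * Real.exp (-θ) := by positivity
      nlinarith [mul_le_mul_of_nonneg_left h4 hα0.le, mul_pos hα0 h5]
    set θ₁ := balancePoint (p + δ) (q + δ) with hθ₁
    set θ₂ := balancePoint (q + δ) (p + δ) with hθ₂
    have hsum : θ₁ + θ₂ = Real.log 2 := by
      rw [hθ₁, hθ₂, balancePoint, balancePoint, ← add_div, ← Real.log_mul (by positivity)
        (by positivity)]
      have : 2 * (q + δ) / (p + δ) * (2 * (p + δ) / (q + δ)) = 2 ^ 2 := by field_simp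
      rw [this, Real.log_pow]; push_cast; ring
    have hlog0 : 0 < Real.log 2 := Real.log_pos one_lt_two
    have hlog1 : Real.log 2 ≤ 1 := by linarith [Real.log_two_lt_d9]
    have hle : -θ₂ ≤ θ₁ := by linarith
    have hleft : ∫ θ in Iic (-θ₂), lineIntegrand κ p q δ θ
        = ∫ θ in Ioi θ₂, lineIntegrand κ q p δ θ := by
      rw [← integral_comp_neg_Ioi]
      congr 1
      ext θ
      rw [ofReal_neg, lineIntegrand_neg]
    have hmid : ‖∫ θ : ℝ in (-θ₂)..θ₁, lineIntegrand κ p q δ θ‖ ≤ Real.exp 2 := by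
      refine (intervalIntegral.norm_integral_le_of_norm_le_const fun θ _ =>
        (norm_lineIntegrand_ofReal_le κ p q hδ θ).2).trans ?_
      rw [abs_of_nonneg (by linarith), show θ₁ - -θ₂ = Real.log 2 by linarith]
      exact mul_le_of_le_one_right hE.le hlog1
    have hsplit : ∫ θ : ℝ, lineIntegrand κ p q δ θ = (∫ θ in Iic (-θ₂), lineIntegrand κ p q δ θ)
        + (∫ θ : ℝ in (-θ₂)..θ₁, lineIntegrand κ p q δ θ)
        + ∫ θ in Ioi θ₁, lineIntegrand κ p q δ θ := by
      rw [← intervalIntegral.integral_Iic_sub_Iic hui.integrableOn hui.integrableOn,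
        add_sub_cancel, intervalIntegral.integral_Iic_add_Ioi hui.integrableOn hui.integrableOn]
    rw [hsplit, hleft, mul_add, mul_add]
    have h3 : ‖(κ : ℂ) * ∫ θ : ℝ in (-θ₂)..θ₁, lineIntegrand κ p q δ θ‖ ≤ |κ| * Real.exp 2 := by
      rw [norm_mul, Complex.norm_real, Real.norm_eq_abs]
      gcongr
    refine (norm_add₃_le).trans ((add_le_add_three (hright q p hq hp0) h3
      (hright p q hp0 hq)).trans ?_)
    nlinarith

end OneDimensional

/-! ### Slicing along the direction of `x` -/

section Slicing

/-- A rotation adapted to `x`: the first factor is the direction of `x`. -/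
lemma exists_linearIsometryEquiv_prod {n : ℕ} (x : EuclideanSpace ℝ (Fin (n + 1))) :
    ∃ Φ : WithLp 2 (ℝ × EuclideanSpace ℝ (Fin n)) ≃ₗᵢ[ℝ] EuclideanSpace ℝ (Fin (n + 1)),
      ∀ w, inner ℝ x (Φ w) = ‖x‖ * w.fst := by
  have hfr : Module.finrank ℝ (WithLp 2 (ℝ × EuclideanSpace ℝ (Fin n))) = n + 1 := by
    rw [(WithLp.linearEquiv 2 ℝ (ℝ × EuclideanSpace ℝ (Fin n))).finrank_eq, Module.finrank_prod]
    simp [add_comm]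
  let L : WithLp 2 (ℝ × EuclideanSpace ℝ (Fin n)) ≃ₗᵢ[ℝ] EuclideanSpace ℝ (Fin (n + 1)) :=
    ((stdOrthonormalBasis ℝ _).reindex (finCongr hfr)).repr
  set e : WithLp 2 (ℝ × EuclideanSpace ℝ (Fin n)) := WithLp.toLp 2 (‖x‖, 0) with he
  have hne : ‖L.symm x‖ = ‖e‖ := by
    rw [LinearIsometryEquiv.norm_map, he, WithLp.prod_norm_eq_of_L2]
    simp
  let R := (ℝ ∙ (L.symm x - e))ᗮ.reflection
  have hR : R (L.symm x) = e := Submodule.reflection_sub hne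
  refine ⟨R.symm.trans L, fun w => ?_⟩
  have h1 : inner ℝ x ((R.symm.trans L) w) = inner ℝ e w := by
    rw [← hR, ← LinearIsometryEquiv.inner_map_map L.symm x, LinearIsometryEquiv.trans_apply,
      LinearIsometryEquiv.symm_apply_apply, ← LinearIsometryEquiv.inner_map_map R (L.symm x),
      LinearIsometryEquiv.apply_symm_apply]
  rw [h1, he, WithLp.prod_inner_apply]
  simp [mul_comm]

/-- The Fourier integral of a radial function, sliced along the direction of `x`. -/
lemma integral_radial_eq_integral_prod {n : ℕ} (x : EuclideanSpace ℝ (Fin (n + 1))) {f : ℝ → ℂ}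
    (hf : Integrable fun ξ : EuclideanSpace ℝ (Fin (n + 1)) => f ‖ξ‖) :
    oscIntegral (fun ξ => f ‖ξ‖) x
      = ∫ η : EuclideanSpace ℝ (Fin n), ∫ a : ℝ,
          cexp (I * ((‖x‖ * a : ℝ) : ℂ)) * f (√(a ^ 2 + ‖η‖ ^ 2)) := by
  obtain ⟨Φ, hΦ⟩ := exists_linearIsometryEquiv_prod x
  have hmp : MeasurePreserving (fun w : ℝ × EuclideanSpace ℝ (Fin n) => Φ (WithLp.toLp 2 w)) :=
    Φ.measurePreserving.comp (WithLp.volume_preserving_toLp ℝ (EuclideanSpace ℝ (Fin n)))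
  have hemb : MeasurableEmbedding
      (fun w : ℝ × EuclideanSpace ℝ (Fin n) => Φ (WithLp.toLp 2 w)) :=
    Φ.toMeasurableEquiv.measurableEmbedding.comp
      (MeasurableEquiv.toLp 2 (ℝ × EuclideanSpace ℝ (Fin n))).measurableEmbedding
  have hint : Integrable fun ξ : EuclideanSpace ℝ (Fin (n + 1)) =>
      cexp (I * (inner ℝ x ξ : ℝ)) * f ‖ξ‖ := by
    refine hf.bdd_mul (c := 1) ?_ (Eventually.of_forall fun ξ => ?_)
    · exact Continuous.aestronglyMeasurable (by fun_prop)
    · exact (norm_cexp_I_mul_ofReal _).le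
  have hcomp : ∀ w : ℝ × EuclideanSpace ℝ (Fin n),
      cexp (I * (inner ℝ x (Φ (WithLp.toLp 2 w)) : ℝ)) * f ‖Φ (WithLp.toLp 2 w)‖
        = cexp (I * ((‖x‖ * w.1 : ℝ) : ℂ)) * f (√(w.1 ^ 2 + ‖w.2‖ ^ 2)) := fun w => by
    rw [hΦ, LinearIsometryEquiv.norm_map, WithLp.prod_norm_eq_of_L2]
    simp
  have hint2 := (hmp.integrable_comp_emb hemb).2 hint
  simp only [Function.comp_def, hcomp] at hint2
  rw [oscIntegral, ← hmp.integral_comp hemb]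
  simp only [hcomp]
  exact integral_prod_symm _ hint2

lemma integral_comp_mul_sinh {c : ℝ} (hc : 0 < c) (g : ℝ → ℂ) :
    ∫ a : ℝ, g a = ∫ θ : ℝ, ((c * Real.cosh θ : ℝ) : ℂ) * g (c * Real.sinh θ) := by
  have h := integral_image_eq_integral_abs_deriv_smul (s := univ)
    (f := fun θ => c * Real.sinh θ) (f' := fun θ => c * Real.cosh θ) MeasurableSet.univ
    (fun θ _ => ((Real.hasDerivAt_sinh θ).const_mul c).hasDerivWithinAt)
    (fun θ _ θ' _ h => Real.sinh_injective (mul_left_cancel₀ hc.ne' h)) g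
  have hr : (fun θ => c * Real.sinh θ) '' univ = univ := by
    rw [image_univ, range_eq_univ]
    intro y
    obtain ⟨θ, hθ⟩ := Real.sinh_surjective (y / c)
    exact ⟨θ, by simp only [hθ]; field_simp⟩
  rw [hr, setIntegral_univ, setIntegral_univ] at h
  rw [h]
  congr 1
  ext θ
  rw [abs_of_pos (mul_pos hc (Real.cosh_pos θ)), Complex.real_smul]

lemma one_le_japaneseBracket {d : ℕ} (ξ : EuclideanSpace ℝ (Fin d)) : 1 ≤ japaneseBracket ξ :=
  Real.le_sqrt_of_sq_le (by nlinarith [sq_nonneg ‖ξ‖])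

lemma norm_le_japaneseBracket {d : ℕ} (ξ : EuclideanSpace ℝ (Fin d)) : ‖ξ‖ ≤ japaneseBracket ξ :=
  Real.le_sqrt_of_sq_le (by linarith)

lemma continuous_japaneseBracket {d : ℕ} :
    Continuous (japaneseBracket : EuclideanSpace ℝ (Fin d) → ℝ) := by
  unfold japaneseBracket; fun_prop

lemma integrable_exp_neg_mul_japaneseBracket {d : ℕ} {c : ℝ} (hc : 0 < c) :
    Integrable fun ξ : EuclideanSpace ℝ (Fin d) => Real.exp (-(c * japaneseBracket ξ)) := by
  obtain ⟨C, hC, h⟩ := exists_rpow_le_mul_exp_of_pos (γ := (d : ℝ) + 1) (by positivity)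
  have hi := (integrable_one_add_norm (E := EuclideanSpace ℝ (Fin d)) (μ := volume)
    (r := (d : ℝ) + 1) (by simp)).const_mul (C * Real.exp c * c ^ (-((d : ℝ) + 1)))
  refine hi.mono' ?_ (Eventually.of_forall fun ξ => ?_)
  · exact Continuous.aestronglyMeasurable (by have := continuous_japaneseBracket (d := d); fun_prop)
  · have h0 : 0 < 1 + ‖ξ‖ := by positivity
    have h1 := h (c * (1 + ‖ξ‖)) (by positivity)
    rw [Real.mul_rpow hc.le h0.le] at h1
    have h2 : Real.exp (-(c * japaneseBracket ξ)) ≤ Real.exp (-(c * ‖ξ‖)) := by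
      have := norm_le_japaneseBracket ξ
      exact Real.exp_le_exp.2 (by nlinarith)
    rw [Real.norm_of_nonneg (Real.exp_pos _).le]
    refine h2.trans ?_
    rw [Real.rpow_neg hc.le, Real.rpow_neg h0.le]
    have e1 : Real.exp (-(c * ‖ξ‖)) * Real.exp (c * (1 + ‖ξ‖)) = Real.exp c := by
      rw [← Real.exp_add]; congr 1; ring
    have hA : 0 < c ^ ((d : ℝ) + 1) := by positivity
    have hB : 0 < (1 + ‖ξ‖) ^ ((d : ℝ) + 1) := by positivity
    rw [show C * Real.exp c * (c ^ ((d : ℝ) + 1))⁻¹ * ((1 + ‖ξ‖) ^ ((d : ℝ) + 1))⁻¹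
      = C * Real.exp c / (c ^ ((d : ℝ) + 1) * (1 + ‖ξ‖) ^ ((d : ℝ) + 1)) by field_simp,
      le_div_iff₀ (by positivity)]
    calc _ ≤ Real.exp (-(c * ‖ξ‖)) * (C * Real.exp (c * (1 + ‖ξ‖))) := by gcongr
      _ = C * (Real.exp (-(c * ‖ξ‖)) * Real.exp (c * (1 + ‖ξ‖))) := by ring
      _ = _ := by rw [e1]

lemma integrable_exp_neg_mul_cosh {c : ℝ} (hc : 0 < c) :
    Integrable fun θ : ℝ => Real.exp (-(c * Real.cosh θ)) := by
  refine ((integrable_cosh_rpow_neg one_pos).const_mul c⁻¹).mono' ?_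
    (Eventually.of_forall fun θ => ?_)
  · exact Continuous.aestronglyMeasurable (by have := Real.continuous_cosh; fun_prop)
  · have := Real.cosh_pos θ
    rw [Real.norm_of_nonneg (Real.exp_pos _).le, Real.rpow_neg_one, ← mul_inv]
    exact exp_neg_le_inv (by positivity)

end Slicing

/-! ### The kernel as an integral over the rapidity -/

section RapidityRepresentation

/-- The integrand of the damped kernel without the factor `e^{ix·ξ}`: complex time `t + iδ`
makes it integrable. -/
noncomputable def dampedSymbol (d : ℕ) (κ t δ : ℝ) (ξ : EuclideanSpace ℝ (Fin d)) : ℂ :=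
  cexp (I * (t + δ * I) * japaneseBracket ξ)
    * (japaneseBracket ξ : ℂ) ^ (-((((d : ℝ) + 1) / 2 : ℝ) + 2 * κ * I))

/-- The transversal integral `∫ ⟨η⟩^{-b} e^{iλ⟨η⟩} dη` over `ℝⁿ`. -/
noncomputable def transversalIntegral (n : ℕ) (b l : ℂ) : ℂ :=
  ∫ η : EuclideanSpace ℝ (Fin n), (japaneseBracket η : ℂ) ^ (-b) * cexp (I * l * japaneseBracket η)

lemma norm_cpow_ofReal_of_pos {w : ℝ} (hw : 0 < w) (a κ : ℝ) :
    ‖(w : ℂ) ^ (-((a : ℂ) + 2 * κ * I))‖ = w ^ (-a) := by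
  rw [Complex.norm_cpow_eq_rpow_re_of_pos hw]
  congr 1; simp

lemma norm_cexp_damped (t δ w : ℝ) : ‖cexp (I * (t + δ * I) * w)‖ = Real.exp (-(δ * w)) := by
  rw [Complex.norm_exp]; congr 1; simp

lemma norm_dampedSymbol_le (d : ℕ) (κ t δ : ℝ) (ξ : EuclideanSpace ℝ (Fin d)) :
    ‖dampedSymbol d κ t δ ξ‖ ≤ Real.exp (-(δ * japaneseBracket ξ)) := by
  have h1 := one_le_japaneseBracket ξ
  rw [dampedSymbol, norm_mul, norm_cexp_damped, norm_cpow_ofReal_of_pos (by linarith)]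
  exact mul_le_of_le_one_right (Real.exp_pos _).le
    (Real.rpow_le_one_of_one_le_of_nonpos h1 (by rw [neg_nonpos]; positivity))

lemma continuous_dampedSymbol (d : ℕ) (κ t δ : ℝ) : Continuous (dampedSymbol d κ t δ) := by
  have h := continuous_japaneseBracket (d := d)
  unfold dampedSymbol
  refine Continuous.mul (by fun_prop) (Continuous.cpow (by fun_prop) (by fun_prop) fun ξ => ?_)
  exact Complex.ofReal_mem_slitPlane.2 (by linarith [one_le_japaneseBracket ξ])

lemma integrable_dampedSymbol (d : ℕ) (κ t : ℝ) {δ : ℝ} (hδ : 0 < δ) :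
    Integrable (dampedSymbol d κ t δ) :=
  (integrable_exp_neg_mul_japaneseBracket hδ).mono'
    (continuous_dampedSymbol d κ t δ).aestronglyMeasurable
    (Eventually.of_forall fun ξ => norm_dampedSymbol_le d κ t δ ξ)

lemma conePhase_eq (r t δ θ : ℝ) : conePhase (t + r) (t - r) δ θ
    = r * Real.sinh θ + (t + δ * I) * Real.cosh θ := by
  rw [conePhase, Complex.ofReal_sinh, Complex.ofReal_cosh, Complex.sinh, Complex.cosh]
  push_cast; ring

/-- With `ξ = (⟨η⟩ sinh θ, η)` the kernel becomes an integral over the rapidity `θ`. -/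
lemma oscIntegral_dampedSymbol {n : ℕ} {s : ℝ} (hs : s = n / 2) (κ t : ℝ) {δ : ℝ} (hδ : 0 < δ)
    (x : EuclideanSpace ℝ (Fin (n + 1))) :
    oscIntegral (dampedSymbol (n + 1) κ t δ) x
      = ∫ θ : ℝ, Complex.cosh θ ^ (-((s : ℂ) + 2 * κ * I)) * transversalIntegral n
          ((s : ℂ) + 2 * κ * I) (conePhase (t + ‖x‖) (t - ‖x‖) δ θ) := by
  set b : ℂ := (s : ℂ) + 2 * κ * I with hb
  have hs0 : 0 ≤ s := by rw [hs]; positivity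
  set f : ℝ → ℂ := fun ρ => cexp (I * (t + δ * I) * (√(1 + ρ ^ 2) : ℝ))
    * ((√(1 + ρ ^ 2) : ℝ) : ℂ) ^ (-(b + 1)) with hf
  have hsym : dampedSymbol (n + 1) κ t δ = fun ξ => f ‖ξ‖ := by
    ext ξ
    rw [dampedSymbol, hf, hb, hs]
    simp only [japaneseBracket]
    congr 2
    push_cast; ring
  have hint : Integrable fun ξ : EuclideanSpace ℝ (Fin (n + 1)) => f ‖ξ‖ := by
    rw [← hsym]; exact integrable_dampedSymbol _ κ t hδ
  rw [hsym, integral_radial_eq_integral_prod x hint]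
  set H : EuclideanSpace ℝ (Fin n) → ℝ → ℂ := fun η θ => Complex.cosh θ ^ (-b) *
    ((japaneseBracket η : ℂ) ^ (-b) *
      cexp (I * conePhase (t + ‖x‖) (t - ‖x‖) δ θ * japaneseBracket η)) with hH
  have hinner : ∀ η : EuclideanSpace ℝ (Fin n), (∫ a : ℝ, cexp (I * ((‖x‖ * a : ℝ) : ℂ)) *
      f (√(a ^ 2 + ‖η‖ ^ 2))) = ∫ θ : ℝ, H η θ := fun η => by
    have hη := one_le_japaneseBracket η
    have hη0 : 0 < japaneseBracket η := by linarith
    have hηsq : japaneseBracket η ^ 2 = 1 + ‖η‖ ^ 2 := Real.sq_sqrt (by positivity)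
    rw [integral_comp_mul_sinh hη0]
    congr 1
    ext θ
    have hc := Real.cosh_pos θ
    have hw : √(1 + √((japaneseBracket η * Real.sinh θ) ^ 2 + ‖η‖ ^ 2) ^ 2)
        = japaneseBracket η * Real.cosh θ := by
      rw [Real.sq_sqrt (by positivity), ← Real.sqrt_sq (mul_pos hη0 hc).le]
      congr 1
      rw [mul_pow, mul_pow, Real.cosh_sq]
      linear_combination -hηsq
    have hw0 : ((japaneseBracket η * Real.cosh θ : ℝ) : ℂ) ≠ 0 := by
      exact_mod_cast (mul_pos hη0 hc).ne'
    simp only [hf, hH]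
    rw [hw, neg_add, Complex.cpow_add _ _ hw0, Complex.cpow_neg_one, Complex.ofReal_mul
      (japaneseBracket η) (Real.cosh θ), Complex.mul_cpow_ofReal_nonneg hη0.le hc.le, conePhase_eq]
    have hJ0 : (japaneseBracket η : ℂ) ≠ 0 := by exact_mod_cast hη0.ne'
    have hC0 : (Real.cosh θ : ℂ) ≠ 0 := by exact_mod_cast hc.ne'
    have e1 : cexp (I * ((‖x‖ * (japaneseBracket η * Real.sinh θ) : ℝ) : ℂ))
        * cexp (I * (t + δ * I) * (japaneseBracket η * Real.cosh θ))
        = cexp (I * (‖x‖ * Real.sinh θ + (t + δ * I) * Real.cosh θ) * japaneseBracket η) := by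
      rw [← Complex.exp_add]; congr 1; push_cast; ring
    rw [← e1, ← Complex.ofReal_cosh]
    field_simp
  simp only [hinner]
  have hHint : Integrable (Function.uncurry H) (volume.prod volume) := by
    have hd := (integrable_exp_neg_mul_japaneseBracket (d := n) (half_pos hδ)).mul_prod
      (integrable_exp_neg_mul_cosh (half_pos hδ))
    refine hd.mono' ?_ (Eventually.of_forall fun ⟨η, θ⟩ => ?_)
    · refine Continuous.aestronglyMeasurable ?_
      have h := continuous_japaneseBracket (d := n)
      have h' : Continuous (conePhase (t + ‖x‖) (t - ‖x‖) δ) := by unfold conePhase; fun_prop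
      simp only [hH, Function.uncurry_def]
      refine Continuous.mul ?_ (Continuous.mul ?_ (by fun_prop))
      · refine Continuous.cpow (by fun_prop) (by fun_prop) fun p => ?_
        rw [← Complex.ofReal_cosh]
        exact Complex.ofReal_mem_slitPlane.2 (Real.cosh_pos _)
      · refine Continuous.cpow (by fun_prop) (by fun_prop) fun p => ?_
        exact Complex.ofReal_mem_slitPlane.2 (by linarith [one_le_japaneseBracket p.1])
    · have hη := one_le_japaneseBracket η
      have hc := Real.one_le_cosh θ
      simp only [hH, Function.uncurry_apply_pair]
      rw [norm_mul, norm_mul, ← Complex.ofReal_cosh, hb, norm_cpow_ofReal_of_pos (by linarith),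
        norm_cpow_ofReal_of_pos (by linarith)]
      have h1 : Real.cosh θ ^ (-s) ≤ 1 := Real.rpow_le_one_of_one_le_of_nonpos hc (by linarith)
      have h2 : japaneseBracket η ^ (-s) ≤ 1 :=
        Real.rpow_le_one_of_one_le_of_nonpos hη (by linarith)
      have h3 : ‖cexp (I * conePhase (t + ‖x‖) (t - ‖x‖) δ θ * japaneseBracket η)‖
          = Real.exp (-(δ * (Real.cosh θ * japaneseBracket η))) := by
        rw [Complex.norm_exp, conePhase_eq]
        congr 1
        simp [-Complex.ofReal_cosh, -Complex.ofReal_sinh]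
        ring
      rw [h3, ← Real.exp_add]
      have h4 : Real.exp (-(δ * (Real.cosh θ * japaneseBracket η)))
          ≤ Real.exp (-(δ / 2 * japaneseBracket η) + -(δ / 2 * Real.cosh θ)) := by
        refine Real.exp_le_exp.2 ?_
        -- `xy ≥ (x + y)/2` for `x, y ≥ 1`
        nlinarith [mul_nonneg hδ.le (mul_nonneg (sub_nonneg.2 hη) (sub_nonneg.2 hc)),
          mul_nonneg hδ.le (add_nonneg (sub_nonneg.2 hη) (sub_nonneg.2 hc)),
          mul_nonneg hδ.le (mul_nonneg (by linarith : 0 ≤ japaneseBracket η - 1)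
            (by linarith : 0 ≤ Real.cosh θ))]
      have h5 : 0 ≤ Real.cosh θ ^ (-s) := by positivity
      have h6 : 0 ≤ japaneseBracket η ^ (-s) := Real.rpow_nonneg (by linarith) _
      calc _ ≤ 1 * (1 * Real.exp (-(δ * (Real.cosh θ * japaneseBracket η)))) := by gcongr
        _ ≤ _ := by rw [one_mul, one_mul]; exact h4
  rw [integral_integral_swap hHint]
  congr 1
  ext θ
  simp only [hH, transversalIntegral]
  rw [integral_const_mul]

lemma transversalIntegral_zero (b l : ℂ) : transversalIntegral 0 b l = cexp (I * l) := by
  rw [transversalIntegral, volume_euclideanSpace_eq_dirac, integral_dirac]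
  simp [japaneseBracket]

lemma exists_transversalIntegral_eq {n : ℕ} (hn : 1 ≤ n) :
    ∃ c : ℝ, 0 ≤ c ∧ ∀ b l : ℂ, transversalIntegral n b l = c * radialG n b l := by
  have : Nonempty (Fin n) := ⟨⟨0, hn⟩⟩
  refine ⟨n * volume.real (Metric.ball (0 : EuclideanSpace ℝ (Fin n)) 1), by positivity,
    fun b l => ?_⟩
  have h := integral_fun_norm_addHaar (volume : Measure (EuclideanSpace ℝ (Fin n)))
    (fun ρ : ℝ => ((√(1 + ρ ^ 2) : ℝ) : ℂ) ^ (-b) * cexp (I * l * (√(1 + ρ ^ 2) : ℝ)))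
  rw [transversalIntegral]
  simp only [japaneseBracket]
  rw [h, finrank_euclideanSpace_fin, radialG, nsmul_eq_mul, Complex.real_smul]
  push_cast
  rw [mul_assoc]
  congr 3
  ext ρ
  rw [radialIntegrand, Complex.real_smul]
  push_cast
  ring

end RapidityRepresentation

/-! ### The bound of the damped kernel -/

section DampedKernel

lemma exists_norm_oscIntegral_dampedSymbol_le_of_nonneg {n : ℕ} {s : ℝ} (hs : s = n / 2) :
    ∃ C : ℝ, 0 < C ∧ ∀ (κ t δ : ℝ) (x : EuclideanSpace ℝ (Fin (n + 1))), 0 ≤ t → 0 < δ →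
      (δ ≤ t ∨ n = 0) → ‖(κ : ℂ) * oscIntegral (dampedSymbol (n + 1) κ t δ) x‖
        ≤ C * (1 + |κ|) ^ (s + 1) * t ^ (-s) := by
  rcases Nat.eq_zero_or_pos n with rfl | hn
  · obtain ⟨C, hC, h⟩ := exists_norm_integral_lineIntegrand_le
    have hs0 : s = 0 := by rw [hs]; simp
    refine ⟨C, hC, fun κ t δ x ht hδ _ => ?_⟩
    rw [oscIntegral_dampedSymbol hs κ t hδ x]
    simp only [transversalIntegral_zero, hs0, ofReal_zero, zero_add, neg_zero, Real.rpow_one,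
      Real.rpow_zero, mul_one]
    refine h κ (t + ‖x‖) (t - ‖x‖) δ (by positivity) hδ ?_
    rcases le_or_gt (t - ‖x‖) 0 with h1 | h1
    · exact Or.inl h1
    · have := norm_nonneg x
      exact Or.inr (by linarith)
  · obtain ⟨C, hC, h⟩ := exists_norm_integral_coneIntegrand_le hn hs
    obtain ⟨c, hc, hcb⟩ := exists_transversalIntegral_eq hn
    have hs0 : 0 ≤ s := by rw [hs]; positivity
    refine ⟨c * C + 1, by positivity, fun κ t δ x _ hδ hδt => ?_⟩
    have hδt : δ ≤ t := hδt.resolve_right hn.ne'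
    have ht : 0 < t := hδ.trans_le hδt
    have hx := norm_nonneg x
    have hp : 0 < t + ‖x‖ := by linarith
    have h1 := h κ (t + ‖x‖) (t - ‖x‖) δ hp hδ (by linarith)
    have h2 : (t + ‖x‖) ^ (-s) ≤ t ^ (-s) :=
      Real.rpow_le_rpow_of_nonpos ht (by linarith) (by linarith)
    have hκ := abs_nonneg κ
    have h3 : oscIntegral (dampedSymbol (n + 1) κ t δ) x
        = c * ∫ θ : ℝ, coneIntegrand n s κ (t + ‖x‖) (t - ‖x‖) δ θ := by
      rw [oscIntegral_dampedSymbol hs κ t hδ x, ← integral_const_mul]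
      congr 1
      ext θ
      rw [hcb, coneIntegrand]
      ring
    rw [h3, mul_left_comm, norm_mul, Complex.norm_real, Real.norm_of_nonneg hc]
    calc _ ≤ c * (C * (1 + |κ|) ^ (s + 1) * t ^ (-s)) := by
          gcongr
          exact h1.trans (by gcongr)
      _ = c * C * ((1 + |κ|) ^ (s + 1) * t ^ (-s)) := by ring
      _ ≤ (c * C + 1) * ((1 + |κ|) ^ (s + 1) * t ^ (-s)) := by gcongr; linarith
      _ = _ := by ring

lemma conj_dampedSymbol (d : ℕ) (κ t δ : ℝ) (ξ : EuclideanSpace ℝ (Fin d)) :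
    (starRingEnd ℂ) (dampedSymbol d κ t δ ξ) = dampedSymbol d (-κ) (-t) δ ξ := by
  have h0 : 0 < japaneseBracket ξ := by linarith [one_le_japaneseBracket ξ]
  have h1 := Complex.cpow_conj (japaneseBracket ξ : ℂ)
    (-((((d : ℝ) + 1) / 2 : ℝ) + 2 * κ * I)) (by
      rw [Complex.arg_ofReal_of_nonneg h0.le]; exact Real.pi_pos.ne)
  rw [Complex.conj_ofReal] at h1
  rw [dampedSymbol, dampedSymbol, map_mul, ← Complex.exp_conj, ← h1]
  simp only [map_mul, map_add, map_neg, Complex.conj_I, Complex.conj_ofReal, map_ofNat]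
  push_cast
  congr 2 <;> ring

/-- Complex conjugation reverses time. -/
lemma norm_oscIntegral_dampedSymbol_neg (d : ℕ) (κ t δ : ℝ) (x : EuclideanSpace ℝ (Fin d)) :
    ‖oscIntegral (dampedSymbol d κ t δ) x‖
      = ‖oscIntegral (dampedSymbol d (-κ) (-t) δ) (-x)‖ := by
  rw [← Complex.norm_conj, oscIntegral, ← integral_conj, oscIntegral]
  congr 2
  ext ξ
  rw [map_mul, conj_dampedSymbol, ← Complex.exp_conj, map_mul, Complex.conj_I, Complex.conj_ofReal,
    inner_neg_left]
  push_cast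
  congr 2
  ring

lemma exists_norm_oscIntegral_dampedSymbol_le {n : ℕ} {s : ℝ} (hs : s = n / 2) :
    ∃ C : ℝ, 0 < C ∧ ∀ (κ t δ : ℝ) (x : EuclideanSpace ℝ (Fin (n + 1))), 0 < δ →
      (δ ≤ |t| ∨ n = 0) → ‖(κ : ℂ) * oscIntegral (dampedSymbol (n + 1) κ t δ) x‖
        ≤ C * (1 + |κ|) ^ (s + 1) * |t| ^ (-s) := by
  obtain ⟨C, hC, h⟩ := exists_norm_oscIntegral_dampedSymbol_le_of_nonneg hs
  refine ⟨C, hC, fun κ t δ x hδ hδt => ?_⟩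
  rcases le_total 0 t with ht | ht
  · rw [abs_of_nonneg ht] at hδt ⊢
    exact h κ t δ x ht hδ hδt
  · rw [abs_of_nonpos ht] at hδt ⊢
    have h1 := h (-κ) (-t) δ (-x) (by linarith) hδ hδt
    rw [norm_mul, ← norm_oscIntegral_dampedSymbol_neg, abs_neg, Complex.norm_real, norm_neg] at h1
    rwa [norm_mul, Complex.norm_real]

end DampedKernel

/-! ### Removing the damping -/

section Limit

lemma kleinGordonIntegrand_eq {d : ℕ} (ψ : ℝ → ℂ) (κ ε : ℝ) (x : EuclideanSpace ℝ (Fin d)) (t : ℝ)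
    (ξ : EuclideanSpace ℝ (Fin d)) : kleinGordonIntegrand ψ κ ε x t ξ
      = cexp (I * (inner ℝ x ξ : ℝ)) * (dampedSymbol d κ t 0 ξ * ψ (ε * ‖ξ‖)) := by
  have h0 : 0 < japaneseBracket ξ := by linarith [one_le_japaneseBracket ξ]
  have h1 : (1 + ‖ξ‖ ^ 2 : ℝ) = japaneseBracket ξ * japaneseBracket ξ :=
    (Real.mul_self_sqrt (by positivity)).symm
  have h2 : (japaneseBracket ξ : ℂ) ≠ 0 := by exact_mod_cast h0.ne'
  rw [kleinGordonIntegrand, dampedSymbol, h1, Complex.ofReal_mul,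
    Complex.mul_cpow_ofReal_nonneg h0.le h0.le, ← Complex.cpow_add _ _ h2]
  have e1 : -((d : ℂ) + 1) / 4 - I * κ + (-((d : ℂ) + 1) / 4 - I * κ)
      = -((((d : ℝ) + 1) / 2 : ℝ) + 2 * κ * I) := by push_cast; ring
  have e2 : cexp (I * ((inner ℝ x ξ + t * japaneseBracket ξ : ℝ) : ℂ))
      = cexp (I * (inner ℝ x ξ : ℝ)) * cexp (I * (t + (0 : ℝ) * I) * japaneseBracket ξ) := by
    rw [← Complex.exp_add]; congr 1; push_cast; ring
  rw [e1, e2]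
  ring

lemma integrable_comp_norm {V : Type*} [NormedAddCommGroup V] [NormedSpace ℝ V]
    [FiniteDimensional ℝ V] [MeasureSpace V] [BorelSpace V]
    [IsFiniteMeasureOnCompacts (volume : Measure V)] {ψ : ℝ → ℂ} (hψ : Continuous ψ)
    (hsupp : tsupport ψ ⊆ Ioo (-1 : ℝ) 1) {ε : ℝ} (hε : 0 < ε) :
    Integrable fun ξ : V => ψ (ε * ‖ξ‖) := by
  have : ProperSpace V := FiniteDimensional.proper ℝ V
  refine Continuous.integrable_of_hasCompactSupport (by fun_prop)
    (HasCompactSupport.of_support_subset_isCompact (isCompact_closedBall (0 : V) (1 / ε))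
      fun ξ hξ => ?_)
  have h1 := hsupp (subset_tsupport ψ (Function.mem_support.1 hξ))
  rw [mem_closedBall_zero_iff, le_div_iff₀ hε, mul_comm]
  exact h1.2.le

/-- The undamped kernel is the limit of damped ones. -/
lemma tendsto_oscIntegral_dampedSymbol {d : ℕ} {ψ : ℝ → ℂ} (hψ : Continuous ψ)
    (hsupp : tsupport ψ ⊆ Ioo (-1 : ℝ) 1) (κ : ℝ) {ε : ℝ} (hε : 0 < ε)
    (x : EuclideanSpace ℝ (Fin d)) (t : ℝ) :
    Tendsto (fun δ : ℝ => oscIntegral (fun ξ => κ * dampedSymbol d κ t δ ξ * ψ (ε * ‖ξ‖)) x)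
      (𝓝[>] 0) (𝓝 (κ * kleinGordonJ ψ κ ε x t)) := by
  rw [kleinGordonJ, ← integral_const_mul]
  refine tendsto_integral_filter_of_dominated_convergence (fun ξ => |κ| * ‖ψ (ε * ‖ξ‖)‖)
    (Eventually.of_forall fun δ => ?_) ?_ ((integrable_comp_norm hψ hsupp hε).norm.const_mul _)
    (Eventually.of_forall fun ξ => ?_)
  · have := continuous_dampedSymbol d κ t δ
    exact Continuous.aestronglyMeasurable (by fun_prop)
  · filter_upwards [self_mem_nhdsWithin] with δ hδ
    refine Eventually.of_forall fun ξ => ?_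
    have hδ0 : 0 < δ := hδ
    have h0 : 0 < japaneseBracket ξ := by linarith [one_le_japaneseBracket ξ]
    rw [norm_mul, norm_cexp_I_mul_ofReal, one_mul, norm_mul, norm_mul, Complex.norm_real,
      Real.norm_eq_abs]
    gcongr
    refine mul_le_of_le_one_right (abs_nonneg κ) ((norm_dampedSymbol_le d κ t δ ξ).trans ?_)
    rw [Real.exp_le_one_iff, neg_nonpos]
    positivity
  · rw [kleinGordonIntegrand_eq]
    have h1 : Continuous fun δ : ℝ => cexp (I * (inner ℝ x ξ : ℝ)) *
        (κ * dampedSymbol d κ t δ ξ * ψ (ε * ‖ξ‖)) := by unfold dampedSymbol; fun_prop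
    have h2 := (h1.tendsto 0).mono_left (nhdsWithin_le_nhds (s := Ioi 0))
    rwa [mul_assoc (κ : ℂ), mul_left_comm] at h2

end Limit

/-- For `d ≥ 2` the value `t = 0` is left out, since the right-hand side is then infinite
(whereas the power of `0` is `0` in Lean); for `d = 1` the exponent is `0` and `t = 0` is allowed. -/
theorem proposition3p3 (d : ℕ) (hd : 1 ≤ d) (ψ : ℝ → ℂ) (hψ : ContDiff ℝ ∞ ψ)
    (hc : HasCompactSupport ψ) (hsupp : tsupport ψ ⊆ Set.Ioo (-1 : ℝ) 1) :
    ∃ C N : ℝ, 0 < N ∧ ∀ (κ ε : ℝ), 0 < ε → ∀ (x : EuclideanSpace ℝ (Fin d)) (t : ℝ),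
      (t ≠ 0 ∨ d = 1) →
        ‖(κ : ℂ) * kleinGordonJ ψ κ ε x t‖ ≤
          C * (1 + |κ|) ^ N * |t| ^ (-((d : ℝ) - 1) / 2) := by
  obtain ⟨n, rfl⟩ : ∃ n, d = n + 1 := ⟨d - 1, by omega⟩
  obtain ⟨A, hA, hAm⟩ :=
    exists_isSupMultiplier_radial (V := EuclideanSpace ℝ (Fin (n + 1))) hψ hsupp
  obtain ⟨C, hC, hCb⟩ := exists_norm_oscIntegral_dampedSymbol_le (n := n) rfl
  refine ⟨A * C, (n : ℝ) / 2 + 1, by positivity, fun κ ε hε x t ht => ?_⟩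
  have hexp : -(((n + 1 : ℕ) : ℝ) - 1) / 2 = -((n : ℝ) / 2) := by push_cast; ring
  rw [hexp]
  refine le_of_tendsto
    (tendsto_oscIntegral_dampedSymbol hψ.continuous hsupp κ hε x t).norm ?_
  have hev : ∀ᶠ δ : ℝ in 𝓝[>] 0, δ ≤ |t| ∨ n = 0 := by
    rcases ht with ht | ht
    · filter_upwards [nhdsWithin_le_nhds (Iic_mem_nhds (abs_pos.2 ht))] with δ hδ
      exact Or.inl hδ
    · exact Eventually.of_forall fun δ => Or.inr (by omega)
  filter_upwards [hev, self_mem_nhdsWithin] with δ hδt hδ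
  have hδ0 : 0 < δ := hδ
  have h := hAm ε hε (fun ξ => κ * dampedSymbol (n + 1) κ t δ ξ)
    ((integrable_dampedSymbol (n + 1) κ t hδ0).const_mul _)
    (C * (1 + |κ|) ^ ((n : ℝ) / 2 + 1) * |t| ^ (-((n : ℝ) / 2))) (fun y => ?_) x
  · refine h.trans (le_of_eq ?_)
    ring
  · have h1 : oscIntegral (fun ξ => κ * dampedSymbol (n + 1) κ t δ ξ) y
        = κ * oscIntegral (dampedSymbol (n + 1) κ t δ) y := by
      rw [oscIntegral, oscIntegral, ← integral_const_mul]
      congr 1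
      ext ξ
      ring
    rw [h1]
    exact hCb κ t δ y hδ0 hδt
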